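/- **Model.** In the plane, macro base stations (MBSs, tier 1) and helpers (tier 2) form independent homogeneous Poisson point processes $\Phi_1=\{x_{1,j}\}$, $\Phi_2=\{x_{2,j}\}$ with intensities $\lambda_1,\lambda_2>0$ and transmit powers $P_1,P_2>0$; the user density is $\lambda_u>0$, the path loss exponent is $2<\alpha\le 4$, the noise power is $\sigma^2\ge 0$, the bandwidth is $W>0$, the rate demand is $R_0>0$ and the backhaul capacity of an MBS is $C_b>0$. The tagged user sits at the origin and $z_{i,j}=\|x_{i,j}\|$. All fading variables $h_{i,j}$ are i.i.d. exponential with mean $1$. The contents $1,\dots,N$ have Zipf popularities $q_n=n^{-\gamma}/\sum_{k=1}^N k^{-\gamma}$ with $\gamma\ge 0$; the first group is $\{1,\dots,N_{Mp}\}$ and the second group is $\{N_{Mp}+1,\dots,N\}$, $N_{Mp}<N$. Each helper independently stores $N_2\le N-N_{Mp}$ contents of the second group, each of them with the same probability $p_{Lp}=N_2/(N-N_{Mp})$. Put $Q_{Mp}=\sum_{n\le N_{Mp}}q_n$, $Q_{Lp}=1-Q_{Mp}$, $$A_{Lp,1}=\frac{\lambda_1P_1^{2/\alpha}}{\lambda_1P_1^{2/\alpha}+p_{Lp}\lambda_2P_2^{2/\alpha}},\quad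 A_{Lp,2}=1-A_{Lp,1},\quad A_1=Q_{Mp}+Q_{Lp}A_{Lp,1},\quad A_2=Q_{Lp}A_{Lp,2},\quad p_b=\frac{Q_{Lp}A_{Lp,1}}{A_1}.$$ Each helper is independently active with probability $p_a=1-\bigl(1+\tfrac{A_2\lambda_u}{3.5\lambda_2}\bigr)^{-3.5}$, and only active helpers interfere. The load $L_1$ of the serving MBS (the number of its users, tagged user included) has the distribution $$\Pr(L_1=l+1)=P_{L_1}(l+1)=\frac{3.5^{3.5}}{l!}\,\frac{\Gamma(l+4.5)}{\Gamma(3.5)}\Bigl(\frac{A_1\lambda_u}{\lambda_1}\Bigr)^{l}\Bigl(3.5+\frac{A_1\lambda_u}{\lambda_1}\Bigr)^{-(l+4.5)},\qquad l=0,1,2,\dots$$ Given $L_1$, each of the other $L_1-1$ users of the serving MBS independently needs its backhaul link with probability $p_b$. If the tagged user and $m$ other users need it, all of them are scheduled when $m+1\le N_b:=\lfloor C_b/R_0\rfloor$, and otherwise $N_b$ of them are picked uniformly at random; the backhaul rate $R^b_{Lp,1}$ of the tagged user is $R_0$ if it is scheduled and $0$ otherwise. Locations, fading, caches and activity of the base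 stations, and the load together with the backhaul scheduling, are mutually independent. The tagged user requests a content $n$ of the second group and associates with the base station that maximizes $P_iz_{i,j}^{-\alpha}$ among all MBSs and all helpers storing $n$. If this is an MBS $x_0$ at distance $z_0$ with fading $h_0$ (an event again denoted by $A_{Lp,1}$), the access rate is $$R^w_{Lp,1}=\frac{W}{L_1}\log_2\Bigl(1+\frac{P_1h_0z_0^{-\alpha}}{I+\sigma^2}\Bigr),$$ where $I$ is the sum of the received powers $P_ih_{i,j}z_{i,j}^{-\alpha}$ of all MBSs other than $x_0$ and of all active helpers, whether or not they store $n$. **Lemma.** (i) The successful access delivery probability $C^w_{Lp,1}=\Pr\bigl(R^w_{Lp,1}\ge R_0,\ A_{Lp,1}\bigr)$ is $$C^w_{Lp,1}=\int_0^\infty\sum_{l=0}^\infty 2\pi\lambda_1z\,\exp\bigl(-z^\alpha P_1^{-1}\delta_1\sigma^2\bigr)\exp\Bigl(-\pi\lambda_1z^2\bigl(\xi_1G(\delta_1,\alpha)+\varsigma_1H(\delta_1,\alpha)+\zeta_1\bigr)\Bigr)P_{L_1}(l+1)\,dz,$$ where the sum and the integral converge, $\delta_1=2^{(l+1)R_0/W}-1$,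 $$\xi_1=\frac{\lambda_1P_1^{2/\alpha}+p_ap_{Lp}\lambda_2P_2^{2/\alpha}}{\lambda_1P_1^{2/\alpha}},\quad \varsigma_1=\frac{p_a(1-p_{Lp})\lambda_2P_2^{2/\alpha}}{\lambda_1P_1^{2/\alpha}},\quad \zeta_1=\frac{\lambda_1P_1^{2/\alpha}+p_{Lp}\lambda_2P_2^{2/\alpha}}{\lambda_1P_1^{2/\alpha}},$$ $$G(x,y)=\frac{2x}{y-2}\,{}_2F_1\Bigl(1,1-\frac2y;2-\frac2y;-x\Bigr),\qquad H(x,y)=\frac2y\,x^{2/y}B\Bigl(\frac2y,1-\frac2y\Bigr),$$ ${}_2F_1$ being the Gauss hypergeometric function (analytically continued to the negative axis) and $B$ the Beta function. (ii) For every $l\ge 0$ the successful backhaul delivery probability, given that the tagged user is associated with an MBS whose load is $l+1$, is $$C^b_{Lp,1}(l+1)=\Pr\bigl(R^b_{Lp,1}\ge R_0\mid A_{Lp,1},\,L_1=l+1\bigr)=\sum_{m=0}^{l}\binom{l}{m}(1-p_b)^{l-m}p_b^{\,m}\min\Bigl\{1,\frac{N_b}{m+1}\Bigr\}.$$ -/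

import Mathlib

open MeasureTheory ProbabilityTheory

noncomputable section

namespace HetNet

/-! ## Special functions -/

/-- The Gauss hypergeometric function `₂F₁(a, b; c; x)` for real `0 < b < c` and real `x < 1`,
given by Euler's integral.  (Mathlib's `ordinaryHypergeometric` is the sum of the power series and
takes the junk value `0` where the series does not converge, whereas arbitrarily large negative
arguments are needed here.) -/
def hyp2F1 (a b c x : ℝ) : ℝ :=
  Real.Gamma c / (Real.Gamma b * Real.Gamma (c - b)) *
    ∫ t in (0 : ℝ)..1, t ^ (b - 1) * (1 - t) ^ (c - b - 1) * (1 - x * t) ^ (-a)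

/-- `G(x, y) = 2x / (y - 2) · ₂F₁(1, 1 - 2/y; 2 - 2/y; -x)`. -/
def G (x y : ℝ) : ℝ :=
  2 * x / (y - 2) * hyp2F1 1 (1 - 2 / y) (2 - 2 / y) (-x)

/-- `H(x, y) = (2/y) x^(2/y) B(2/y, 1 - 2/y)`, where `B` is the Beta function. -/
def H (x y : ℝ) : ℝ :=
  2 / y * x ^ (2 / y) * ProbabilityTheory.beta (2 / y) (1 - 2 / y)

/-! ## Network parameters -/

/-- The parameters of the two-tier network. Tier 1: macro base stations; tier 2: helpers. -/
structure Params where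
  /-- density of the macro base stations -/
  lam1 : ℝ
  /-- density of the helpers -/
  lam2 : ℝ
  /-- density of the users -/
  lamU : ℝ
  /-- transmit power of a macro base station -/
  P1 : ℝ
  /-- transmit power of a helper -/
  P2 : ℝ
  /-- path loss exponent -/
  α : ℝ
  /-- noise power `σ²` -/
  noise : ℝ
  /-- bandwidth -/
  W : ℝ
  /-- rate demand -/
  R0 : ℝ
  /-- backhaul capacity of a macro base station -/
  Cb : ℝ
  /-- Zipf shape parameter -/
  γ : ℝ
  /-- number of contents; the contents are `1, …, N` in order of decreasing popularity -/
  N : ℕ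
  /-- number of contents in the first group -/
  NMp : ℕ
  /-- number of contents stored by a helper -/
  N2 : ℕ
  lam1_pos : 0 < lam1
  lam2_pos : 0 < lam2
  lamU_pos : 0 < lamU
  P1_pos : 0 < P1
  P2_pos : 0 < P2
  two_lt_α : 2 < α
  α_le_four : α ≤ 4
  noise_nonneg : 0 ≤ noise
  W_pos : 0 < W
  R0_pos : 0 < R0
  Cb_pos : 0 < Cb
  γ_nonneg : 0 ≤ γ
  NMp_lt : NMp < N
  N2_le : N2 ≤ N - NMp

namespace Params

variable (p : Params)

/-- The second content group `{N_Mp + 1, …, N}`. -/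
def secondGroup : Finset ℕ := Finset.Ioc p.NMp p.N

/-- Zipf popularity of the `n`-th content. -/
def q (n : ℕ) : ℝ :=
  (n : ℝ) ^ (-p.γ) / ∑ k ∈ Finset.Icc 1 p.N, (k : ℝ) ^ (-p.γ)

/-- Probability that a content of the first group is requested. -/
def QMp : ℝ := ∑ n ∈ Finset.Icc 1 p.NMp, p.q n

/-- Probability that a content of the second group is requested. -/
def QLp : ℝ := ∑ n ∈ p.secondGroup, p.q n

/-- Caching probability `p_Lp = N₂ / N_Lp` of a second-group content at a helper. -/
def pLp : ℝ := (p.N2 : ℝ) / ((p.N - p.NMp : ℕ) : ℝ)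

/-- `λ₁ P₁^(2/α) + p_Lp λ₂ P₂^(2/α)`. -/
def assocDen : ℝ := p.lam1 * p.P1 ^ (2 / p.α) + p.pLp * p.lam2 * p.P2 ^ (2 / p.α)

/-- `A_{Lp,1}`. -/
def ALp1 : ℝ := p.lam1 * p.P1 ^ (2 / p.α) / p.assocDen

/-- `A_{Lp,2}`. -/
def ALp2 : ℝ := p.pLp * p.lam2 * p.P2 ^ (2 / p.α) / p.assocDen

/-- `A₁ = Q_Mp + Q_Lp A_{Lp,1}`. -/
def A1 : ℝ := p.QMp + p.QLp * p.ALp1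

/-- `A₂ = Q_Lp A_{Lp,2}`. -/
def A2 : ℝ := p.QLp * p.ALp2

/-- Probability `p_b` that a user of a macro base station needs the backhaul link. -/
def pb : ℝ := p.QLp * p.ALp1 / p.A1

/-- Probability `p_a` that a helper is active. -/
def pa : ℝ := 1 - (1 + p.A2 * p.lamU / (3.5 * p.lam2)) ^ (-(3.5 : ℝ))

/-- `P_{L₁}(l + 1)`: the probability that the load of a macro base station is `l + 1`. -/
def loadPMF (l : ℕ) : ℝ :=
  (3.5 : ℝ) ^ (3.5 : ℝ) / (l.factorial : ℝ) * (Real.Gamma (l + 4.5) / Real.Gamma 3.5) *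
    (p.A1 * p.lamU / p.lam1) ^ l *
    (3.5 + p.A1 * p.lamU / p.lam1) ^ (-((l : ℝ) + 4.5))

/-- `N_b`: the number of users to which the backhaul link can deliver at rate `R₀`. -/
def Nb : ℕ := ⌊p.Cb / p.R0⌋₊

/-- SINR threshold `δ₁` of a macro base station whose load is `l + 1`. -/
def δ1 (l : ℕ) : ℝ := (2 : ℝ) ^ (((l : ℝ) + 1) * (p.R0 / p.W)) - 1

def ξ1 : ℝ :=
  (p.lam1 * p.P1 ^ (2 / p.α) + p.pa * p.pLp * p.lam2 * p.P2 ^ (2 / p.α)) /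
    (p.lam1 * p.P1 ^ (2 / p.α))

def ς1 : ℝ :=
  p.pa * (1 - p.pLp) * p.lam2 * p.P2 ^ (2 / p.α) / (p.lam1 * p.P1 ^ (2 / p.α))

def ζ1 : ℝ :=
  (p.lam1 * p.P1 ^ (2 / p.α) + p.pLp * p.lam2 * p.P2 ^ (2 / p.α)) /
    (p.lam1 * p.P1 ^ (2 / p.α))

/-- The term of index `l` of the integral–sum formula, at serving distance `z`. -/
def term (z : ℝ) (l : ℕ) : ℝ :=
  2 * Real.pi * p.lam1 * z * Real.exp (-(z ^ p.α * p.P1⁻¹ * p.δ1 l * p.noise)) *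
    Real.exp (-(Real.pi * p.lam1 * z ^ 2 *
      (p.ξ1 * G (p.δ1 l) p.α + p.ς1 * H (p.δ1 l) p.α + p.ζ1))) *
    p.loadPMF l

end Params

/-! ## The random network -/

/-- The two-dimensional Euclidean plane; the tagged user sits at the origin. -/
abbrev Plane := EuclideanSpace ℝ (Fin 2)

/-- The random points `x 0, x 1, …` form a homogeneous Poisson point process of intensity `lam`
in the plane. -/
structure IsPoissonProcess {Ω : Type*} [MeasurableSpace Ω] (μ : Measure Ω) (lam : ℝ)
    (x : ℕ → Ω → Plane) : Prop where
  measurable : ∀ j, Measurable (x j)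
  count_law : ∀ B : Set Plane, MeasurableSet B → volume B ≠ ⊤ →
    HasLaw (fun ω => {j | x j ω ∈ B}.encard)
      ((poissonMeasure (lam.toNNReal * (volume B).toNNReal)).map (fun k : ℕ => (k : ℕ∞))) μ
  count_indep : ∀ (k : ℕ) (B : Fin k → Set Plane), (∀ i, MeasurableSet (B i)) →
    (∀ i, volume (B i) ≠ ⊤) → Pairwise (fun i i' => Disjoint (B i) (B i')) →
    iIndepFun (fun i ω => {j | x j ω ∈ B i}.encard) μ

/-- The random network seen by the tagged user: locations and fading of the base stations of both
tiers, caches and activity of the helpers, and load and backhaul scheduling at the macro base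
station serving the tagged user. -/
structure Network (p : Params) {Ω : Type*} [MeasurableSpace Ω] (μ : Measure Ω) where
  /-- locations of the macro base stations -/
  x1 : ℕ → Ω → Plane
  /-- locations of the helpers -/
  x2 : ℕ → Ω → Plane
  /-- fading of the macro base stations -/
  h1 : ℕ → Ω → ℝ
  /-- fading of the helpers -/
  h2 : ℕ → Ω → ℝ
  /-- contents stored by the helpers -/
  cache : ℕ → Ω → Finset ℕ
  /-- whether a helper is active -/
  active : ℕ → Ω → Bool
  /-- load `L₁` of the serving macro base station: number of its users, tagged user included -/
  load : Ω → ℕ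
  /-- The users of the serving macro base station are numbered `0, …, L₁ - 1`, the tagged user
  being `0`; for `u ≥ 1`, `miss u` says whether user `u` needs the backhaul link. -/
  miss : ℕ → Ω → Bool
  /-- users scheduled on the backhaul link when the tagged user needs it -/
  sched : Ω → Finset ℕ
  ppp1 : IsPoissonProcess μ p.lam1 x1
  ppp2 : IsPoissonProcess μ p.lam2 x2
  h1_meas : ∀ j, Measurable (h1 j)
  h1_law : ∀ j, HasLaw (h1 j) (expMeasure 1) μ
  h1_indep : iIndepFun h1 μ
  h2_meas : ∀ j, Measurable (h2 j)
  h2_law : ∀ j, HasLaw (h2 j) (expMeasure 1) μ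
  h2_indep : iIndepFun h2 μ
  cache_meas : ∀ j, Measurable (cache j)
  cache_sub : ∀ j, ∀ᵐ ω ∂μ, cache j ω ⊆ p.secondGroup ∧ (cache j ω).card = p.N2
  cache_law : ∀ j, ∀ n ∈ p.secondGroup, μ.real {ω | n ∈ cache j ω} = p.pLp
  cache_indep : iIndepFun cache μ
  active_meas : ∀ j, Measurable (active j)
  active_law : ∀ j, μ.real {ω | active j ω = true} = p.pa
  active_indep : iIndepFun active μ
  load_meas : Measurable load
  load_law : ∀ l : ℕ, μ.real {ω | load ω = l + 1} = p.loadPMF l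
  miss_meas : ∀ u, Measurable (miss u)
  miss_law : ∀ u, μ.real {ω | miss u ω = true} = p.pb
  miss_indep : iIndepFun miss μ
  load_miss_indep : IndepFun load (fun ω u => miss u ω) μ
  sched_meas : Measurable sched
  /-- Given the load and the set `U` of users needing the backhaul link, the scheduled set is
  uniformly distributed over the subsets of `U` with `min N_b |U|` elements. -/
  sched_law : ∀ (l : ℕ) (U T : Finset ℕ), T ⊆ U → T.card = min p.Nb U.card →
    μ.real {ω | load ω = l ∧
        (Finset.range (load ω)).filter (fun u => u = 0 ∨ miss u ω = true) = U ∧ sched ω = T} =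
      μ.real {ω | load ω = l ∧
        (Finset.range (load ω)).filter (fun u => u = 0 ∨ miss u ω = true) = U} /
      (U.card.choose (min p.Nb U.card) : ℝ)
  /-- Locations, fading, caches, activity, and the pair load/backhaul are mutually independent. -/
  indep : iIndep ![
    MeasurableSpace.comap (fun ω j => x1 j ω) inferInstance,
    MeasurableSpace.comap (fun ω j => x2 j ω) inferInstance,
    MeasurableSpace.comap (fun ω j => h1 j ω) inferInstance,
    MeasurableSpace.comap (fun ω j => h2 j ω) inferInstance,
    MeasurableSpace.comap (fun ω j => cache j ω) inferInstance,
    MeasurableSpace.comap (fun ω j => active j ω) inferInstance,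
    MeasurableSpace.comap (fun ω => (load ω, (fun u => miss u ω), sched ω)) inferInstance] μ

namespace Network

variable {p : Params} {Ω : Type*} [MeasurableSpace Ω] {μ : Measure Ω} (M : Network p μ)

/-- Path loss `z_{1,j}^(-α)` of the `j`-th macro base station. -/
def loss1 (j : ℕ) (ω : Ω) : ℝ := ‖M.x1 j ω‖ ^ (-p.α)

/-- Path loss `z_{2,j}^(-α)` of the `j`-th helper. -/
def loss2 (j : ℕ) (ω : Ω) : ℝ := ‖M.x2 j ω‖ ^ (-p.α)

/-- The tagged user, requesting content `n` of the second group, is associated with the `i`-th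
macro base station: it maximizes `P z^(-α)` over all macro base stations and all helpers which
store `n`. -/
def Serves (n i : ℕ) (ω : Ω) : Prop :=
  (∀ j, p.P1 * M.loss1 j ω ≤ p.P1 * M.loss1 i ω) ∧
    ∀ j, n ∈ M.cache j ω → p.P2 * M.loss2 j ω ≤ p.P1 * M.loss1 i ω

/-- Interference from the macro base stations other than the `i`-th one. -/
def I1 (i : ℕ) (ω : Ω) : ℝ :=
  ∑' j, if j = i then 0 else p.P1 * M.h1 j ω * M.loss1 j ω

/-- Interference from the active helpers which store content `n`. -/
def IPlus (n : ℕ) (ω : Ω) : ℝ :=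
  ∑' j, if M.active j ω = true ∧ n ∈ M.cache j ω then p.P2 * M.h2 j ω * M.loss2 j ω else 0

/-- Interference from the active helpers which do not store content `n`. -/
def IMinus (n : ℕ) (ω : Ω) : ℝ :=
  ∑' j, if M.active j ω = true ∧ n ∉ M.cache j ω then p.P2 * M.h2 j ω * M.loss2 j ω else 0

/-- SINR of the tagged user when served by the `i`-th macro base station. -/
def SINR (n i : ℕ) (ω : Ω) : ℝ :=
  p.P1 * M.h1 i ω * M.loss1 i ω / (M.I1 i ω + M.IPlus n ω + M.IMinus n ω + p.noise)

/-- Access rate `(W / L₁) log₂(1 + SINR)`. -/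
def accessRate (n i : ℕ) (ω : Ω) : ℝ :=
  p.W / (M.load ω : ℝ) * Real.logb 2 (1 + M.SINR n i ω)

/-- The tagged user, requesting `n`, is associated with a macro base station. -/
def assocMacro (n : ℕ) : Set Ω := {ω | ∃ i, M.Serves n i ω}

/-- The tagged user, requesting `n`, is associated with a macro base station whose access rate
is at least `R₀`. -/
def accessSuccess (n : ℕ) : Set Ω := {ω | ∃ i, M.Serves n i ω ∧ p.R0 ≤ M.accessRate n i ω}

/-- Backhaul rate of the tagged user: `R₀` if it is scheduled, and `0` otherwise. -/
def backhaulRate (ω : Ω) : ℝ := if 0 ∈ M.sched ω then p.R0 else 0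

end Network

end HetNet

end

noncomputable section

namespace HetNet

open Filter Topology ENNReal

/-! Access. Fix the load, hence the threshold `δ`. If the serving macro station is at distance `z`,
then SINR ≥ `δ` says that its exponential fading exceeds `δ z^α / P₁` times noise plus interference,
and given everything else this has probability `exp` of minus that quantity. The independent
families are then integrated out one at a time (`measure_serveSet`). The fading of an interferer of
relative power `s` gives `1/(1+s)`, the activity of a helper gives a mixture of this with `1`, and a
helper stronger than the server must not store `n`, which gives `1 - p_Lp`. The helper locations
give `exp(-λ₂ ∫ (1 - factor))` by the probability generating functional of a Poisson process. In
polar coordinates the integral of `s/(1+s)` is a multiple of `G` outside a disc (Euler's integral)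
and a multiple of `H` over the whole plane (Beta integral).

The location of the server is handled by squeezing, without Palm calculus. Let `serveMass` assign to
a set of distances the mean contribution of serving stations at those distances. On a ring it is
bounded above through the mean number of stations in the ring and below through the event that the
ring holds exactly one. Both bounds are exact values of a generating functional that also carries a
function of the count in the ring (`lintegral_cnt_mul_infProd`), and they agree to first order in
the width of the ring. The one-sided fundamental theorem of calculus then identifies the density
(`measure_Ico_of_squeeze`, `tsum_lintegral_serve`). The load is independent of the radio part, so
`measure_accessSuccess` mixes the result over the load.

These computations live in `[0, ∞]`, where sums and products always exist. Almost sure summability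
of the interference (`ae_summable`) links them to the real-valued SINR.

Backhaul. Association is independent of load and scheduling, so conditioning on it changes nothing.
Given load `l + 1`, the number `m` of other users needing the link is binomial, and a uniform set of
`min N_b (m+1)` among `m + 1` users contains the tagged one with probability `min 1 (N_b/(m+1))`. -/

/-! ## Exponentials and infinite products in `[0, 1]` -/

/-- `exp (-t)` for an extended nonnegative real `t`. -/
def expNeg (t : ℝ≥0∞) : ℝ≥0∞ := EReal.exp (-(t : EReal))

/-- The infinite product of factors that are at most `1`. -/
def infProd (a : ℕ → ℝ≥0∞) : ℝ≥0∞ := ⨅ m, ∏ j ∈ Finset.range m, a j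

/-- `-log v` for `v ≤ 1`. -/
def negLog (v : ℝ≥0∞) : ℝ≥0∞ := (-(ENNReal.log v)).toENNReal

@[simp] lemma expNeg_zero : expNeg 0 = 1 := by simp [expNeg]

@[simp] lemma expNeg_top : expNeg ⊤ = 0 := by simp [expNeg]

lemma expNeg_antitone : Antitone expNeg := fun a b h =>
  EReal.exp_monotone (EReal.neg_le_neg_iff.2 (by exact_mod_cast h))

lemma continuous_expNeg : Continuous expNeg :=
  ENNReal.continuous_exp.comp (continuous_neg.comp continuous_coe_ennreal_ereal)

@[fun_prop] lemma measurable_expNeg : Measurable expNeg := continuous_expNeg.measurable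

lemma expNeg_le_one (t : ℝ≥0∞) : expNeg t ≤ 1 := by
  simpa using expNeg_antitone (zero_le : (0 : ℝ≥0∞) ≤ t)

lemma expNeg_ne_top (t : ℝ≥0∞) : expNeg t ≠ ⊤ := ((expNeg_le_one t).trans_lt one_lt_top).ne

lemma expNeg_add (a b : ℝ≥0∞) : expNeg (a + b) = expNeg a * expNeg b := by
  unfold expNeg
  rw [← EReal.exp_add, EReal.coe_ennreal_add, EReal.neg_add (Or.inl (by simp)) (Or.inr (by simp)),
    sub_eq_add_neg]

lemma expNeg_ofReal {r : ℝ} (hr : 0 ≤ r) :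
    expNeg (ENNReal.ofReal r) = ENNReal.ofReal (Real.exp (-r)) := by
  unfold expNeg
  rw [EReal.coe_ennreal_ofReal, max_eq_left hr, ← EReal.coe_neg, EReal.exp_coe]

lemma expNeg_sum {ι : Type*} (s : Finset ι) (f : ι → ℝ≥0∞) :
    expNeg (∑ i ∈ s, f i) = ∏ i ∈ s, expNeg (f i) := by
  classical
  induction s using Finset.induction_on with
  | empty => simp
  | insert a s ha ih => rw [Finset.sum_insert ha, Finset.prod_insert ha, expNeg_add, ih]

lemma expNeg_iSup {ι : Sort*} [Nonempty ι] (f : ι → ℝ≥0∞) : expNeg (⨆ i, f i) = ⨅ i, expNeg (f i) :=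
  expNeg_antitone.map_ciSup_of_continuousAt continuous_expNeg.continuousAt

/-- No summability is needed: a divergent sum is `⊤`, and the partial products then decrease to
`expNeg ⊤ = 0`. -/
lemma expNeg_tsum (f : ℕ → ℝ≥0∞) : expNeg (∑' j, f j) = infProd fun j => expNeg (f j) := by
  rw [ENNReal.tsum_eq_iSup_nat, expNeg_iSup, infProd]
  simp_rw [expNeg_sum]

lemma expNeg_negLog {v : ℝ≥0∞} (hv : v ≤ 1) : expNeg (negLog v) = v := by
  unfold expNeg negLog
  rw [EReal.coe_toENNReal, neg_neg, ENNReal.exp_log]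
  rw [EReal.neg_nonneg]
  simpa using hv

@[simp] lemma negLog_one : negLog 1 = 0 := by simp [negLog]

@[fun_prop] lemma measurable_negLog : Measurable negLog := by
  unfold negLog
  fun_prop

lemma infProd_eq_expNeg {a : ℕ → ℝ≥0∞} (ha : ∀ j, a j ≤ 1) :
    infProd a = expNeg (∑' j, negLog (a j)) := by
  rw [expNeg_tsum]
  simp_rw [expNeg_negLog (ha _)]

lemma infProd_mono {a b : ℕ → ℝ≥0∞} (h : ∀ j, a j ≤ b j) : infProd a ≤ infProd b :=
  iInf_mono fun _ => Finset.prod_le_prod' fun j _ => h j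

lemma infProd_mul {a b : ℕ → ℝ≥0∞} (ha : ∀ j, a j ≤ 1) (hb : ∀ j, b j ≤ 1) :
    infProd (fun j => a j * b j) = infProd a * infProd b := by
  have h : ∀ j, a j * b j = expNeg (negLog (a j) + negLog (b j)) := fun j => by
    rw [expNeg_add, expNeg_negLog (ha j), expNeg_negLog (hb j)]
  simp_rw [h]
  rw [← expNeg_tsum, ENNReal.tsum_add, expNeg_add, infProd_eq_expNeg ha, infProd_eq_expNeg hb]

/-- Writes the event that no index satisfies `P` as a product, so that `lintegral_infProd` can
average it over independent caches. -/
lemma infProd_zero_one {P : ℕ → Prop} [DecidablePred P] [Decidable (∃ j, P j)] :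
    infProd (fun j => if P j then 0 else 1) = if ∃ j, P j then 0 else 1 := by
  split_ifs with h
  · obtain ⟨j, hj⟩ := h
    refine le_antisymm ((iInf_le _ (j + 1)).trans (le_of_eq ?_)) zero_le
    exact Finset.prod_eq_zero (i := j) (by simp) (by simp [hj])
  · push Not at h
    simp [infProd, h]

@[fun_prop] lemma measurable_infProd {β : Type*} [MeasurableSpace β] {f : β → ℕ → ℝ≥0∞}
    (hf : ∀ j, Measurable fun b => f b j) : Measurable fun b => infProd (f b) :=
  Measurable.iInf fun _ => Finset.measurable_fun_prod _ fun j _ => hf j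

lemma antitone_prod_range {a : ℕ → ℝ≥0∞} (ha : ∀ j, a j ≤ 1) :
    Antitone fun m => ∏ j ∈ Finset.range m, a j :=
  antitone_nat_of_succ_le fun m => by
    rw [Finset.prod_range_succ]
    exact mul_le_of_le_one_right' (ha m)

/-- The mean of an infinite product of independent factors. -/
lemma lintegral_infProd {Ω : Type*} [MeasurableSpace Ω] {μ : Measure Ω} [IsProbabilityMeasure μ]
    {X : ℕ → Ω → ℝ≥0∞} (hX : ∀ j, Measurable (X j)) (hind : iIndepFun X μ)
    (h1 : ∀ j ω, X j ω ≤ 1) :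
    ∫⁻ ω, infProd (fun j => X j ω) ∂μ = infProd fun j => ∫⁻ ω, X j ω ∂μ := by
  unfold infProd
  -- Monotone convergence for a decreasing sequence: the partial products decrease, and the empty
  -- one has the finite integral `1`.
  rw [lintegral_iInf (fun m => Finset.measurable_fun_prod _ fun j _ => hX j)
    (fun m k hmk ω => antitone_prod_range (fun j => h1 j ω) hmk) (by simp)]
  refine iInf_congr fun m => ?_
  exact lintegral_prod_eq_prod_lintegral_of_indepFun _ X hind hX

/-- Integration with respect to two independent random elements, one after the other. -/
lemma lintegral_indepFun {Ω β γ : Type*} [MeasurableSpace Ω] [MeasurableSpace β]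
    [MeasurableSpace γ] {μ : Measure Ω} [IsProbabilityMeasure μ] {Y : Ω → β} {Z : Ω → γ}
    (hY : Measurable Y) (hZ : Measurable Z) (h : IndepFun Y Z μ) {φ : β × γ → ℝ≥0∞}
    (hφ : Measurable φ) :
    ∫⁻ ω, φ (Y ω, Z ω) ∂μ = ∫⁻ ω, ∫⁻ ω', φ (Y ω, Z ω') ∂μ ∂μ := by
  have := Measure.isProbabilityMeasure_map (μ := μ) hZ.aemeasurable
  rw [← lintegral_map hφ (hY.prodMk hZ),
    (indepFun_iff_map_prod_eq_prod_map_map hY.aemeasurable hZ.aemeasurable).1 h,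
    lintegral_prod _ hφ.aemeasurable, lintegral_map hφ.lintegral_prod_right' hY]
  refine lintegral_congr fun ω => ?_
  exact lintegral_map (hφ.comp measurable_prodMk_left) hZ

/-! ## Poisson point processes -/

/-- The number of points in `B`. -/
def cnt {Ω : Type*} (x : ℕ → Ω → Plane) (B : Set Plane) (ω : Ω) : ℕ∞ := {j | x j ω ∈ B}.encard

lemma toENNReal_encard_eq_tsum (s : Set ℕ) :
    ((s.encard : ℕ∞) : ℝ≥0∞) = ∑' j, s.indicator 1 j := by
  rw [← tsum_subtype, ← ENNReal.tsum_set_one s]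
  simp

lemma toENNReal_cnt {Ω : Type*} (x : ℕ → Ω → Plane) (B : Set Plane) (ω : Ω) :
    ((cnt x B ω : ℕ∞) : ℝ≥0∞) = ∑' j, B.indicator 1 (x j ω) :=
  toENNReal_encard_eq_tsum _

lemma lintegral_cnt {Ω : Type*} [MeasurableSpace Ω] {μ : Measure Ω} {lam : ℝ} {x : ℕ → Ω → Plane}
    (hx : IsPoissonProcess μ lam x)
    {B : Set Plane} (hB : MeasurableSet B) (hB' : volume B ≠ ⊤) (φ : ℕ∞ → ℝ≥0∞) :
    ∫⁻ ω, φ (cnt x B ω) ∂μ = ∑' k : ℕ, ENNReal.ofReal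
      (Real.exp (-(lam.toNNReal * (volume B).toNNReal : NNReal)) *
        (lam.toNNReal * (volume B).toNNReal : NNReal) ^ k / k.factorial) * φ k := by
  have h := hx.count_law B hB hB'
  have hφ : Measurable φ := measurable_of_countable φ
  calc _ = ∫⁻ n, φ n ∂(μ.map (cnt x B)) := (lintegral_map' hφ.aemeasurable h.aemeasurable).symm
    _ = _ := by
      have : μ.map (cnt x B) = _ := h.map_eq
      rw [this, lintegral_map hφ (measurable_of_countable _), poissonMeasure,
        lintegral_sum_measure]
      simp [lintegral_smul_measure]

/-- The law of the count gives almost everywhere measurability only. Full measurability comes from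
the sum of indicators in `ℝ≥0∞`, since `ℕ∞` is countable and embeds injectively. -/
lemma measurable_cnt {Ω : Type*} [MeasurableSpace Ω] {μ : Measure Ω} {lam : ℝ} {x : ℕ → Ω → Plane}
    (hx : IsPoissonProcess μ lam x) {B : Set Plane} (hB : MeasurableSet B) :
    Measurable (cnt x B) := by
  have h : Measurable fun ω => ((cnt x B ω : ℕ∞) : ℝ≥0∞) := by
    simp_rw [toENNReal_cnt]
    refine Measurable.tsum fun j => ?_
    exact (measurable_one.indicator hB).comp (hx.measurable j)
  refine measurable_to_countable' fun n => ?_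
  have : cnt x B ⁻¹' {n} = (fun ω => ((cnt x B ω : ℕ∞) : ℝ≥0∞)) ⁻¹' {((n : ℕ∞) : ℝ≥0∞)} := by
    ext ω; simp
  rw [this]
  exact h (measurableSet_singleton _)

lemma expNeg_mul_natCast (c : ℝ≥0∞) (k : ℕ) : expNeg (c * k) = expNeg c ^ k := by
  simpa [mul_comm] using expNeg_sum (Finset.range k) fun _ => c

/-- The generating function of a Poisson variable, obtained from the exponential series at `r q`. -/
lemma tsum_poisson_mul_pow (r : NNReal) {q : ℝ≥0∞} (hq : q ≤ 1) :
    ∑' k : ℕ, ENNReal.ofReal (Real.exp (-(r : ℝ)) * (r : ℝ) ^ k / k.factorial) * q ^ k =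
      expNeg (r * (1 - q)) := by
  lift q to NNReal using (hq.trans_lt one_lt_top).ne
  have hq' : q ≤ 1 := by exact_mod_cast hq
  have h : ∀ k : ℕ, ENNReal.ofReal (Real.exp (-(r : ℝ)) * (r : ℝ) ^ k / k.factorial) * (q : ℝ≥0∞) ^ k
      = ENNReal.ofReal (Real.exp (-(r : ℝ)) * (((r : ℝ) * q) ^ k / k.factorial)) := fun k => by
    rw [← ENNReal.ofReal_coe_nnreal (p := q), ← ENNReal.ofReal_pow q.coe_nonneg,
      ← ENNReal.ofReal_mul (by positivity)]
    congr 1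
    rw [mul_pow]
    ring
  have hs : HasSum (fun k : ℕ => Real.exp (-(r : ℝ)) * (((r : ℝ) * q) ^ k / k.factorial))
      (Real.exp (-(r : ℝ)) * Real.exp (r * q)) := by
    rw [Real.exp_eq_exp_ℝ]
    exact (NormedSpace.expSeries_div_hasSum_exp (𝔸 := ℝ) ((r : ℝ) * q)).mul_left _
  simp_rw [h]
  rw [← ENNReal.ofReal_tsum_of_nonneg (fun k => by positivity) hs.summable, hs.tsum_eq,
    ← Real.exp_add]
  have : (r : ℝ≥0∞) * (1 - q) = ENNReal.ofReal (r * (1 - q)) := by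
    rw [ENNReal.ofReal_mul r.coe_nonneg, ENNReal.ofReal_sub _ q.coe_nonneg]
    simp
  rw [this, expNeg_ofReal (mul_nonneg r.coe_nonneg (by
    have : (q : ℝ) ≤ 1 := by exact_mod_cast hq'
    linarith))]
  congr 2
  ring

lemma coe_toNNReal_mul_volume {lam : ℝ} {B : Set Plane} (hB' : volume B ≠ ⊤) :
    ((lam.toNNReal * (volume B).toNNReal : NNReal) : ℝ≥0∞) = ENNReal.ofReal lam * volume B := by
  rw [ENNReal.coe_mul, ENNReal.coe_toNNReal hB']
  rfl

section Poisson

variable {Ω : Type*} [MeasurableSpace Ω] {μ : Measure Ω} {lam : ℝ} {x : ℕ → Ω → Plane}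

lemma lintegral_expNeg_cnt (hx : IsPoissonProcess μ lam x)
    {B : Set Plane} (hB : MeasurableSet B) (hB' : volume B ≠ ⊤) (c : ℝ≥0∞) :
    ∫⁻ ω, expNeg (c * (cnt x B ω : ℕ∞)) ∂μ =
      expNeg (ENNReal.ofReal lam * ((1 - expNeg c) * volume B)) := by
  rw [lintegral_cnt hx hB hB' fun n => expNeg (c * (n : ℕ∞))]
  simp only [ENat.toENNReal_coe, expNeg_mul_natCast]
  rw [tsum_poisson_mul_pow _ (expNeg_le_one c), coe_toNNReal_mul_volume hB', mul_assoc,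
    mul_comm (volume B)]

lemma lintegral_cnt_self (hx : IsPoissonProcess μ lam x)
    {B : Set Plane} (hB : MeasurableSet B) (hB' : volume B ≠ ⊤) :
    ∫⁻ ω, ((cnt x B ω : ℕ∞) : ℝ≥0∞) ∂μ = ENNReal.ofReal lam * volume B := by
  rw [lintegral_cnt hx hB hB' fun n => (n : ℝ≥0∞), ← coe_toNNReal_mul_volume hB']
  set r := lam.toNNReal * (volume B).toNNReal
  -- The term `k = 0` vanishes and `(k+1)/(k+1)! = 1/k!`, so the shifted series is `r` times the
  -- total mass, which is `tsum_poisson_mul_pow` at `q = 1`.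
  rw [tsum_eq_zero_add' ENNReal.summable]
  have h : ∀ k : ℕ, ENNReal.ofReal (Real.exp (-(r : ℝ)) * (r : ℝ) ^ (k + 1) / (k + 1).factorial) *
      (((k + 1 : ℕ) : ℕ∞) : ℝ≥0∞) =
      r * (ENNReal.ofReal (Real.exp (-(r : ℝ)) * (r : ℝ) ^ k / k.factorial) * 1 ^ k) := fun k => by
    rw [one_pow, mul_one, ENat.toENNReal_coe, ← ENNReal.ofReal_natCast,
      ← ENNReal.ofReal_coe_nnreal (p := r), ← ENNReal.ofReal_mul (by positivity),
      ← ENNReal.ofReal_mul (by positivity), Nat.factorial_succ]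
    congr 1
    push_cast
    field_simp
    ring
  simp_rw [h]
  rw [ENNReal.tsum_mul_left, tsum_poisson_mul_pow r le_rfl]
  simp

lemma lintegral_cnt_eq_one (hx : IsPoissonProcess μ lam x)
    {B : Set Plane} (hB : MeasurableSet B) (hB' : volume B ≠ ⊤) :
    ∫⁻ ω, (if cnt x B ω = 1 then 1 else 0) ∂μ =
      ENNReal.ofReal lam * volume B * expNeg (ENNReal.ofReal lam * volume B) := by
  rw [lintegral_cnt hx hB hB' fun n => if n = 1 then 1 else 0, ← coe_toNNReal_mul_volume hB']
  set r := lam.toNNReal * (volume B).toNNReal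
  rw [tsum_eq_single 1]
  · rw [← ENNReal.ofReal_coe_nnreal (p := r), expNeg_ofReal r.coe_nonneg,
      ← ENNReal.ofReal_mul r.coe_nonneg]
    simp [mul_comm]
  · intro k hk
    simp [hk]

omit [MeasurableSpace Ω] in
lemma tsum_eq_simpleFunc_sum (g : SimpleFunc Plane ℝ≥0∞) (ω : Ω) :
    ∑' j, g (x j ω) = ∑ c ∈ g.range, c * (cnt x (g ⁻¹' {c}) ω : ℕ∞) := by
  have h : ∀ y, g y = ∑ c ∈ g.range, c * (g ⁻¹' {c}).indicator 1 y := fun y => by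
    rw [Finset.sum_eq_single (g y)]
    · simp
    · intro c _ hc
      simp [Set.indicator, hc.symm]
    · intro hy
      exact absurd (SimpleFunc.mem_range_self g y) hy
  simp_rw [toENNReal_cnt, ← ENNReal.tsum_mul_left]
  rw [← Summable.tsum_finsetSum fun _ _ => ENNReal.summable]
  exact tsum_congr fun j => h _

/-- The set `R` and the level sets of `g` at nonzero values are disjoint and of finite area. Their
counts are therefore independent, the mean factorizes, and each level set contributes a Poisson
generating function. -/
lemma lintegral_cnt_mul_expNeg_simpleFunc (hx : IsPoissonProcess μ lam x) {R : Set Plane}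
    (hR : MeasurableSet R) (hR' : volume R ≠ ⊤) (φ : ℕ∞ → ℝ≥0∞) (g : SimpleFunc Plane ℝ≥0∞)
    (hg : ∀ c ≠ 0, volume (g ⁻¹' {c}) ≠ ⊤) (hgR : ∀ y ∈ R, g y = 0) :
    ∫⁻ ω, φ (cnt x R ω) * expNeg (∑' j, g (x j ω)) ∂μ =
      (∫⁻ ω, φ (cnt x R ω) ∂μ) * expNeg (ENNReal.ofReal lam * ∫⁻ y, (1 - expNeg (g y))) := by
  classical
  let s : Finset ℝ≥0∞ := g.range.filter (· ≠ 0)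
  -- `none` stands for `R` and `some c` for the level set of `c`. The value `0` is left out: its
  -- level set may have infinite area, and it contributes the factor `1`.
  let B : Option s → Set Plane := fun o => o.elim R fun c => g ⁻¹' {c.1}
  have hBm : ∀ o, MeasurableSet (B o) := by
    rintro (_ | c)
    · exact hR
    · exact g.measurableSet_preimage _
  have hBv : ∀ o, volume (B o) ≠ ⊤ := by
    rintro (_ | c)
    · exact hR'
    · exact hg _ (Finset.mem_filter.1 c.2).2
  have hBd : Pairwise fun o o' => Disjoint (B o) (B o') := by
    have hR0 : ∀ c : s, Disjoint R (g ⁻¹' {c.1}) := fun c => by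
      rw [Set.disjoint_left]
      intro y hy hy'
      exact (Finset.mem_filter.1 c.2).2 (by rw [← hgR y hy]; exact hy'.symm)
    rintro (_ | c) (_ | c') h
    · exact absurd rfl h
    · exact hR0 c'
    · exact (hR0 c).symm
    · rw [Set.disjoint_left]
      intro y hy hy'
      exact h (congrArg some (Subtype.ext (hy.symm.trans hy')))
  let e := Fintype.equivFin (Option s)
  have hind : iIndepFun (fun o => cnt x (B o)) μ := by
    have := hx.count_indep _ (fun i => B (e.symm i)) (fun i => hBm _) (fun i => hBv _)
      (fun i i' h => hBd fun h' => h (e.symm.injective h'))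
    have h2 := this.precomp e.injective
    simp only [Equiv.symm_apply_apply] at h2
    exact h2
  let ψ : Option s → ℕ∞ → ℝ≥0∞ := fun o => o.elim φ fun c n => expNeg (c.1 * n)
  have hψ : iIndepFun (fun o ω => ψ o (cnt x (B o) ω)) μ :=
    hind.comp ψ fun o => measurable_of_countable _
  have hsum : ∀ ω, φ (cnt x R ω) * expNeg (∑' j, g (x j ω)) = ∏ o, ψ o (cnt x (B o) ω) := by
    intro ω
    rw [Fintype.prod_option, tsum_eq_simpleFunc_sum]
    congr 1
    rw [← Finset.sum_filter_of_ne (p := (· ≠ 0)) (fun c _ h h0 => h (by simp [h0])), expNeg_sum,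
      ← Finset.prod_coe_sort]
    rfl
  simp_rw [hsum]
  rw [lintegral_prod_eq_prod_lintegral_of_indepFun Finset.univ _ hψ fun o =>
    (measurable_of_countable (ψ o)).comp (measurable_cnt hx (hBm o)), Fintype.prod_option]
  congr 1
  have h1 : ∀ c : s, ∫⁻ ω, ψ (some c) (cnt x (B (some c)) ω) ∂μ =
      expNeg (ENNReal.ofReal lam * ((1 - expNeg c.1) * volume (g ⁻¹' {c.1}))) := fun c =>
    lintegral_expNeg_cnt hx (hBm (some c)) (hBv (some c)) c.1
  simp_rw [h1]
  rw [← expNeg_sum, ← Finset.mul_sum]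
  congr 2
  have h2 : ∫⁻ y, (1 - expNeg (g y)) = (g.map fun c => 1 - expNeg c).lintegral volume := by
    rw [← SimpleFunc.lintegral_eq_lintegral]
    rfl
  rw [h2, SimpleFunc.map_lintegral,
    Finset.sum_coe_sort s fun c => (1 - expNeg c) * volume (g ⁻¹' {c})]
  exact Finset.sum_filter_of_ne (p := (· ≠ 0)) fun c _ h h0 => h (by simp [h0])

/-- The probability generating functional of a Poisson point process, with a factor that depends
on the number of points in a region `R` on which `v = 1`. -/
theorem lintegral_cnt_mul_infProd (hx : IsPoissonProcess μ lam x) {R : Set Plane}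
    (hR : MeasurableSet R) (hR' : volume R ≠ ⊤) (φ : ℕ∞ → ℝ≥0∞)
    (hφ : ∫⁻ ω, φ (cnt x R ω) ∂μ ≠ ⊤) {v : Plane → ℝ≥0∞} (hv : Measurable v)
    (hv1 : ∀ y, v y ≤ 1) (hvR : ∀ y ∈ R, v y = 1) :
    ∫⁻ ω, φ (cnt x R ω) * infProd (fun j => v (x j ω)) ∂μ =
      (∫⁻ ω, φ (cnt x R ω) ∂μ) * expNeg (ENNReal.ofReal lam * ∫⁻ y, (1 - v y)) := by
  let g : Plane → ℝ≥0∞ := fun y => negLog (v y)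
  have hg : Measurable g := by fun_prop
  -- Truncating to balls makes the nonzero level sets finite in area, while the truncations still
  -- increase to `g = -log v`.
  let G : ℕ → SimpleFunc Plane ℝ≥0∞ := fun n =>
    (SimpleFunc.eapprox g n).restrict (Metric.ball 0 n)
  have hGapp : ∀ n y, G n y = (Metric.ball 0 n).indicator (SimpleFunc.eapprox g n) y := fun n y =>
    SimpleFunc.restrict_apply _ measurableSet_ball _
  have hGmono : Monotone fun n y => G n y := by
    intro n m hnm y
    simp only [hGapp]
    refine (Set.indicator_le_indicator_of_subset (Metric.ball_subset_ball (by exact_mod_cast hnm))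
      (fun _ => zero_le) y).trans (Set.indicator_le_indicator ?_)
    exact SimpleFunc.monotone_eapprox g hnm y
  have hGsup : ∀ y, ⨆ n, G n y = g y := by
    intro y
    refine le_antisymm (iSup_le fun n => ?_) ?_
    · rw [hGapp]
      refine (Set.indicator_le_self _ _ _).trans ?_
      rw [← SimpleFunc.iSup_eapprox_apply hg y]
      exact le_iSup (fun n => SimpleFunc.eapprox g n y) n
    · rw [← SimpleFunc.iSup_eapprox_apply hg y]
      refine iSup_le fun n => ?_
      obtain ⟨m, hm⟩ := exists_nat_gt ‖y‖
      refine le_trans ?_ (le_iSup _ (max n m))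
      rw [hGapp, Set.indicator_of_mem]
      · exact SimpleFunc.monotone_eapprox g (le_max_left n m) y
      · rw [mem_ball_zero_iff]
        exact hm.trans_le (by exact_mod_cast le_max_right n m)
  have hGle : ∀ n y, G n y ≤ g y := fun n y => (le_iSup (fun n => G n y) n).trans (hGsup y).le
  have key : ∀ n, _ := fun n => lintegral_cnt_mul_expNeg_simpleFunc hx hR hR' φ (G n)
    (fun c hc => by
      refine ((measure_mono ?_).trans_lt (measure_ball_lt_top (μ := volume) (x := (0 : Plane))
        (r := n))).ne
      intro y hy
      by_contra h
      apply hc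
      rw [← show G n y = c from hy, hGapp, Set.indicator_of_notMem h])
    (fun y hy => le_antisymm ((hGle n y).trans (by simp [g, hvR y hy])) zero_le)
  have hφm : Measurable fun ω => φ (cnt x R ω) :=
    (measurable_of_countable φ).comp (measurable_cnt hx hR)
  have hL : Tendsto (fun n => ∫⁻ ω, φ (cnt x R ω) * expNeg (∑' j, G n (x j ω)) ∂μ) atTop
      (𝓝 (∫⁻ ω, φ (cnt x R ω) * infProd (fun j => v (x j ω)) ∂μ)) := by
    -- The exponential is at most `1`, so the integrable factor `φ` of the count dominates.
    refine tendsto_lintegral_of_dominated_convergence (fun ω => φ (cnt x R ω)) (fun n => ?_)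
      (fun n => ae_of_all _ fun ω => mul_le_of_le_one_right' (expNeg_le_one _)) hφ ?_
    · refine hφm.mul (measurable_expNeg.comp (Measurable.tsum fun j => ?_))
      exact (G n).measurable.comp (hx.measurable j)
    · filter_upwards [ae_lt_top hφm hφ] with ω hω
      refine ENNReal.Tendsto.const_mul ?_ (Or.inr hω.ne)
      rw [infProd_eq_expNeg fun j => hv1 _]
      refine (continuous_expNeg.tendsto _).comp ?_
      have hs : ∑' j, negLog (v (x j ω)) = ⨆ n, ∑' j, G n (x j ω) := by
        simp_rw [← lintegral_count]
        rw [← lintegral_iSup (f := fun n j => G n (x j ω)) (fun n => measurable_of_countable _)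
          (fun n m hnm j => hGmono hnm _)]
        refine lintegral_congr fun j => (hGsup _).symm
      rw [hs]
      exact tendsto_atTop_iSup fun n m hnm => ENNReal.tsum_le_tsum fun j => hGmono hnm _
  have hI : ⨆ n, ∫⁻ y, (1 - expNeg (G n y)) = ∫⁻ y, (1 - v y) := by
    rw [← lintegral_iSup (f := fun n y => 1 - expNeg (G n y)) (fun n => measurable_const.sub (measurable_expNeg.comp (G n).measurable))
      (fun n m hnm y => tsub_le_tsub_left (expNeg_antitone (hGmono hnm y)) 1)]
    refine lintegral_congr fun y => ?_
    rw [← ENNReal.sub_iInf, ← expNeg_iSup, hGsup, expNeg_negLog (hv1 y)]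
  have hr : Tendsto (fun n => (∫⁻ ω, φ (cnt x R ω) ∂μ) *
      expNeg (ENNReal.ofReal lam * ∫⁻ y, (1 - expNeg (G n y)))) atTop
      (𝓝 ((∫⁻ ω, φ (cnt x R ω) ∂μ) * expNeg (ENNReal.ofReal lam * ∫⁻ y, (1 - v y)))) := by
    refine ENNReal.Tendsto.const_mul ?_ (Or.inr hφ)
    refine (continuous_expNeg.tendsto _).comp (ENNReal.Tendsto.const_mul ?_ (Or.inr ofReal_ne_top))
    rw [← hI]
    exact tendsto_atTop_iSup fun n m hnm => lintegral_mono fun y =>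
      tsub_le_tsub_left (expNeg_antitone (hGmono hnm y)) 1
  simp_rw [key] at hL
  exact tendsto_nhds_unique hL hr

/-- The probability generating functional of a Poisson point process. -/
theorem lintegral_infProd_poisson [IsProbabilityMeasure μ] (hx : IsPoissonProcess μ lam x)
    {v : Plane → ℝ≥0∞} (hv : Measurable v) (hv1 : ∀ y, v y ≤ 1) :
    ∫⁻ ω, infProd (fun j => v (x j ω)) ∂μ = expNeg (ENNReal.ofReal lam * ∫⁻ y, (1 - v y)) := by
  simpa using lintegral_cnt_mul_infProd hx MeasurableSet.empty (by simp) (fun _ => 1) (by simp) hv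
    hv1 (by simp)

end Poisson

/-! ## Exponential fading -/

lemma lintegral_expMeasure {f : ℝ → ℝ≥0∞} (hf : Measurable f) :
    ∫⁻ x, f x ∂(expMeasure 1) = ∫⁻ x, exponentialPDF 1 x * f x := by
  have : expMeasure 1 = volume.withDensity (exponentialPDF 1) := rfl
  rw [this, lintegral_withDensity_eq_lintegral_mul _ (by
    exact (measurable_exponentialPDFReal 1).ennreal_ofReal) hf]
  rfl

/-- The density `e^(-x)` times `e^(-b x)` is `1/(1+b)` times the exponential density of rate `1 +
b`. -/
lemma lintegral_expNeg_expMeasure {b : ℝ≥0∞} (hb : b ≠ ⊤) :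
    ∫⁻ x, expNeg (b * ENNReal.ofReal x) ∂(expMeasure 1) = (1 + b)⁻¹ := by
  lift b to NNReal using hb
  rw [lintegral_expMeasure (by fun_prop)]
  have h : ∀ x : ℝ, exponentialPDF 1 x * expNeg (b * ENNReal.ofReal x) =
      (1 + (b : ℝ≥0∞))⁻¹ * exponentialPDF (1 + b) x := fun x => by
    rcases lt_or_ge x 0 with hx | hx
    · simp [exponentialPDF_of_neg hx]
    · rw [exponentialPDF_of_nonneg hx, exponentialPDF_of_nonneg hx,
        ← ENNReal.ofReal_coe_nnreal (p := b), ← ENNReal.ofReal_mul b.coe_nonneg,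
        expNeg_ofReal (by positivity), ← ENNReal.ofReal_one,
        ← ENNReal.ofReal_add zero_le_one b.coe_nonneg, ← ENNReal.ofReal_inv_of_pos (by positivity),
        ← ENNReal.ofReal_mul (by positivity), ← ENNReal.ofReal_mul (by positivity)]
      congr 1
      have : (1 + (b : ℝ)) ≠ 0 := by positivity
      rw [← mul_assoc, inv_mul_cancel₀ this, one_mul, one_mul, one_mul, add_mul, neg_add,
        Real.exp_add, one_mul]
  simp_rw [h]
  rw [lintegral_const_mul' _ _ (by simp), lintegral_exponentialPDF_eq_one (by positivity), mul_one]

/-- Lack of memory: on `[t, ∞)` the density is `e^(-t)` times its own translate by `t`. -/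
lemma expMeasure_le_ofReal (t : ℝ≥0∞) :
    expMeasure 1 {x : ℝ | t ≤ ENNReal.ofReal x} = expNeg t := by
  have : IsProbabilityMeasure (expMeasure 1) := isProbabilityMeasure_expMeasure one_pos
  rcases eq_or_ne t ⊤ with rfl | ht
  · simp
  rcases eq_or_ne t 0 with rfl | ht0
  · simp
  have htpos : 0 < t.toReal := ENNReal.toReal_pos ht0 ht
  have hset : {x : ℝ | t ≤ ENNReal.ofReal x} = Set.Ici t.toReal := by
    ext x
    rw [Set.mem_ofPred_eq, ← ENNReal.ofReal_toReal ht, ENNReal.ofReal_le_ofReal_iff',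
      ENNReal.toReal_ofReal htpos.le]
    simp [htpos]
  rw [hset, ← lintegral_indicator_one measurableSet_Ici,
    lintegral_expMeasure (measurable_one.indicator measurableSet_Ici)]
  have h : ∀ x, exponentialPDF 1 x * (Set.Ici t.toReal).indicator 1 x =
      expNeg t * exponentialPDF 1 (x - t.toReal) := fun x => by
    rcases lt_or_ge x t.toReal with hx | hx
    · rw [Set.indicator_of_notMem (by simpa using hx),
        exponentialPDF_of_neg (x := x - t.toReal) (by linarith)]
      simp
    · rw [Set.indicator_of_mem (by simpa using hx), exponentialPDF_of_nonneg (by linarith),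
        exponentialPDF_of_nonneg (by linarith), show expNeg t = expNeg (ENNReal.ofReal t.toReal) by
          rw [ENNReal.ofReal_toReal ht], expNeg_ofReal htpos.le, ← ENNReal.ofReal_mul (by positivity), Pi.one_apply, mul_one]
      congr 1
      rw [one_mul, one_mul, one_mul, one_mul, ← Real.exp_add]
      congr 1
      ring
  simp_rw [h]
  rw [lintegral_const_mul' _ _ (expNeg_ne_top t), lintegral_sub_right_eq_self,
    lintegral_exponentialPDF_eq_one one_pos, mul_one]

/-- Random elements that are measurable with respect to disjoint groups of independent
σ-algebras are independent. -/
lemma indepFun_of_iIndep {Ω ι β γ : Type*} [mΩ : MeasurableSpace Ω] [mβ : MeasurableSpace β]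
    [mγ : MeasurableSpace γ] {μ : Measure Ω} {m : ι → MeasurableSpace Ω} (hm : ∀ i, m i ≤ mΩ)
    (h : iIndep m μ) (S T : Set ι) (hST : Disjoint S T) {Y : Ω → β} {Z : Ω → γ}
    (hY : Measurable[⨆ i ∈ S, m i] Y) (hZ : Measurable[⨆ i ∈ T, m i] Z) : IndepFun Y Z μ :=
  (IndepFun_iff_Indep _ _ _).2 <| indep_of_indep_of_le_left
    (indep_of_indep_of_le_right (indep_iSup_of_disjoint hm h hST) hZ.comap_le) hY.comap_le

lemma measurable_iSup_of_mem {Ω ι β : Type*} [MeasurableSpace β] {m : ι → MeasurableSpace Ω}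
    {S : Set ι} {Y : Ω → β} (i : ι) (hi : i ∈ S) (hY : Measurable[m i] Y) :
    Measurable[⨆ i ∈ S, m i] Y :=
  hY.mono (le_iSup₂ (f := fun i (_ : i ∈ S) => m i) i hi) le_rfl

section Fading

variable {Ω : Type*} [MeasurableSpace Ω] {μ : Measure Ω} [IsProbabilityMeasure μ] {h : ℕ → Ω → ℝ}

/-- The Laplace transform of the interference. -/
lemma lintegral_expNeg_tsum (hm : ∀ j, Measurable (h j))
    (hl : ∀ j, HasLaw (h j) (expMeasure 1) μ) (hi : iIndepFun h μ) {b : ℕ → ℝ≥0∞}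
    (hb : ∀ j, b j ≠ ⊤) :
    ∫⁻ ω, expNeg (∑' j, b j * ENNReal.ofReal (h j ω)) ∂μ = infProd fun j => (1 + b j)⁻¹ := by
  simp_rw [expNeg_tsum]
  rw [lintegral_infProd (X := fun j ω => expNeg (b j * ENNReal.ofReal (h j ω)))
    (fun j => by have := hm j; fun_prop)
    (hi.comp (fun j x => expNeg (b j * ENNReal.ofReal x)) fun j => by fun_prop)
    (fun _ _ => expNeg_le_one _)]
  congr 1
  ext j
  rw [← lintegral_expNeg_expMeasure (hb j), ← (hl j).map_eq, lintegral_map (by fun_prop) (hm j)]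

/-- The probability that the fading of the `i`-th station exceeds a threshold that depends on the
fading of the other stations. -/
lemma measure_le_fading (hm : ∀ j, Measurable (h j))
    (hl : ∀ j, HasLaw (h j) (expMeasure 1) μ) (hi : iIndepFun h μ) (i : ℕ) (a : ℝ≥0∞)
    {b : ℕ → ℝ≥0∞} (hb : ∀ j, b j ≠ ⊤) :
    μ {ω | a + ∑' j, (if j = i then 0 else b j * ENNReal.ofReal (h j ω)) ≤ ENNReal.ofReal (h i ω)}
      = expNeg a * infProd fun j => if j = i then 1 else (1 + b j)⁻¹ := by
  -- Coordinate `i` is overwritten by `0`, so that `Y` depends on the other fadings only and is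
  -- independent of `h i`.
  let Y : Ω → ℕ → ℝ := fun ω j => if j = i then 0 else h j ω
  have hmc : ∀ j, MeasurableSpace.comap (h j) inferInstance ≤ (inferInstance : MeasurableSpace Ω) :=
    fun j => (hm j).comap_le
  have hind : IndepFun Y (h i) μ := by
    refine indepFun_of_iIndep hmc ((iIndepFun_iff_iIndep _ _ _).1 hi) {i}ᶜ {i}
      disjoint_compl_left ?_ (measurable_iSup_of_mem i rfl (comap_measurable _))
    refine @measurable_pi_lambda _ _ _ (_) _ _ fun j => ?_
    by_cases hj : j = i
    · simp only [Y, hj, if_true]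
      exact @measurable_const _ _ _ (_) _
    · simp only [Y, hj, if_false]
      exact measurable_iSup_of_mem (S := {i}ᶜ) j hj (comap_measurable _)
  have hY : Measurable Y := measurable_pi_lambda _ fun j => by
    by_cases hj : j = i
    · simp [Y, hj]
    · simpa [Y, hj] using hm j
  let thr : (ℕ → ℝ) → ℝ≥0∞ := fun y =>
    a + ∑' j, (if j = i then 0 else b j) * ENNReal.ofReal (y j)
  have hthr : Measurable thr := Measurable.add measurable_const (Measurable.tsum fun j => by fun_prop)
  have hset : ∀ ω, (a + ∑' j, (if j = i then 0 else b j * ENNReal.ofReal (h j ω)) ≤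
      ENNReal.ofReal (h i ω)) ↔ thr (Y ω) ≤ ENNReal.ofReal (h i ω) := fun ω => by
    have : ∀ j, (if j = i then 0 else b j * ENNReal.ofReal (h j ω)) =
        (if j = i then 0 else b j) * ENNReal.ofReal (Y ω j) := fun j => by
      by_cases hj : j = i <;> simp [Y, hj]
    simp only [thr, this]
  simp_rw [hset]
  let φ : (ℕ → ℝ) × ℝ → ℝ≥0∞ := {q | thr q.1 ≤ ENNReal.ofReal q.2}.indicator 1
  have hφ : MeasurableSet {q : (ℕ → ℝ) × ℝ | thr q.1 ≤ ENNReal.ofReal q.2} :=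
    measurableSet_le (hthr.comp measurable_fst) (by fun_prop)
  have hE : MeasurableSet {ω | thr (Y ω) ≤ ENNReal.ofReal (h i ω)} :=
    hφ.preimage (hY.prodMk (hm i))
  rw [← lintegral_indicator_one hE]
  calc _ = ∫⁻ ω, φ (Y ω, h i ω) ∂μ := rfl
    _ = ∫⁻ ω, ∫⁻ ω', φ (Y ω, h i ω') ∂μ ∂μ :=
        lintegral_indepFun hY (hm i) hind (measurable_one.indicator hφ)
    _ = ∫⁻ ω, expNeg (thr (Y ω)) ∂μ := by
        refine lintegral_congr fun ω => ?_
        rw [← expMeasure_le_ofReal, ← (hl i).map_eq, Measure.map_apply (hm i)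
          (measurableSet_le measurable_const (by fun_prop)),
          ← lintegral_indicator_one ((hm i) (measurableSet_le measurable_const (by fun_prop)))]
        rfl
    _ = ∫⁻ ω, expNeg a * expNeg (∑' j, (if j = i then 0 else b j) * ENNReal.ofReal (h j ω)) ∂μ := by
        refine lintegral_congr fun ω => ?_
        have : ∀ j, (if j = i then 0 else b j) * ENNReal.ofReal (Y ω j) =
            (if j = i then 0 else b j) * ENNReal.ofReal (h j ω) := fun j => by
          by_cases hj : j = i <;> simp [Y, hj]
        simp only [thr, this, expNeg_add]
    _ = _ := by
        rw [lintegral_const_mul' _ _ (expNeg_ne_top a),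
          lintegral_expNeg_tsum hm hl hi fun j => by split_ifs <;> simp [hb]]
        congr 2
        ext j
        split_ifs <;> simp

end Fading

/-! ## Integrating out fading, caches, activity and helper locations -/

namespace Params

variable (p : Params) (δ : ℝ)

/-- The power received from distance `‖y‖` at transmit power `P`, relative to the power received
from a macro base station at distance `z` divided by the threshold `δ`. -/
def relPower (P z : ℝ) (y : Plane) : ℝ≥0∞ :=
  ENNReal.ofReal (δ * z ^ p.α * p.P1⁻¹ * (P * ‖y‖ ^ (-p.α)))

/-- The noise power, on the same scale. -/
def relNoise (z : ℝ) : ℝ≥0∞ := ENNReal.ofReal (δ * z ^ p.α * p.P1⁻¹ * p.noise)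

/-- The mean factor contributed by a helper at `y`. -/
def helperFactor (z : ℝ) (y : Plane) : ℝ≥0∞ :=
  (if p.P1 * z ^ (-p.α) < p.P2 * ‖y‖ ^ (-p.α) then ENNReal.ofReal (1 - p.pLp) else 1) *
    (ENNReal.ofReal (1 - p.pa) + ENNReal.ofReal p.pa * (1 + p.relPower δ p.P2 z y)⁻¹)

/-- The factor contributed by noise and helpers, given the distance `z` of the serving macro base
station. -/
def outerFactor (z : ℝ) : ℝ≥0∞ :=
  expNeg (p.relNoise δ z) * expNeg (ENNReal.ofReal p.lam2 * ∫⁻ y, (1 - p.helperFactor δ z y))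

/-- The factor contributed by the macro base stations other than the serving one. -/
def innerFactor (i : ℕ) (x : ℕ → Plane) : ℝ≥0∞ :=
  infProd fun j => if j = i then 1 else (1 + p.relPower δ p.P1 ‖x i‖ (x j))⁻¹

lemma relPower_ne_top (P z : ℝ) (y : Plane) : p.relPower δ P z y ≠ ⊤ := ofReal_ne_top

@[fun_prop] lemma measurable_relPower {β : Type*} [MeasurableSpace β] (P : ℝ) {f : β → ℝ}
    {g : β → Plane} (hf : Measurable f) (hg : Measurable g) :
    Measurable fun b => p.relPower δ P (f b) (g b) := by
  unfold relPower
  fun_prop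

@[fun_prop] lemma measurable_relNoise {β : Type*} [MeasurableSpace β] {f : β → ℝ}
    (hf : Measurable f) : Measurable fun b => p.relNoise δ (f b) := by
  unfold relNoise
  fun_prop

@[fun_prop] lemma measurable_innerFactor (i : ℕ) : Measurable (p.innerFactor δ i) := by
  unfold innerFactor
  refine measurable_infProd fun j => ?_
  split_ifs <;> fun_prop

end Params

namespace Network

variable {p : Params} {Ω : Type*} [MeasurableSpace Ω] {μ : Measure Ω}

/-- The family of independent σ-algebras of a network. -/
@[reducible] def sigmas (M : Network p μ) : Fin 7 → MeasurableSpace Ω := ![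
    MeasurableSpace.comap (fun ω j => M.x1 j ω) inferInstance,
    MeasurableSpace.comap (fun ω j => M.x2 j ω) inferInstance,
    MeasurableSpace.comap (fun ω j => M.h1 j ω) inferInstance,
    MeasurableSpace.comap (fun ω j => M.h2 j ω) inferInstance,
    MeasurableSpace.comap (fun ω j => M.cache j ω) inferInstance,
    MeasurableSpace.comap (fun ω j => M.active j ω) inferInstance,
    MeasurableSpace.comap (fun ω => (M.load ω, (fun u => M.miss u ω), M.sched ω)) inferInstance]

variable (M : Network p μ)

lemma measurable_x1 : Measurable fun ω j => M.x1 j ω := measurable_pi_lambda _ M.ppp1.measurable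
lemma measurable_x2 : Measurable fun ω j => M.x2 j ω := measurable_pi_lambda _ M.ppp2.measurable
lemma measurable_h1 : Measurable fun ω j => M.h1 j ω := measurable_pi_lambda _ M.h1_meas
lemma measurable_h2 : Measurable fun ω j => M.h2 j ω := measurable_pi_lambda _ M.h2_meas
lemma measurable_cache : Measurable fun ω j => M.cache j ω := measurable_pi_lambda _ M.cache_meas
lemma measurable_active : Measurable fun ω j => M.active j ω :=
  measurable_pi_lambda _ M.active_meas
lemma measurable_load_miss_sched :
    Measurable fun ω => (M.load ω, (fun u => M.miss u ω), M.sched ω) :=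
  M.load_meas.prodMk ((measurable_pi_lambda _ M.miss_meas).prodMk M.sched_meas)

lemma sigmas_le (k : Fin 7) : M.sigmas k ≤ (inferInstance : MeasurableSpace Ω) := by
  fin_cases k
  · exact M.measurable_x1.comap_le
  · exact M.measurable_x2.comap_le
  · exact M.measurable_h1.comap_le
  · exact M.measurable_h2.comap_le
  · exact M.measurable_cache.comap_le
  · exact M.measurable_active.comap_le
  · exact M.measurable_load_miss_sched.comap_le

/-- Random elements of the network, grouped as in `sigmas`, are measurable. -/
lemma measurable_x1_sup {S : Set (Fin 7)} (h : 0 ∈ S) :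
    Measurable[⨆ k ∈ S, M.sigmas k] fun ω j => M.x1 j ω :=
  measurable_iSup_of_mem 0 h (comap_measurable _)
lemma measurable_x2_sup {S : Set (Fin 7)} (h : 1 ∈ S) :
    Measurable[⨆ k ∈ S, M.sigmas k] fun ω j => M.x2 j ω :=
  measurable_iSup_of_mem 1 h (comap_measurable _)
lemma measurable_h1_sup {S : Set (Fin 7)} (h : 2 ∈ S) :
    Measurable[⨆ k ∈ S, M.sigmas k] fun ω j => M.h1 j ω :=
  measurable_iSup_of_mem 2 h (comap_measurable _)
lemma measurable_h2_sup {S : Set (Fin 7)} (h : 3 ∈ S) :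
    Measurable[⨆ k ∈ S, M.sigmas k] fun ω j => M.h2 j ω :=
  measurable_iSup_of_mem 3 h (comap_measurable _)
lemma measurable_cache_sup {S : Set (Fin 7)} (h : 4 ∈ S) :
    Measurable[⨆ k ∈ S, M.sigmas k] fun ω j => M.cache j ω :=
  measurable_iSup_of_mem 4 h (comap_measurable _)
lemma measurable_active_sup {S : Set (Fin 7)} (h : 5 ∈ S) :
    Measurable[⨆ k ∈ S, M.sigmas k] fun ω j => M.active j ω :=
  measurable_iSup_of_mem 5 h (comap_measurable _)

/-- The space of locations, caches, activity and fading. -/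
abbrev RadioSpace : Type :=
  (ℕ → Plane) × (ℕ → Plane) × (ℕ → Finset ℕ) × (ℕ → Bool) × (ℕ → ℝ) × (ℕ → ℝ)

/-- The random elements that do not involve the load and the backhaul link. -/
def radio (ω : Ω) : RadioSpace :=
  (fun j => M.x1 j ω, fun j => M.x2 j ω, fun j => M.cache j ω, fun j => M.active j ω,
    fun j => M.h2 j ω, fun j => M.h1 j ω)

lemma measurable_radio : Measurable M.radio :=
  M.measurable_x1.prodMk <| M.measurable_x2.prodMk <| M.measurable_cache.prodMk <|
    M.measurable_active.prodMk <| M.measurable_h2.prodMk M.measurable_h1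

/-- Association and the fading condition are functions of `radio`, so this one independence
separates both of them from load and scheduling. -/
lemma indepFun_radio : IndepFun M.radio
    (fun ω => (M.load ω, (fun u => M.miss u ω), M.sched ω)) μ := by
  refine indepFun_of_iIndep M.sigmas_le M.indep {6}ᶜ {6} disjoint_compl_left ?_
    (measurable_iSup_of_mem 6 rfl (comap_measurable _))
  exact @Measurable.prodMk _ _ _ _ _ (_) _ _ (M.measurable_x1_sup (by decide)) <|
    @Measurable.prodMk _ _ _ _ _ (_) _ _ (M.measurable_x2_sup (by decide)) <|
    @Measurable.prodMk _ _ _ _ _ (_) _ _ (M.measurable_cache_sup (by decide)) <|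
    @Measurable.prodMk _ _ _ _ _ (_) _ _ (M.measurable_active_sup (by decide)) <|
    @Measurable.prodMk _ _ _ _ _ (_) _ _ (M.measurable_h2_sup (by decide))
    (M.measurable_h1_sup (by decide))

/-- No helper that stores `n` is received more strongly than the `i`-th macro base station. -/
def Unblocked (n i : ℕ) (ω : Ω) : Prop :=
  ∀ j, ¬(n ∈ M.cache j ω ∧ p.P1 * ‖M.x1 i ω‖ ^ (-p.α) < p.P2 * ‖M.x2 j ω‖ ^ (-p.α))

/-- The fading of the `i`-th macro base station exceeds the threshold given by noise and
interference. -/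
def Exceeds (δ : ℝ) (i : ℕ) (ω : Ω) : Prop :=
  p.relNoise δ ‖M.x1 i ω‖ +
      ∑' j, (if M.active j ω = true then p.relPower δ p.P2 ‖M.x1 i ω‖ (M.x2 j ω) else 0) *
        ENNReal.ofReal (M.h2 j ω) +
      ∑' j, (if j = i then 0 else
        p.relPower δ p.P1 ‖M.x1 i ω‖ (M.x1 j ω) * ENNReal.ofReal (M.h1 j ω)) ≤
    ENNReal.ofReal (M.h1 i ω)

/-- The event that `Unblocked` and `Exceeds` hold and the macro base stations are in `D`. -/
def serveSet (n : ℕ) (δ : ℝ) (i : ℕ) (D : Set (ℕ → Plane)) : Set Ω :=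
  {ω | (fun j => M.x1 j ω) ∈ D ∧ M.Unblocked n i ω ∧ M.Exceeds δ i ω}

/-- `serveSet` as a set of values of `radio`. -/
def serveRadio (p : Params) (n : ℕ) (δ : ℝ) (i : ℕ) (D : Set (ℕ → Plane)) :
    Set RadioSpace :=
  {q | q.1 ∈ D ∧
    (∀ j, ¬(n ∈ q.2.2.1 j ∧ p.P1 * ‖q.1 i‖ ^ (-p.α) < p.P2 * ‖q.2.1 j‖ ^ (-p.α))) ∧
    p.relNoise δ ‖q.1 i‖ +
      ∑' j, (if q.2.2.2.1 j = true then p.relPower δ p.P2 ‖q.1 i‖ (q.2.1 j) else 0) *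
        ENNReal.ofReal (q.2.2.2.2.1 j) +
      ∑' j, (if j = i then 0 else
        p.relPower δ p.P1 ‖q.1 i‖ (q.1 j) * ENNReal.ofReal (q.2.2.2.2.2 j)) ≤
    ENNReal.ofReal (q.2.2.2.2.2 i)}

lemma measurableSet_serveRadio (n : ℕ) (δ : ℝ) (i : ℕ) {D : Set (ℕ → Plane)}
    (hD : MeasurableSet D) : MeasurableSet (serveRadio p n δ i D) := by
  have h1 : ∀ j, MeasurableSet {q : RadioSpace | n ∈ q.2.2.1 j} := fun j =>
    (MeasurableSet.of_discrete (s := {c : Finset ℕ | n ∈ c})).preimage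
      (f := fun q : RadioSpace => q.2.2.1 j) (by fun_prop)
  have h2 : ∀ j, MeasurableSet {q : RadioSpace |
      p.P1 * ‖q.1 i‖ ^ (-p.α) < p.P2 * ‖q.2.1 j‖ ^ (-p.α)} := fun j =>
    measurableSet_lt (by fun_prop) (by fun_prop)
  have h3 : MeasurableSet {q : RadioSpace | ∀ j, ¬(n ∈ q.2.2.1 j ∧
      p.P1 * ‖q.1 i‖ ^ (-p.α) < p.P2 * ‖q.2.1 j‖ ^ (-p.α))} := by
    rw [Set.ofPred_forall]
    exact MeasurableSet.iInter fun j => ((h1 j).inter (h2 j)).compl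
  have h0 : Measurable fun q : RadioSpace => p.relNoise δ ‖q.1 i‖ := by fun_prop
  have h4 : Measurable fun q : RadioSpace => p.relNoise δ ‖q.1 i‖ +
      ∑' j, (if q.2.2.2.1 j = true then p.relPower δ p.P2 ‖q.1 i‖ (q.2.1 j) else 0) *
        ENNReal.ofReal (q.2.2.2.2.1 j) +
      ∑' j, (if j = i then 0 else
        p.relPower δ p.P1 ‖q.1 i‖ (q.1 j) * ENNReal.ofReal (q.2.2.2.2.2 j)) := by
    refine (h0.add (Measurable.tsum fun j => ?_)).add (Measurable.tsum fun j => ?_)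
    · refine Measurable.mul (Measurable.ite ?_ (by fun_prop) measurable_const) (by fun_prop)
      exact (measurableSet_singleton true).preimage
        (f := fun q : RadioSpace => q.2.2.2.1 j) (by fun_prop)
    · split_ifs <;> fun_prop
  exact (hD.preimage measurable_fst).inter (h3.inter (measurableSet_le h4 (by fun_prop)))

lemma serveSet_eq (n : ℕ) (δ : ℝ) (i : ℕ) (D : Set (ℕ → Plane)) :
    M.serveSet n δ i D = M.radio ⁻¹' serveRadio p n δ i D := rfl

variable [IsProbabilityMeasure μ]

/-- Given locations, caches and activity, the helper interference has a product Laplace transform,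
in which inactive helpers give the factor `1`. The weight `K` carries the factors that involve
neither helper fading nor activity, so that the same shape can be fed to `lintegral_active`. -/
lemma lintegral_h2 (δ : ℝ) (i : ℕ)
    {K : (ℕ → Plane) × (ℕ → Plane) × (ℕ → Finset ℕ) → ℝ≥0∞} (hK : Measurable K) :
    ∫⁻ ω, K (fun j => M.x1 j ω, fun j => M.x2 j ω, fun j => M.cache j ω) *
        expNeg (∑' j, (if M.active j ω = true then
          p.relPower δ p.P2 ‖M.x1 i ω‖ (M.x2 j ω) else 0) * ENNReal.ofReal (M.h2 j ω)) ∂μ =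
      ∫⁻ ω, K (fun j => M.x1 j ω, fun j => M.x2 j ω, fun j => M.cache j ω) *
        infProd (fun j => if M.active j ω = true then
          (1 + p.relPower δ p.P2 ‖M.x1 i ω‖ (M.x2 j ω))⁻¹ else 1) ∂μ := by
  let Y : Ω → (ℕ → Plane) × (ℕ → Plane) × (ℕ → Finset ℕ) × (ℕ → Bool) := fun ω =>
    (fun j => M.x1 j ω, fun j => M.x2 j ω, fun j => M.cache j ω, fun j => M.active j ω)
  have hY : Measurable Y := M.measurable_x1.prodMk <| M.measurable_x2.prodMk <|
    M.measurable_cache.prodMk M.measurable_active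
  have hind : IndepFun Y (fun ω j => M.h2 j ω) μ :=
    indepFun_of_iIndep M.sigmas_le M.indep {0, 1, 4, 5} {3} (by simp)
      (@Measurable.prodMk _ _ _ _ _ (_) _ _ (M.measurable_x1_sup (by simp)) <|
        @Measurable.prodMk _ _ _ _ _ (_) _ _ (M.measurable_x2_sup (by simp)) <|
        @Measurable.prodMk _ _ _ _ _ (_) _ _ (M.measurable_cache_sup (by simp))
        (M.measurable_active_sup (by simp)))
      (M.measurable_h2_sup (by simp))
  let φ : ((ℕ → Plane) × (ℕ → Plane) × (ℕ → Finset ℕ) × (ℕ → Bool)) × (ℕ → ℝ) → ℝ≥0∞ := fun q =>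
    K (q.1.1, q.1.2.1, q.1.2.2.1) * expNeg (∑' j, (if q.1.2.2.2 j = true then
          p.relPower δ p.P2 ‖q.1.1 i‖ (q.1.2.1 j) else 0) * ENNReal.ofReal (q.2 j))
  have hφ : Measurable φ := by
    refine Measurable.mul (by fun_prop) (measurable_expNeg.comp (Measurable.tsum fun j => ?_))
    refine Measurable.mul (Measurable.ite ?_ (by fun_prop) measurable_const) (by fun_prop)
    exact (measurableSet_singleton true).preimage (by fun_prop)
  refine (lintegral_indepFun hY M.measurable_h2 hind hφ).trans (lintegral_congr fun ω => ?_)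
  simp only [φ, Y]
  rw [lintegral_const_mul, lintegral_expNeg_tsum M.h2_meas M.h2_law M.h2_indep]
  · congr 2
    ext j
    split_ifs <;> simp
  · intro j
    split_ifs <;> simp [Params.relPower_ne_top]
  · have := M.h2_meas
    exact measurable_expNeg.comp (Measurable.tsum fun j => by fun_prop)

lemma lintegral_active_factor (j : ℕ) (c : ℝ≥0∞) :
    ∫⁻ ω, (if M.active j ω = true then c else 1) ∂μ =
      ENNReal.ofReal (1 - p.pa) + ENNReal.ofReal p.pa * c := by
  have hm : MeasurableSet {ω | M.active j ω = true} :=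
    (M.active_meas j) (measurableSet_singleton true)
  have h : ∀ ω, (if M.active j ω = true then c else 1) =
      {ω | M.active j ω = true}.indicator (fun _ => c) ω +
        {ω | M.active j ω = true}ᶜ.indicator (fun _ => 1) ω := fun ω => by
    by_cases hω : M.active j ω = true <;> simp [hω]
  simp_rw [h]
  rw [lintegral_add_left (measurable_const.indicator hm), lintegral_indicator hm,
    lintegral_indicator hm.compl, lintegral_const, lintegral_const, Measure.restrict_apply_univ,
    Measure.restrict_apply_univ, one_mul, prob_compl_eq_one_sub hm, ← M.active_law j,
    ofReal_measureReal, ← ENNReal.ofReal_one, ENNReal.ofReal_sub _ measureReal_nonneg,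
    ofReal_measureReal, add_comm, mul_comm c]

lemma lintegral_cache_factor (j : ℕ) {n : ℕ} (hn : n ∈ p.secondGroup) (P : Prop) [Decidable P] :
    ∫⁻ ω, (if n ∈ M.cache j ω ∧ P then 0 else 1) ∂μ =
      if P then ENNReal.ofReal (1 - p.pLp) else 1 := by
  by_cases hP : P
  · have hm : MeasurableSet {ω | n ∈ M.cache j ω} :=
      (M.cache_meas j) (MeasurableSet.of_discrete (s := {c : Finset ℕ | n ∈ c}))
    have h : ∀ ω, (if n ∈ M.cache j ω ∧ P then (0 : ℝ≥0∞) else 1) =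
        {ω | n ∈ M.cache j ω}ᶜ.indicator 1 ω := fun ω => by
      by_cases hω : n ∈ M.cache j ω <;> simp [hω, hP]
    simp_rw [h]
    rw [lintegral_indicator_one hm.compl, prob_compl_eq_one_sub hm, if_pos hP,
      ← M.cache_law j n hn, ENNReal.ofReal_sub _ measureReal_nonneg, ofReal_measureReal,
      ENNReal.ofReal_one]
  · simp [hP]

lemma lintegral_active (δ : ℝ) (i : ℕ)
    {K : (ℕ → Plane) × (ℕ → Plane) × (ℕ → Finset ℕ) → ℝ≥0∞} (hK : Measurable K) :
    ∫⁻ ω, K (fun j => M.x1 j ω, fun j => M.x2 j ω, fun j => M.cache j ω) *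
        infProd (fun j => if M.active j ω = true then
          (1 + p.relPower δ p.P2 ‖M.x1 i ω‖ (M.x2 j ω))⁻¹ else 1) ∂μ =
      ∫⁻ ω, K (fun j => M.x1 j ω, fun j => M.x2 j ω, fun j => M.cache j ω) *
        infProd (fun j => ENNReal.ofReal (1 - p.pa) + ENNReal.ofReal p.pa *
          (1 + p.relPower δ p.P2 ‖M.x1 i ω‖ (M.x2 j ω))⁻¹) ∂μ := by
  let Y : Ω → (ℕ → Plane) × (ℕ → Plane) × (ℕ → Finset ℕ) := fun ω =>
    (fun j => M.x1 j ω, fun j => M.x2 j ω, fun j => M.cache j ω)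
  have hY : Measurable Y := M.measurable_x1.prodMk <| M.measurable_x2.prodMk M.measurable_cache
  have hind : IndepFun Y (fun ω j => M.active j ω) μ :=
    indepFun_of_iIndep M.sigmas_le M.indep {0, 1, 4} {5} (by simp)
      (@Measurable.prodMk _ _ _ _ _ (_) _ _ (M.measurable_x1_sup (by simp)) <|
        @Measurable.prodMk _ _ _ _ _ (_) _ _ (M.measurable_x2_sup (by simp))
        (M.measurable_cache_sup (by simp)))
      (M.measurable_active_sup (by simp))
  let φ : ((ℕ → Plane) × (ℕ → Plane) × (ℕ → Finset ℕ)) × (ℕ → Bool) → ℝ≥0∞ := fun q =>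
    K q.1 * infProd (fun j => if q.2 j = true then
          (1 + p.relPower δ p.P2 ‖q.1.1 i‖ (q.1.2.1 j))⁻¹ else 1)
  have hφ : Measurable φ := by
    refine Measurable.mul (by fun_prop) (measurable_infProd fun j => ?_)
    refine Measurable.ite ?_ (by fun_prop) measurable_const
    exact (measurableSet_singleton true).preimage (by fun_prop)
  refine (lintegral_indepFun hY M.measurable_active hind hφ).trans (lintegral_congr fun ω => ?_)
  simp only [φ, Y]
  have hm : ∀ (c : ℕ → ℝ≥0∞) j, Measurable fun ω => if M.active j ω = true then c j else 1 :=
    fun c j => Measurable.ite (M.active_meas j (measurableSet_singleton true)) measurable_const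
      measurable_const
  rw [lintegral_const_mul _ (measurable_infProd fun j => hm
      (fun j => (1 + p.relPower δ p.P2 ‖M.x1 i ω‖ (M.x2 j ω))⁻¹) j),
    lintegral_infProd (hm fun j => (1 + p.relPower δ p.P2 ‖M.x1 i ω‖ (M.x2 j ω))⁻¹)
      (M.active_indep.comp (fun j b => if b = true then
        (1 + p.relPower δ p.P2 ‖M.x1 i ω‖ (M.x2 j ω))⁻¹ else 1) fun j => measurable_of_countable _)]
  · simp_rw [M.lintegral_active_factor]
  · intro j ω'
    split_ifs <;> simp

-- Given the locations, being unblocked is an intersection of independent conditions, one for each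
-- helper. Only the events `n ∈ cache j` enter, so the rest of the cache law plays no role.
open Classical in
lemma lintegral_cache {n : ℕ} (hn : n ∈ p.secondGroup) (i : ℕ)
    {K : (ℕ → Plane) × (ℕ → Plane) → ℝ≥0∞} (hK : Measurable K) :
    ∫⁻ ω, K (fun j => M.x1 j ω, fun j => M.x2 j ω) *
        (if M.Unblocked n i ω then 1 else 0) ∂μ =
      ∫⁻ ω, K (fun j => M.x1 j ω, fun j => M.x2 j ω) *
        infProd (fun j => if p.P1 * ‖M.x1 i ω‖ ^ (-p.α) < p.P2 * ‖M.x2 j ω‖ ^ (-p.α) then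
          ENNReal.ofReal (1 - p.pLp) else 1) ∂μ := by
  let Y : Ω → (ℕ → Plane) × (ℕ → Plane) := fun ω => (fun j => M.x1 j ω, fun j => M.x2 j ω)
  have hY : Measurable Y := M.measurable_x1.prodMk M.measurable_x2
  have hind : IndepFun Y (fun ω j => M.cache j ω) μ :=
    indepFun_of_iIndep M.sigmas_le M.indep {0, 1} {4} (by simp)
      (@Measurable.prodMk _ _ _ _ _ (_) _ _ (M.measurable_x1_sup (by simp))
        (M.measurable_x2_sup (by simp)))
      (M.measurable_cache_sup (by simp))
  let φ : ((ℕ → Plane) × (ℕ → Plane)) × (ℕ → Finset ℕ) → ℝ≥0∞ := fun q =>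
    K q.1 * infProd (fun j => if n ∈ q.2 j ∧ p.P1 * ‖q.1.1 i‖ ^ (-p.α) <
      p.P2 * ‖q.1.2 j‖ ^ (-p.α) then 0 else 1)
  have hφ : Measurable φ := by
    refine Measurable.mul (by fun_prop) (measurable_infProd fun j => ?_)
    have h1 : MeasurableSet {q : ((ℕ → Plane) × (ℕ → Plane)) × (ℕ → Finset ℕ) | n ∈ q.2 j} :=
      (MeasurableSet.of_discrete (s := {c : Finset ℕ | n ∈ c})).preimage
        (f := fun q : ((ℕ → Plane) × (ℕ → Plane)) × (ℕ → Finset ℕ) => q.2 j) (by fun_prop)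
    have h2 : MeasurableSet {q : ((ℕ → Plane) × (ℕ → Plane)) × (ℕ → Finset ℕ) |
        p.P1 * ‖q.1.1 i‖ ^ (-p.α) < p.P2 * ‖q.1.2 j‖ ^ (-p.α)} :=
      measurableSet_lt (by fun_prop) (by fun_prop)
    exact Measurable.ite (h1.inter h2) measurable_const measurable_const
  have h0 : ∀ ω, K (fun j => M.x1 j ω, fun j => M.x2 j ω) *
      (if M.Unblocked n i ω then 1 else 0) = φ (Y ω, fun j => M.cache j ω) := fun ω => by
    simp only [φ, Y, infProd_zero_one]
    congr 1
    by_cases h : M.Unblocked n i ω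
    · rw [if_pos h, if_neg]
      simpa [Unblocked] using h
    · rw [if_neg h, if_pos]
      simpa [Unblocked] using h
  simp_rw [h0]
  refine (lintegral_indepFun hY M.measurable_cache hind hφ).trans (lintegral_congr fun ω => ?_)
  simp only [φ, Y]
  have hm : ∀ (P : ℕ → Prop) j, Measurable fun ω =>
      if n ∈ M.cache j ω ∧ P j then (0 : ℝ≥0∞) else 1 := fun P j =>
    (measurable_of_countable fun c : Finset ℕ => if n ∈ c ∧ P j then (0 : ℝ≥0∞) else 1).comp
      (M.cache_meas j)
  rw [lintegral_const_mul _ (measurable_infProd fun j => hm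
      (fun j => p.P1 * ‖M.x1 i ω‖ ^ (-p.α) < p.P2 * ‖M.x2 j ω‖ ^ (-p.α)) j),
    lintegral_infProd (hm fun j => p.P1 * ‖M.x1 i ω‖ ^ (-p.α) < p.P2 * ‖M.x2 j ω‖ ^ (-p.α))
      (M.cache_indep.comp (fun j c => if n ∈ c ∧ p.P1 * ‖M.x1 i ω‖ ^ (-p.α) <
        p.P2 * ‖M.x2 j ω‖ ^ (-p.α) then (0 : ℝ≥0∞) else 1) fun j => measurable_of_countable _)]
  · simp_rw [M.lintegral_cache_factor _ hn]
  · intro j ω'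
    split_ifs <;> simp


-- The tail of the serving station's fading turns `Exceeds` into an exponential, which splits into a
-- noise factor, a factor for the other macro stations and a factor for the helpers.
open Classical in
lemma measure_serveSet_eq_lintegral_h2 (n : ℕ) (δ : ℝ) (i : ℕ) {D : Set (ℕ → Plane)}
    (hD : MeasurableSet D) :
    μ (M.serveSet n δ i D) = ∫⁻ ω, (D.indicator 1 (fun j => M.x1 j ω) *
        p.innerFactor δ i (fun j => M.x1 j ω) * expNeg (p.relNoise δ ‖M.x1 i ω‖) *
        (if M.Unblocked n i ω then 1 else 0)) *
      expNeg (∑' j, (if M.active j ω = true then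
          p.relPower δ p.P2 ‖M.x1 i ω‖ (M.x2 j ω) else 0) * ENNReal.ofReal (M.h2 j ω)) ∂μ := by
  let Y : Ω → (ℕ → Plane) × (ℕ → Plane) × (ℕ → Finset ℕ) × (ℕ → Bool) × (ℕ → ℝ) := fun ω =>
    (fun j => M.x1 j ω, fun j => M.x2 j ω, fun j => M.cache j ω, fun j => M.active j ω,
      fun j => M.h2 j ω)
  have hY : Measurable Y := M.measurable_x1.prodMk <| M.measurable_x2.prodMk <|
    M.measurable_cache.prodMk <| M.measurable_active.prodMk M.measurable_h2
  have hind : IndepFun Y (fun ω j => M.h1 j ω) μ :=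
    indepFun_of_iIndep M.sigmas_le M.indep {0, 1, 3, 4, 5} {2} (by simp)
      (@Measurable.prodMk _ _ _ _ _ (_) _ _ (M.measurable_x1_sup (by simp)) <|
        @Measurable.prodMk _ _ _ _ _ (_) _ _ (M.measurable_x2_sup (by simp)) <|
        @Measurable.prodMk _ _ _ _ _ (_) _ _ (M.measurable_cache_sup (by simp)) <|
        @Measurable.prodMk _ _ _ _ _ (_) _ _ (M.measurable_active_sup (by simp))
        (M.measurable_h2_sup (by simp)))
      (M.measurable_h1_sup (by simp))
  let ι : ((ℕ → Plane) × (ℕ → Plane) × (ℕ → Finset ℕ) × (ℕ → Bool) × (ℕ → ℝ)) × (ℕ → ℝ) →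
    RadioSpace := fun q => (q.1.1, q.1.2.1, q.1.2.2.1, q.1.2.2.2.1, q.1.2.2.2.2, q.2)
  have hι : Measurable ι := by fun_prop
  have hS := measurableSet_serveRadio (p := p) n δ i hD
  let φ : ((ℕ → Plane) × (ℕ → Plane) × (ℕ → Finset ℕ) × (ℕ → Bool) × (ℕ → ℝ)) × (ℕ → ℝ) → ℝ≥0∞ :=
    fun q => (serveRadio p n δ i D).indicator 1 (ι q)
  have hφ : Measurable φ := (measurable_one.indicator hS).comp hι
  have h0 : μ (M.serveSet n δ i D) = ∫⁻ ω, φ (Y ω, fun j => M.h1 j ω) ∂μ := by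
    rw [serveSet_eq, ← lintegral_indicator_one (hS.preimage M.measurable_radio)]
    rfl
  rw [h0]
  refine (lintegral_indepFun hY M.measurable_h1 hind hφ).trans (lintegral_congr fun ω => ?_)
  by_cases hω : (fun j => M.x1 j ω) ∈ D ∧ M.Unblocked n i ω
  · have h1 : ∀ ω', φ (Y ω, fun j => M.h1 j ω') = {ω' | p.relNoise δ ‖M.x1 i ω‖ +
      ∑' j, (if M.active j ω = true then p.relPower δ p.P2 ‖M.x1 i ω‖ (M.x2 j ω) else 0) *
        ENNReal.ofReal (M.h2 j ω) +
      ∑' j, (if j = i then 0 else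
        p.relPower δ p.P1 ‖M.x1 i ω‖ (M.x1 j ω) * ENNReal.ofReal (M.h1 j ω')) ≤
    ENNReal.ofReal (M.h1 i ω')}.indicator 1 ω' := fun ω' => by
      simp only [φ, ι, Y, Set.indicator_apply]
      congr 1
      refine propext ⟨fun h => h.2.2, fun h => ⟨hω.1, hω.2, h⟩⟩
    simp_rw [h1]
    rw [lintegral_indicator_one, measure_le_fading M.h1_meas M.h1_law M.h1_indep i _
      fun j => p.relPower_ne_top δ p.P1 _ _, expNeg_add, Set.indicator_of_mem hω.1, if_pos hω.2,
      Params.innerFactor, Pi.one_apply]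
    · ring
    · have hm := M.h1_meas
      refine measurableSet_le (Measurable.add measurable_const (Measurable.tsum fun j => ?_))
        (by fun_prop)
      split_ifs <;> fun_prop
  · have h1 : ∀ ω', φ (Y ω, fun j => M.h1 j ω') = 0 := fun ω' =>
      Set.indicator_of_notMem (fun h => hω ⟨h.1, h.2.1⟩) _
    simp_rw [h1, lintegral_zero]
    rw [not_and_or] at hω
    rcases hω with hω | hω
    · rw [Set.indicator_of_notMem hω]
      simp
    · rw [if_neg hω]
      simp

lemma _root_.HetNet.Params.measurable_helperFactor (p : Params) (δ z : ℝ) :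
    Measurable (p.helperFactor δ z) := by
  unfold Params.helperFactor
  refine Measurable.mul (Measurable.ite (measurableSet_lt (by fun_prop) (by fun_prop))
    measurable_const measurable_const) (by fun_prop)

lemma _root_.HetNet.Params.activeFactor_le_one {a : ℝ} (h0 : 0 ≤ a) (h1 : a ≤ 1) {c : ℝ≥0∞}
    (hc : c ≤ 1) : ENNReal.ofReal (1 - a) + ENNReal.ofReal a * c ≤ 1 := by
  calc _ ≤ ENNReal.ofReal (1 - a) + ENNReal.ofReal a * 1 := by gcongr
    _ = 1 := by rw [mul_one, ← ENNReal.ofReal_add (by linarith) h0]; simp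

/-- The bounds hold because the network realizes `pa` as the probability of an event; its explicit
formula is not needed. -/
lemma pa_mem (M : Network p μ) : 0 ≤ p.pa ∧ p.pa ≤ 1 := by
  rw [← M.active_law 0]
  exact ⟨measureReal_nonneg, measureReal_le_one⟩

lemma pLp_mem (M : Network p μ) {n : ℕ} (hn : n ∈ p.secondGroup) : 0 ≤ p.pLp ∧ p.pLp ≤ 1 := by
  rw [← M.cache_law 0 n hn]
  exact ⟨measureReal_nonneg, measureReal_le_one⟩

/-- The probability of `serveSet`, as a mean over the locations of the macro base stations. -/
theorem measure_serveSet {n : ℕ} (hn : n ∈ p.secondGroup) (δ : ℝ) (i : ℕ) {D : Set (ℕ → Plane)}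
    (hD : MeasurableSet D) :
    μ (M.serveSet n δ i D) = ∫⁻ ω, D.indicator 1 (fun j => M.x1 j ω) *
      p.innerFactor δ i (fun j => M.x1 j ω) * p.outerFactor δ ‖M.x1 i ω‖ ∂μ := by
  classical
  have hpa := M.pa_mem
  have hpL := M.pLp_mem hn
  have hle : ∀ (z : ℝ) (y : Plane), (1 + p.relPower δ p.P2 z y)⁻¹ ≤ 1 := fun z y => by simp
  have hDm : Measurable (D.indicator (1 : (ℕ → Plane) → ℝ≥0∞)) := measurable_one.indicator hD
  let U : Set ((ℕ → Plane) × (ℕ → Plane) × (ℕ → Finset ℕ)) :=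
    {q | ∀ j, ¬(n ∈ q.2.2 j ∧ p.P1 * ‖q.1 i‖ ^ (-p.α) < p.P2 * ‖q.2.1 j‖ ^ (-p.α))}
  have hU : MeasurableSet U := by
    have h1 : ∀ j, MeasurableSet {q : (ℕ → Plane) × (ℕ → Plane) × (ℕ → Finset ℕ) | n ∈ q.2.2 j} :=
      fun j => (MeasurableSet.of_discrete (s := {c : Finset ℕ | n ∈ c})).preimage
        (f := fun q : (ℕ → Plane) × (ℕ → Plane) × (ℕ → Finset ℕ) => q.2.2 j) (by fun_prop)
    have h2 : ∀ j, MeasurableSet {q : (ℕ → Plane) × (ℕ → Plane) × (ℕ → Finset ℕ) |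
        p.P1 * ‖q.1 i‖ ^ (-p.α) < p.P2 * ‖q.2.1 j‖ ^ (-p.α)} := fun j =>
      measurableSet_lt (by fun_prop) (by fun_prop)
    simp only [U]
    rw [Set.ofPred_forall]
    exact MeasurableSet.iInter fun j => ((h1 j).inter (h2 j)).compl
  let K : (ℕ → Plane) × (ℕ → Plane) × (ℕ → Finset ℕ) → ℝ≥0∞ := fun q =>
    D.indicator 1 q.1 * p.innerFactor δ i q.1 * expNeg (p.relNoise δ ‖q.1 i‖) *
      (if q ∈ U then 1 else 0)
  have hK : Measurable K := by
    refine Measurable.mul (Measurable.mul (Measurable.mul (hDm.comp measurable_fst) (by fun_prop))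
      (by fun_prop)) (Measurable.ite hU measurable_const measurable_const)
  let K' : (ℕ → Plane) × (ℕ → Plane) → ℝ≥0∞ := fun q =>
    D.indicator 1 q.1 * p.innerFactor δ i q.1 * expNeg (p.relNoise δ ‖q.1 i‖) *
      infProd (fun j => ENNReal.ofReal (1 - p.pa) + ENNReal.ofReal p.pa *
          (1 + p.relPower δ p.P2 ‖q.1 i‖ (q.2 j))⁻¹)
  have hK' : Measurable K' := by
    refine Measurable.mul (Measurable.mul (Measurable.mul (hDm.comp measurable_fst) (by fun_prop))
      (by fun_prop)) (measurable_infProd fun j => by fun_prop)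
  let K'' : (ℕ → Plane) × (ℕ → Plane) → ℝ≥0∞ := fun q =>
    D.indicator 1 q.1 * p.innerFactor δ i q.1 * expNeg (p.relNoise δ ‖q.1 i‖) *
      infProd (fun j => p.helperFactor δ ‖q.1 i‖ (q.2 j))
  have hK'' : Measurable K'' := by
    refine Measurable.mul (Measurable.mul (Measurable.mul (hDm.comp measurable_fst) (by fun_prop))
      (by fun_prop)) (measurable_infProd fun j => ?_)
    unfold Params.helperFactor
    refine Measurable.mul (Measurable.ite ?_ measurable_const measurable_const) (by fun_prop)
    exact measurableSet_lt (by fun_prop) (by fun_prop)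
  have hind : IndepFun (fun ω j => M.x1 j ω) (fun ω j => M.x2 j ω) μ :=
    indepFun_of_iIndep M.sigmas_le M.indep {0} {1} (by simp)
      (M.measurable_x1_sup (by simp)) (M.measurable_x2_sup (by simp))
  -- The remaining families are removed in the order helper fading, activity, caches, helper
  -- locations. Only the macro locations survive.
  calc μ (M.serveSet n δ i D)
      = ∫⁻ ω, K (fun j => M.x1 j ω, fun j => M.x2 j ω, fun j => M.cache j ω) *
        expNeg (∑' j, (if M.active j ω = true then
          p.relPower δ p.P2 ‖M.x1 i ω‖ (M.x2 j ω) else 0) * ENNReal.ofReal (M.h2 j ω)) ∂μ :=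
        M.measure_serveSet_eq_lintegral_h2 n δ i hD
    _ = ∫⁻ ω, K' (fun j => M.x1 j ω, fun j => M.x2 j ω) *
        (if M.Unblocked n i ω then 1 else 0) ∂μ := by
        rw [M.lintegral_h2 δ i hK, M.lintegral_active δ i hK]
        refine lintegral_congr fun ω => ?_
        exact mul_right_comm _ _ _
    _ = ∫⁻ ω, K'' (fun j => M.x1 j ω, fun j => M.x2 j ω) ∂μ := by
        rw [M.lintegral_cache hn i hK']
        refine lintegral_congr fun ω => ?_
        simp only [K', K'', Params.helperFactor]
        rw [mul_assoc, mul_comm (infProd _), infProd_mul]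
        · intro j
          split_ifs <;> simp [hpL.1]
        · exact fun j => Params.activeFactor_le_one hpa.1 hpa.2 (hle _ _)
    _ = ∫⁻ ω, ∫⁻ ω', K'' (fun j => M.x1 j ω, fun j => M.x2 j ω') ∂μ ∂μ :=
        lintegral_indepFun M.measurable_x1 M.measurable_x2 hind hK''
    _ = _ := by
        refine lintegral_congr fun ω => ?_
        simp only [K'']
        rw [lintegral_const_mul, lintegral_infProd_poisson M.ppp2 (p.measurable_helperFactor δ _),
          Params.outerFactor]
        · ring
        · intro y
          refine mul_le_one' ?_ (Params.activeFactor_le_one hpa.1 hpa.2 (hle _ _))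
          split_ifs <;> simp [hpL.1]
        · exact measurable_infProd fun j => (p.measurable_helperFactor δ _).comp (M.ppp2.measurable j)

end Network

/-! ## The special functions as integrals over the plane -/

/-- Polar coordinates. The sign of `g` matters only for `t > 0`, the origin being a null set. -/
lemma lintegral_norm_plane {g : ℝ → ℝ} (hg : Measurable g) (hg0 : ∀ t, 0 < t → 0 ≤ g t) {J : ℝ}
    (hJ : 0 ≤ J) (h : ∫⁻ t in Set.Ioi (0 : ℝ), ENNReal.ofReal (t * g t) = ENNReal.ofReal J) :
    ∫⁻ y : Plane, ENNReal.ofReal (g ‖y‖) = ENNReal.ofReal (2 * Real.pi * J) := by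
  have hnn : ∀ᵐ t ∂(volume.restrict (Set.Ioi (0 : ℝ))), 0 ≤ t * g t :=
    (ae_restrict_iff' measurableSet_Ioi).2 <| ae_of_all _ fun t ht => mul_nonneg (le_of_lt ht)
      (hg0 t ht)
  have hint : IntegrableOn (fun t => t * g t) (Set.Ioi (0 : ℝ)) :=
    (lintegral_ofReal_ne_top_iff_integrable (by fun_prop) hnn).1 (by rw [h]; exact ofReal_ne_top)
  have hval : ∫ t in Set.Ioi (0 : ℝ), t * g t = J := by
    have := ofReal_integral_eq_lintegral_ofReal hint hnn
    rw [h] at this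
    exact (ENNReal.ofReal_eq_ofReal_iff (integral_nonneg_of_ae hnn) hJ).1 this
  have hdim : Module.finrank ℝ Plane = 2 := by simp
  have hI : Integrable (fun y : Plane => g ‖y‖) := by
    rw [integrable_fun_norm_addHaar, hdim]
    simpa using hint
  have hne : ∀ᵐ y : Plane, 0 ≤ g ‖y‖ := by
    have : ∀ᵐ y : Plane, y ≠ 0 := by
      simp [ae_iff]
    filter_upwards [this] with y hy
    exact hg0 _ (norm_pos_iff.2 hy)
  rw [← ofReal_integral_eq_lintegral_ofReal hI hne, integral_fun_norm_addHaar, hdim]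
  congr 1
  simp only [Nat.add_one_sub_one, pow_one, smul_eq_mul, hval, Measure.real,
    EuclideanSpace.volume_ball_fin_two]
  simp [Real.pi_pos.le]
  ring

/-- The mean loss factor at distance `t`, on the scale `r` of the exclusion radius. -/
def lossFactor (α δ r t : ℝ) : ℝ := δ * r ^ α * t ^ (-α) / (1 + δ * r ^ α * t ^ (-α))

@[fun_prop] lemma measurable_lossFactor (α δ r : ℝ) : Measurable (lossFactor α δ r) := by
  unfold lossFactor
  fun_prop

lemma lossFactor_nonneg {α δ r t : ℝ} (hδ : 0 ≤ δ) (hr : 0 ≤ r) (ht : 0 ≤ t) :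
    0 ≤ lossFactor α δ r t := by
  unfold lossFactor
  positivity

lemma one_sub_inv_ofReal {s : ℝ} (hs : 0 ≤ s) :
    1 - (1 + ENNReal.ofReal s)⁻¹ = ENNReal.ofReal (s / (1 + s)) := by
  rw [← ENNReal.ofReal_one, ← ENNReal.ofReal_add zero_le_one hs,
    ← ENNReal.ofReal_inv_of_pos (by linarith), ← ENNReal.ofReal_sub _ (by positivity)]
  congr 1
  have : 1 + s ≠ 0 := by positivity
  field_simp
  ring

/-- Euler's integral with `a = 1` and `c = b + 1`: the power of `1 - t` disappears, and the Gamma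
quotient is `b = 1 - 2/α`, which turns `2δ/(α-2)` into `2δ/α`. -/
lemma G_eq {δ α : ℝ} (hα : 2 < α) :
    G δ α = 2 * δ / α * ∫ u in Set.Ioo (0 : ℝ) 1, u ^ (-(2 / α)) * (1 + δ * u)⁻¹ := by
  have hα0 : 0 < α := by linarith
  have h2 : 0 < 1 - 2 / α := by
    rw [sub_pos, div_lt_one hα0]
    exact hα
  have hG : Real.Gamma (2 - 2 / α) = (1 - 2 / α) * Real.Gamma (1 - 2 / α) := by
    rw [← Real.Gamma_add_one h2.ne']
    congr 1
    ring
  have hint : ∫ t in (0 : ℝ)..1, t ^ (1 - 2 / α - 1) * (1 - t) ^ (2 - 2 / α - (1 - 2 / α) - 1) *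
      (1 - -δ * t) ^ (-1 : ℝ) = ∫ u in Set.Ioo (0 : ℝ) 1, u ^ (-(2 / α)) * (1 + δ * u)⁻¹ := by
    rw [intervalIntegral.integral_of_le zero_le_one, integral_Ioc_eq_integral_Ioo]
    refine integral_congr_ae (ae_of_all _ fun t => ?_)
    simp only
    rw [show 1 - 2 / α - 1 = -(2 / α) by ring, show 2 - 2 / α - (1 - 2 / α) - 1 = 0 by ring,
      Real.rpow_zero, mul_one, Real.rpow_neg_one, neg_mul, sub_neg_eq_add]
  unfold G hyp2F1
  rw [hint, hG, show 2 - 2 / α - (1 - 2 / α) = 1 by ring, Real.Gamma_one, mul_one]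
  have := (Real.Gamma_pos_of_pos h2).ne'
  have h3 : α - 2 ≠ 0 := by linarith
  rw [mul_div_cancel_right₀ _ this, ← mul_assoc]
  congr 1
  field_simp

lemma integrableOn_G_integrand {δ α : ℝ} (hδ : 0 < δ) (hα : 2 < α) :
    IntegrableOn (fun u : ℝ => u ^ (-(2 / α)) * (1 + δ * u)⁻¹) (Set.Ioo 0 1) := by
  have h1 : IntegrableOn (fun u : ℝ => u ^ (-(2 / α))) (Set.Ioo 0 1) := by
    rw [intervalIntegral.integrableOn_Ioo_rpow_iff one_pos, neg_lt_neg_iff,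
      div_lt_one (by linarith)]
    exact hα
  refine Integrable.mono' h1 (by fun_prop) ?_
  refine (ae_restrict_iff' measurableSet_Ioo).2 (ae_of_all _ fun u hu => ?_)
  have hu0 : 0 < u := hu.1
  rw [Real.norm_of_nonneg (by positivity)]
  refine mul_le_of_le_one_right (by positivity) (inv_le_one_of_one_le₀ ?_)
  nlinarith [mul_pos hδ hu0]

lemma G_nonneg {δ α : ℝ} (hδ : 0 < δ) (hα : 2 < α) : 0 ≤ G δ α := by
  rw [G_eq hα]
  refine mul_nonneg (by positivity) (setIntegral_nonneg measurableSet_Ioo fun u hu => ?_)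
  have := hu.1
  positivity

lemma H_nonneg {δ α : ℝ} (hδ : 0 < δ) (hα : 2 < α) : 0 ≤ H δ α := by
  have hα0 : 0 < α := by linarith
  have h2 : 0 < 1 - 2 / α := by
    rw [sub_pos, div_lt_one hα0]
    exact hα
  have := beta_pos (show 0 < 2 / α by positivity) h2
  unfold H
  positivity

/-- The substitution `u = (r/t)^α` maps `(r, ∞)` onto `(0, 1)` and produces the integral of `G_eq`.
-/
lemma lintegral_lossFactor_Ioi {δ α r : ℝ} (hδ : 0 < δ) (hα : 2 < α) (hr : 0 < r) :
    ∫⁻ t in Set.Ioi r, ENNReal.ofReal (t * lossFactor α δ r t) =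
      ENNReal.ofReal (r ^ 2 / 2 * G δ α) := by
  have hα0 : 0 < α := by linarith
  let f : ℝ → ℝ := fun t => r ^ α * t ^ (-α)
  let f' : ℝ → ℝ := fun t => r ^ α * (-α * t ^ (-α - 1))
  have hf : ∀ t ∈ Set.Ioi r, HasDerivWithinAt f (f' t) (Set.Ioi r) t := fun t ht =>
    ((Real.hasDerivAt_rpow_const (Or.inl (hr.trans ht).ne')).const_mul _).hasDerivWithinAt
  have hanti : Set.InjOn f (Set.Ioi r) := by
    intro s hs t ht hst
    have h1 : s ^ (-α) = t ^ (-α) := mul_left_cancel₀ (by positivity) hst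
    have := hr.trans hs
    have := hr.trans ht
    exact (Real.rpow_left_inj (by positivity) (by positivity) (by linarith)).1 h1
  have himg : f '' Set.Ioi r = Set.Ioo 0 1 := by
    ext u
    constructor
    · rintro ⟨t, ht, rfl⟩
      have ht0 : 0 < t := hr.trans ht
      refine ⟨by positivity, ?_⟩
      simp only [f]
      rw [Real.rpow_neg ht0.le, ← div_eq_mul_inv, div_lt_one (by positivity)]
      exact Real.rpow_lt_rpow hr.le ht hα0
    · rintro ⟨hu0, hu1⟩
      refine ⟨r * u ^ (-α⁻¹), ?_, ?_⟩
      · have : 1 < u ^ (-α⁻¹) := Real.one_lt_rpow_of_pos_of_lt_one_of_neg hu0 hu1 (by simpa)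
        simp only [Set.mem_Ioi]
        nlinarith
      · simp only [f]
        rw [Real.mul_rpow hr.le (by positivity), ← mul_assoc, ← Real.rpow_add hr,
          ← Real.rpow_mul hu0.le]
        simp [hα0.ne']
  have key := lintegral_image_eq_lintegral_abs_deriv_mul measurableSet_Ioi hf hanti
    fun u => ENNReal.ofReal (u ^ (-(2 / α)) * (1 + δ * u)⁻¹)
  rw [himg, ← ofReal_integral_eq_lintegral_ofReal (integrableOn_G_integrand hδ hα)
    ((ae_restrict_iff' measurableSet_Ioo).2 (ae_of_all _ fun u hu => by
      have := hu.1
      simp only [Pi.zero_apply]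
      positivity))] at key
  have hpt : ∀ t ∈ Set.Ioi r, ENNReal.ofReal (t * lossFactor α δ r t) =
      ENNReal.ofReal (δ * r ^ 2 / α) * (ENNReal.ofReal |f' t| *
        ENNReal.ofReal (f t ^ (-(2 / α)) * (1 + δ * f t)⁻¹)) := by
    intro t ht
    have ht0 : 0 < t := hr.trans ht
    rw [← ENNReal.ofReal_mul (by positivity), ← ENNReal.ofReal_mul (by positivity)]
    congr 1
    have h1 : |f' t| = r ^ α * α * (t ^ (-α) * t⁻¹) := by
      simp only [f']
      rw [neg_mul, mul_neg, abs_neg, abs_of_pos (by positivity), sub_eq_add_neg,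
        Real.rpow_add ht0, Real.rpow_neg_one]
      ring
    have h2 : f t ^ (-(2 / α)) = (r ^ 2)⁻¹ * t ^ 2 := by
      simp only [f]
      rw [Real.mul_rpow (by positivity) (by positivity), ← Real.rpow_mul hr.le,
        ← Real.rpow_mul ht0.le, show α * -(2 / α) = -2 by field_simp,
        show -α * -(2 / α) = 2 by field_simp, Real.rpow_neg hr.le]
      norm_cast
    rw [h1, h2]
    simp only [lossFactor, f]
    have h3 : 1 + δ * (r ^ α * t ^ (-α)) ≠ 0 := by positivity
    have h4 : 1 + δ * r ^ α * t ^ (-α) ≠ 0 := by positivity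
    rw [← mul_assoc δ]
    field_simp
  rw [setLIntegral_congr_fun measurableSet_Ioi hpt, lintegral_const_mul' _ _ ofReal_ne_top, ← key,
    ← ENNReal.ofReal_mul (by positivity), G_eq hα]
  congr 1
  ring

lemma lintegral_beta_integrand {a b : ℝ} (ha : 0 < a) (hb : 0 < b) :
    ∫⁻ x in Set.Ioo (0 : ℝ) 1, ENNReal.ofReal (x ^ (a - 1) * (1 - x) ^ (b - 1)) =
      ENNReal.ofReal (beta a b) := by
  have h := lintegral_betaPDF_eq_one ha hb
  rw [lintegral_betaPDF] at h
  have hB := beta_pos ha hb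
  simp_rw [mul_assoc, ENNReal.ofReal_mul (one_div_pos.2 hB).le] at h
  rw [lintegral_const_mul' _ _ ofReal_ne_top, one_div, ENNReal.ofReal_inv_of_pos hB] at h
  rw [← one_mul (∫⁻ x in Set.Ioo (0 : ℝ) 1, _), ← ENNReal.mul_inv_cancel
    (a := ENNReal.ofReal (beta a b)) (by simpa using hB) ofReal_ne_top, mul_assoc, h, mul_one]

/-- The substitution `u = 1/(1 + δ r^α t^(-α))`, for which `1 - u` is the loss factor, produces the
integral of `B(2/α, 1 - 2/α)`. -/
lemma lintegral_lossFactor_Ioi_zero {δ α r : ℝ} (hδ : 0 < δ) (hα : 2 < α) (hr : 0 < r) :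
    ∫⁻ t in Set.Ioi 0, ENNReal.ofReal (t * lossFactor α δ r t) =
      ENNReal.ofReal (r ^ 2 / 2 * H δ α) := by
  have hα0 : 0 < α := by linarith
  have hα2 : 0 < 1 - 2 / α := by
    rw [sub_pos, div_lt_one hα0]
    exact hα
  have hc : 0 < δ * r ^ α := by positivity
  set c := δ * r ^ α with hcdef
  let f : ℝ → ℝ := fun t => (1 + c * t ^ (-α))⁻¹
  let f' : ℝ → ℝ := fun t => -(c * (-α * t ^ (-α - 1))) / (1 + c * t ^ (-α)) ^ 2
  have hf : ∀ t ∈ Set.Ioi (0 : ℝ), HasDerivWithinAt f (f' t) (Set.Ioi 0) t := fun t ht => by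
    have ht0 : 0 < t := ht
    exact ((((Real.hasDerivAt_rpow_const (Or.inl ht0.ne')).const_mul c).const_add 1).fun_inv
      (by positivity)).hasDerivWithinAt
  have hanti : Set.InjOn f (Set.Ioi 0) := by
    intro s hs t ht hst
    have hs0 : 0 < s := hs
    have ht0 : 0 < t := ht
    have h1 : s ^ (-α) = t ^ (-α) := mul_left_cancel₀ hc.ne' (add_left_cancel (inv_injective hst))
    exact (Real.rpow_left_inj hs0.le ht0.le (by linarith)).1 h1
  have himg : f '' Set.Ioi 0 = Set.Ioo 0 1 := by
    ext u
    constructor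
    · rintro ⟨t, ht, rfl⟩
      have ht0 : 0 < t := ht
      refine ⟨by positivity, inv_lt_one_of_one_lt₀ ?_⟩
      have : 0 < c * t ^ (-α) := by positivity
      linarith
    · rintro ⟨hu0, hu1⟩
      have h1 : 0 < (u⁻¹ - 1) / c := by
        have : 1 < u⁻¹ := (one_lt_inv₀ hu0).2 hu1
        exact div_pos (by linarith) hc
      refine ⟨((u⁻¹ - 1) / c) ^ (-α⁻¹), by
        simp only [Set.mem_Ioi]
        positivity, ?_⟩
      simp only [f]
      rw [← Real.rpow_mul h1.le, neg_mul_neg, inv_mul_cancel₀ hα0.ne', Real.rpow_one]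
      field_simp
      ring
  have key := lintegral_image_eq_lintegral_abs_deriv_mul measurableSet_Ioi hf hanti
    fun u => ENNReal.ofReal (u ^ (2 / α - 1) * (1 - u) ^ (1 - 2 / α - 1))
  rw [himg, lintegral_beta_integrand (by positivity) hα2] at key
  have hpt : ∀ t ∈ Set.Ioi (0 : ℝ), ENNReal.ofReal (t * lossFactor α δ r t) =
      ENNReal.ofReal (c ^ (2 / α) / α) * (ENNReal.ofReal |f' t| *
        ENNReal.ofReal (f t ^ (2 / α - 1) * (1 - f t) ^ (1 - 2 / α - 1))) := by
    intro t ht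
    have ht0 : 0 < t := ht
    rw [← ENNReal.ofReal_mul (by positivity), ← ENNReal.ofReal_mul (by positivity)]
    congr 1
    set ψ := c * t ^ (-α) with hψ
    have hψ0 : 0 < ψ := by positivity
    have h1 : |f' t| = α * ψ * t⁻¹ / (1 + ψ) ^ 2 := by
      simp only [f']
      rw [← hψ, neg_mul, mul_neg, neg_neg, abs_of_pos (by positivity), sub_eq_add_neg,
        Real.rpow_add ht0, Real.rpow_neg_one, hψ]
      ring
    have h2 : f t ^ (2 / α - 1) * (1 - f t) ^ (1 - 2 / α - 1) = (1 + ψ) * ψ ^ (-(2 / α)) := by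
      have : 1 - f t = ψ * (1 + ψ)⁻¹ := by
        simp only [f]
        rw [← hψ]
        field_simp
        ring
      rw [this, Real.mul_rpow hψ0.le (by positivity)]
      simp only [f]
      rw [← hψ, Real.inv_rpow (by positivity), Real.inv_rpow (by positivity),
        ← Real.rpow_neg (by positivity), ← Real.rpow_neg (by positivity),
        mul_left_comm, ← Real.rpow_add (by positivity), mul_comm]
      congr 2
      · ring_nf
        exact Real.rpow_one _
      · ring
    have h3 : ψ ^ (-(2 / α)) = (c ^ (2 / α))⁻¹ * t ^ 2 := by
      rw [hψ, Real.mul_rpow hc.le (by positivity), ← Real.rpow_mul ht0.le, Real.rpow_neg hc.le,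
        show -α * -(2 / α) = 2 by field_simp]
      norm_cast
    rw [h1, h2, h3]
    have h4 : lossFactor α δ r t = ψ / (1 + ψ) := rfl
    rw [h4]
    have : c ^ (2 / α) ≠ 0 := by positivity
    field_simp
  rw [setLIntegral_congr_fun measurableSet_Ioi hpt, lintegral_const_mul' _ _ ofReal_ne_top, ← key,
    ← ENNReal.ofReal_mul (by positivity), H, hcdef, Real.mul_rpow hδ.le (by positivity),
    ← Real.rpow_mul hr.le, show α * (2 / α) = 2 by field_simp]
  congr 1
  norm_cast
  field_simp

lemma lintegral_lossFactor_plane {δ α r : ℝ} (hδ : 0 < δ) (hα : 2 < α) (hr : 0 < r) :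
    ∫⁻ y : Plane, ENNReal.ofReal (lossFactor α δ r ‖y‖) =
      ENNReal.ofReal (Real.pi * r ^ 2 * H δ α) := by
  rw [lintegral_norm_plane (by fun_prop) (fun t ht => lossFactor_nonneg hδ.le hr.le ht.le)
    (mul_nonneg (by positivity) (H_nonneg hδ hα)) (lintegral_lossFactor_Ioi_zero hδ hα hr)]
  congr 1
  ring

lemma lintegral_lossFactor_compl_ball {δ α r : ℝ} (hδ : 0 < δ) (hα : 2 < α) (hr : 0 < r) :
    ∫⁻ y in (Metric.ball (0 : Plane) r)ᶜ, ENNReal.ofReal (lossFactor α δ r ‖y‖) =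
      ENNReal.ofReal (Real.pi * r ^ 2 * G δ α) := by
  have h1 : ∫⁻ t in Set.Ioi (0 : ℝ),
      ENNReal.ofReal (t * (Set.Ici r).indicator (lossFactor α δ r) t) =
      ENNReal.ofReal (r ^ 2 / 2 * G δ α) := by
    rw [← lintegral_lossFactor_Ioi hδ hα hr, setLIntegral_congr (Ioi_ae_eq_Ici (a := r)),
      ← lintegral_indicator measurableSet_Ioi, ← lintegral_indicator measurableSet_Ici]
    refine lintegral_congr fun t => ?_
    by_cases ht : r ≤ t
    · simp [ht, hr.trans_le ht]
    · by_cases ht0 : 0 < t <;> simp [ht, ht0]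
  rw [← lintegral_indicator measurableSet_ball.compl]
  have h2 : ∀ y : Plane, (Metric.ball (0 : Plane) r)ᶜ.indicator
      (fun y => ENNReal.ofReal (lossFactor α δ r ‖y‖)) y =
      ENNReal.ofReal ((Set.Ici r).indicator (lossFactor α δ r) ‖y‖) := fun y => by
    by_cases hy : r ≤ ‖y‖
    · simp [hy]
    · simp [hy]
  simp_rw [h2]
  rw [lintegral_norm_plane ((measurable_lossFactor α δ r).indicator measurableSet_Ici)
    (fun t ht => Set.indicator_nonneg (fun t ht' => lossFactor_nonneg hδ.le hr.le
      (hr.le.trans ht')) t)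
    (mul_nonneg (by positivity) (G_nonneg hδ hα)) h1]
  congr 1
  ring

/-! ## From increments to densities -/

/-- A measure whose masses of short intervals `[r, s)` are squeezed between `A e^(-A) g s` and
`A e^A g r`, where `A = k (s² - r²)`, has density `2 k z g z`. -/
lemma measure_Ico_of_squeeze {ν : Measure ℝ} {g : ℝ → ℝ} {k : ℝ} (hk : 0 < k)
    (hg : ContinuousOn g (Set.Ioi 0)) (hg0 : ∀ z, 0 < z → 0 ≤ g z)
    (hlow : ∀ r s, 0 < r → r < s → ENNReal.ofReal (k * (s ^ 2 - r ^ 2) *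
      Real.exp (-(k * (s ^ 2 - r ^ 2))) * g s) ≤ ν (Set.Ico r s))
    (hup : ∀ r s, 0 < r → r < s → ν (Set.Ico r s) ≤ ENNReal.ofReal (k * (s ^ 2 - r ^ 2) *
      Real.exp (k * (s ^ 2 - r ^ 2)) * g r))
    {a b : ℝ} (ha : 0 < a) (hab : a ≤ b) :
    ν (Set.Ico a b) = ENNReal.ofReal (∫ z in a..b, 2 * k * z * g z) := by
  have hfin : ∀ r s, 0 < r → ν (Set.Ico r s) ≠ ⊤ := fun r s hr => by
    rcases lt_or_ge r s with h | h
    · exact ((hup r s hr h).trans_lt ofReal_lt_top).ne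
    · simp [Set.Ico_eq_empty (not_lt.2 h)]
  let Ψ : ℝ → ℝ := fun r => ν.real (Set.Ico a r)
  have hinc : ∀ r s, a ≤ r → r ≤ s → Ψ s - Ψ r = ν.real (Set.Ico r s) := fun r s har hrs => by
    simp only [Ψ]
    rw [← Set.Ico_union_Ico_eq_Ico har hrs, measureReal_union
      (Set.Ico_disjoint_Ico_same) measurableSet_Ico (hfin _ _ ha) (hfin _ _ (ha.trans_le har))]
    ring
  have hlowR : ∀ r s, 0 < r → r < s → k * (s ^ 2 - r ^ 2) * Real.exp (-(k * (s ^ 2 - r ^ 2))) * g s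
      ≤ ν.real (Set.Ico r s) := fun r s hr hrs =>
    (ENNReal.ofReal_le_iff_le_toReal (hfin r s hr)).1 (hlow r s hr hrs)
  have hA : ∀ r s : ℝ, 0 < r → r ≤ s → 0 ≤ k * (s ^ 2 - r ^ 2) := fun r s hr hrs =>
    mul_nonneg hk.le (by nlinarith)
  have hupR : ∀ r s, 0 < r → r < s → ν.real (Set.Ico r s) ≤
      k * (s ^ 2 - r ^ 2) * Real.exp (k * (s ^ 2 - r ^ 2)) * g r := fun r s hr hrs =>
    ENNReal.toReal_le_of_le_ofReal (mul_nonneg (mul_nonneg (hA r s hr hrs.le) (Real.exp_pos _).le)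
      (hg0 r hr)) (hup r s hr hrs)
  have hgI : ContinuousOn g (Set.Icc a b) := hg.mono fun z hz => ha.trans_le hz.1
  obtain ⟨C, hC⟩ := isCompact_Icc.exists_bound_of_continuousOn hgI
  -- The upper bound makes `Ψ` Lipschitz on `[a, b]`.
  have hcont : ContinuousOn Ψ (Set.Icc a b) := by
    have hlip : ∀ r ∈ Set.Icc a b, ∀ s ∈ Set.Icc a b, r ≤ s →
        |Ψ s - Ψ r| ≤ k * (2 * b) * Real.exp (k * b ^ 2) * C * (s - r) := by
      intro r hr s hs hrs
      have hr0 : 0 < r := ha.trans_le hr.1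
      rw [hinc r s hr.1 hrs, abs_of_nonneg measureReal_nonneg]
      rcases hrs.eq_or_lt with rfl | hlt
      · simp
      refine (hupR r s hr0 hlt).trans ?_
      have h1 : k * (s ^ 2 - r ^ 2) ≤ k * (2 * b) * (s - r) := by
        rw [mul_assoc]
        refine mul_le_mul_of_nonneg_left ?_ hk.le
        nlinarith [hs.2, hr.2]
      have h2 : k * (s ^ 2 - r ^ 2) ≤ k * b ^ 2 := by
        refine mul_le_mul_of_nonneg_left ?_ hk.le
        nlinarith [hs.2, hr.2]
      have h3 : g r ≤ C := (le_abs_self _).trans (hC r hr)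
      have h4 : 0 ≤ g r := hg0 r hr0
      have h5 := hA r s hr0 hrs
      have h6 : 0 ≤ k * (2 * b) * (s - r) := h5.trans h1
      calc _ ≤ k * (2 * b) * (s - r) * Real.exp (k * b ^ 2) * C := by gcongr
        _ = _ := by ring
    set L := k * (2 * b) * Real.exp (k * b ^ 2) * C
    have : LipschitzOnWith L.toNNReal Ψ (Set.Icc a b) := by
      refine LipschitzOnWith.of_dist_le_mul fun r hr s hs => ?_
      have hL : L ≤ (L.toNNReal : ℝ) := Real.le_coe_toNNReal L
      rw [Real.dist_eq, Real.dist_eq]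
      rcases le_total r s with h | h
      · rw [abs_sub_comm, abs_sub_comm r, abs_of_nonneg (sub_nonneg.2 h)]
        exact (hlip r hr s hs h).trans (mul_le_mul_of_nonneg_right hL (sub_nonneg.2 h))
      · rw [abs_of_nonneg (sub_nonneg.2 h)]
        exact (hlip s hs r hr h).trans (mul_le_mul_of_nonneg_right hL (sub_nonneg.2 h))
    exact this.continuousOn
  -- As `s` decreases to `x`, `k (s² - x²)/(s - x)` tends to `2 k x` and both exponentials tend to
  -- `1`. The bounds concern `[x, s)` and give a right derivative only, which together with
  -- continuity suffices for the fundamental theorem of calculus.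
  have hderiv : ∀ x ∈ Set.Ioo a b, HasDerivWithinAt Ψ (2 * k * x * g x) (Set.Ioi x) x := by
    intro x hx
    have hx0 : 0 < x := ha.trans hx.1
    rw [hasDerivWithinAt_iff_tendsto_slope' (by simp)]
    have hgx : Tendsto g (𝓝[>] x) (𝓝 (g x)) :=
      (hg.continuousAt (Ioi_mem_nhds hx0)).tendsto.mono_left nhdsWithin_le_nhds
    have hpoly : ∀ F : ℝ → ℝ, Continuous F → Tendsto F (𝓝[>] x) (𝓝 (F x)) := fun F hF =>
      hF.continuousAt.tendsto.mono_left nhdsWithin_le_nhds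
    have hl := (hpoly (fun s => k * (s + x) * Real.exp (-(k * (s ^ 2 - x ^ 2))))
      (by fun_prop)).mul hgx
    have hu := (hpoly (fun s => k * (s + x) * Real.exp (k * (s ^ 2 - x ^ 2)))
      (by fun_prop)).mul_const (g x)
    have e1 : k * (x + x) * Real.exp (-(k * (x ^ 2 - x ^ 2))) * g x = 2 * k * x * g x := by
      rw [sub_self, mul_zero, neg_zero, Real.exp_zero]
      ring
    have e2 : k * (x + x) * Real.exp (k * (x ^ 2 - x ^ 2)) * g x = 2 * k * x * g x := by
      rw [sub_self, mul_zero, Real.exp_zero]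
      ring
    rw [e1] at hl
    rw [e2] at hu
    have hslope : ∀ s, x < s → slope Ψ x s = ν.real (Set.Ico x s) / (s - x) := fun s hs => by
      rw [slope_def_field, hinc x s hx.1.le hs.le]
    refine tendsto_of_tendsto_of_tendsto_of_le_of_le' hl hu ?_ ?_
    · filter_upwards [self_mem_nhdsWithin] with s hs
      have hs' : x < s := hs
      rw [hslope s hs, le_div_iff₀ (sub_pos.2 hs')]
      refine le_trans (le_of_eq ?_) (hlowR x s hx0 hs)
      ring
    · filter_upwards [self_mem_nhdsWithin] with s hs
      have hs' : x < s := hs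
      rw [hslope s hs, div_le_iff₀ (sub_pos.2 hs')]
      refine (hupR x s hx0 hs).trans (le_of_eq ?_)
      ring
  have hint : IntervalIntegrable (fun z => 2 * k * z * g z) volume a b := by
    refine ContinuousOn.intervalIntegrable ?_
    rw [Set.uIcc_of_le hab]
    exact ContinuousOn.mul (by fun_prop) hgI
  rw [intervalIntegral.integral_eq_sub_of_hasDeriv_right_of_le hab hcont hderiv hint]
  simp [Ψ, hfin a b ha]

/-- Exhaustion of `(0, ∞)` by the intervals `[1/(n+1), n+1)`; the common value may be infinite. -/
lemma measure_Ioi_of_squeeze {ν : Measure ℝ} {g : ℝ → ℝ} {k : ℝ} (hk : 0 < k)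
    (hg : ContinuousOn g (Set.Ioi 0)) (hg0 : ∀ z, 0 < z → 0 ≤ g z)
    (hlow : ∀ r s, 0 < r → r < s → ENNReal.ofReal (k * (s ^ 2 - r ^ 2) *
      Real.exp (-(k * (s ^ 2 - r ^ 2))) * g s) ≤ ν (Set.Ico r s))
    (hup : ∀ r s, 0 < r → r < s → ν (Set.Ico r s) ≤ ENNReal.ofReal (k * (s ^ 2 - r ^ 2) *
      Real.exp (k * (s ^ 2 - r ^ 2)) * g r)) :
    ν (Set.Ioi 0) = ∫⁻ z in Set.Ioi (0 : ℝ), ENNReal.ofReal (2 * k * z * g z) := by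
  let ν' : Measure ℝ := volume.withDensity fun z => ENNReal.ofReal (2 * k * z * g z)
  let S : ℕ → Set ℝ := fun n => Set.Ico (1 / ((n : ℝ) + 1)) (n + 1)
  have hS0 : ∀ n : ℕ, (0 : ℝ) < 1 / ((n : ℝ) + 1) := fun n => by positivity
  have hS1 : ∀ n : ℕ, 1 / ((n : ℝ) + 1) ≤ n + 1 := fun n => by
    rw [div_le_iff₀ (by positivity)]
    nlinarith [(Nat.cast_nonneg n : (0 : ℝ) ≤ n)]
  have hmono : Monotone S := fun n m hnm =>
    Set.Ico_subset_Ico (one_div_le_one_div_of_le (by positivity) (by gcongr)) (by gcongr)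
  have hU : ⋃ n, S n = Set.Ioi 0 := by
    ext z
    simp only [Set.mem_iUnion, S, Set.mem_Ico, Set.mem_Ioi]
    constructor
    · rintro ⟨n, hn, -⟩
      exact (hS0 n).trans_le hn
    · intro hz
      obtain ⟨n, hn⟩ := exists_nat_gt z
      obtain ⟨m, hm⟩ := exists_nat_gt z⁻¹
      refine ⟨max n m, ?_, ?_⟩
      · rw [div_le_iff₀ (by positivity)]
        have h1 : (m : ℝ) ≤ (max n m : ℕ) := by exact_mod_cast le_max_right n m
        have h2 : z * z⁻¹ = 1 := mul_inv_cancel₀ hz.ne'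
        nlinarith
      · have h1 : (n : ℝ) ≤ (max n m : ℕ) := by exact_mod_cast le_max_left n m
        linarith
  have hS : ∀ n, ν (S n) = ν' (S n) := fun n => by
    simp only [S, ν']
    rw [measure_Ico_of_squeeze hk hg hg0 hlow hup (hS0 n) (hS1 n),
      withDensity_apply _ measurableSet_Ico, intervalIntegral.integral_of_le (hS1 n),
      ← integral_Ico_eq_integral_Ioc, ofReal_integral_eq_lintegral_ofReal]
    · have : ContinuousOn (fun z => 2 * k * z * g z) (Set.Icc (1 / ((n : ℝ) + 1)) (n + 1)) :=
        ContinuousOn.mul (by fun_prop) (hg.mono fun z hz => (hS0 n).trans_le hz.1)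
      exact this.integrableOn_Icc.mono_set Set.Ico_subset_Icc_self
    · refine (ae_restrict_iff' measurableSet_Ico).2 (ae_of_all _ fun z hz => ?_)
      have hz0 : 0 < z := (hS0 n).trans_le hz.1
      exact mul_nonneg (by positivity) (hg0 z hz0)
  have hν' : ν' (Set.Ioi 0) = ∫⁻ z in Set.Ioi (0 : ℝ), ENNReal.ofReal (2 * k * z * g z) :=
    withDensity_apply _ measurableSet_Ioi
  rw [← hν', ← hU]
  refine tendsto_nhds_unique (tendsto_measure_iUnion_atTop hmono) ?_
  simp_rw [Function.comp_def, hS]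
  exact tendsto_measure_iUnion_atTop hmono

/-! ## The nearest point of a Poisson process -/

lemma infProd_eq_zero {a : ℕ → ℝ≥0∞} {j : ℕ} (hj : a j = 0) : infProd a = 0 :=
  le_antisymm ((iInf_le _ (j + 1)).trans
    (le_of_eq (Finset.prod_eq_zero (i := j) (by simp) hj))) zero_le

namespace Params

variable (p : Params) {δ : ℝ}

lemma relPower_P1 {z : ℝ} (y : Plane) :
    p.relPower δ p.P1 z y = ENNReal.ofReal (δ * z ^ p.α * ‖y‖ ^ (-p.α)) := by
  unfold relPower
  congr 1
  have := p.P1_pos.ne'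
  field_simp

lemma one_sub_inv_relPower_P1 (hδ : 0 < δ) {z : ℝ} (hz : 0 ≤ z) (y : Plane) :
    1 - (1 + p.relPower δ p.P1 z y)⁻¹ = ENNReal.ofReal (lossFactor p.α δ z ‖y‖) := by
  rw [relPower_P1, one_sub_inv_ofReal (by positivity)]
  rfl

lemma relPower_mono (hδ : 0 < δ) {P z z' : ℝ} (hP : 0 ≤ P) (hz : 0 ≤ z) (h : z ≤ z') (y : Plane) :
    p.relPower δ P z y ≤ p.relPower δ P z' y := by
  have := p.P1_pos
  have := p.two_lt_α
  unfold relPower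
  gcongr

/-- The factor of a macro base station at `y`, if no station is closer than `r`, the serving
station is in the ring of radii `r` and `s`, and the other stations are farther away. -/
def ringFactor (δ r s z : ℝ) (y : Plane) : ℝ≥0∞ :=
  if ‖y‖ < r then 0 else if ‖y‖ < s then 1 else (1 + p.relPower δ p.P1 z y)⁻¹

lemma measurable_ringFactor (r s z : ℝ) : Measurable (p.ringFactor δ r s z) := by
  unfold ringFactor
  refine Measurable.ite (measurableSet_lt (by fun_prop) (by fun_prop)) measurable_const
    (Measurable.ite (measurableSet_lt (by fun_prop) (by fun_prop)) measurable_const (by fun_prop))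

lemma ringFactor_le_one (r s z : ℝ) (y : Plane) : p.ringFactor δ r s z y ≤ 1 := by
  unfold ringFactor
  split_ifs <;> simp

/-- In the exponent, the ball of radius `r` accounts for the absence of nearer stations and the
outside of the ball of radius `s` for interference. -/
lemma lintegral_one_sub_ringFactor (hδ : 0 < δ) {r s z : ℝ} (hrs : r ≤ s) (hz : 0 ≤ z) :
    ∫⁻ y, (1 - p.ringFactor δ r s z y) = volume (Metric.ball (0 : Plane) r) +
      ∫⁻ y in (Metric.ball (0 : Plane) s)ᶜ, ENNReal.ofReal (lossFactor p.α δ z ‖y‖) := by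
  rw [← lintegral_indicator_one measurableSet_ball, ← lintegral_indicator measurableSet_ball.compl,
    ← lintegral_add_left (measurable_one.indicator measurableSet_ball)]
  refine lintegral_congr fun y => ?_
  unfold ringFactor
  by_cases h1 : ‖y‖ < r
  · simp [h1, h1.trans_le hrs]
  · by_cases h2 : ‖y‖ < s
    · simp [h1, h2]
    · simp [h1, h2, p.one_sub_inv_relPower_P1 hδ hz y]

end Params

/-- The points `y` with `r ≤ ‖y‖ < s`. -/
def ring (r s : ℝ) : Set Plane := {y | r ≤ ‖y‖ ∧ ‖y‖ < s}

lemma ring_eq (r s : ℝ) : ring r s = Metric.ball (0 : Plane) s \ Metric.ball 0 r := by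
  ext y
  simp [ring, and_comm]

lemma measurableSet_ring (r s : ℝ) : MeasurableSet (ring r s) := by
  rw [ring_eq]
  exact measurableSet_ball.diff measurableSet_ball

lemma volume_ball_plane {r : ℝ} (hr : 0 ≤ r) :
    volume (Metric.ball (0 : Plane) r) = ENNReal.ofReal (Real.pi * r ^ 2) := by
  rw [EuclideanSpace.volume_ball_fin_two, ← ENNReal.ofReal_pow hr, ← ENNReal.ofReal_mul (by positivity)]
  congr 1
  ring

lemma volume_ring {r s : ℝ} (hr : 0 ≤ r) (hrs : r ≤ s) :
    volume (ring r s) = ENNReal.ofReal (Real.pi * (s ^ 2 - r ^ 2)) := by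
  rw [ring_eq, measure_sdiff (Metric.ball_subset_ball hrs) measurableSet_ball.nullMeasurableSet
    measure_ball_lt_top.ne, volume_ball_plane hr, volume_ball_plane (hr.trans hrs),
    ← ENNReal.ofReal_sub _ (by positivity)]
  congr 1
  ring

/-! ### Intensity measure of a Poisson process. -/

section Campbell

variable {Ω : Type*} [MeasurableSpace Ω] {μ : Measure Ω} {lam : ℝ} {x : ℕ → Ω → Plane}

/-- The intensity measure of a Poisson point process. -/
lemma IsPoissonProcess.sum_map (hx : IsPoissonProcess μ lam x) :
    Measure.sum (fun j => μ.map (x j)) = ENNReal.ofReal lam • (volume : Measure Plane) := by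
  have hfin : ∀ B : Set Plane, MeasurableSet B → volume B ≠ ⊤ →
      Measure.sum (fun j => μ.map (x j)) B = ENNReal.ofReal lam * volume B := fun B hB hB' => by
    have hm : ∀ j, Measurable fun ω => B.indicator (1 : Plane → ℝ≥0∞) (x j ω) := fun j =>
      (measurable_one.indicator hB).comp (hx.measurable j)
    rw [← lintegral_cnt_self hx hB hB', Measure.sum_apply _ hB]
    simp_rw [toENNReal_cnt]
    rw [lintegral_tsum fun j => (hm j).aemeasurable]
    refine tsum_congr fun j => ?_
    rw [Measure.map_apply (hx.measurable j) hB,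
      ← lintegral_indicator_one ((hx.measurable j) hB)]
    rfl
  ext A hA
  have hmono : Monotone fun n : ℕ => A ∩ Metric.ball (0 : Plane) n := fun n m hnm =>
    Set.inter_subset_inter_right _ (Metric.ball_subset_ball (by exact_mod_cast hnm))
  have hU : A = ⋃ n : ℕ, A ∩ Metric.ball (0 : Plane) n := by
    rw [← Set.inter_iUnion, Metric.iUnion_ball_nat, Set.inter_univ]
  rw [hU, hmono.measure_iUnion, hmono.measure_iUnion]
  refine iSup_congr fun n => ?_
  rw [hfin _ (hA.inter measurableSet_ball) ((measure_mono Set.inter_subset_right).trans_lt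
    measure_ball_lt_top).ne]
  rfl

/-- A singleton has zero intensity. The origin has to be excluded because `0 ^ (-α)` takes the
default value `0`, so a station there would count as infinitely weak. -/
lemma IsPoissonProcess.ae_ne_zero (hx : IsPoissonProcess μ lam x) : ∀ᵐ ω ∂μ, ∀ i, x i ω ≠ 0 := by
  rw [ae_all_iff]
  intro i
  have h1 : Measure.sum (fun j => μ.map (x j)) {(0 : Plane)} = 0 := by
    rw [hx.sum_map]
    simp
  have h2 := Measure.sum_apply_eq_zero.1 h1 i
  rw [Measure.map_apply (hx.measurable i) (measurableSet_singleton _)] at h2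
  rw [ae_iff]
  simp only [ne_eq, not_not]
  exact h2

end Campbell

/-- The configurations in which the `i`-th point is a nearest point to the origin. -/
def nearest (i : ℕ) : Set (ℕ → Plane) := {x | ∀ j, ‖x i‖ ≤ ‖x j‖}

/-- The configurations in which the `i`-th point is the only nearest point to the origin. -/
def strictNearest (i : ℕ) : Set (ℕ → Plane) := {x | ∀ j, j ≠ i → ‖x i‖ < ‖x j‖}

lemma measurableSet_nearest (i : ℕ) : MeasurableSet (nearest i) := by
  unfold nearest
  rw [Set.ofPred_forall]
  exact MeasurableSet.iInter fun j => measurableSet_le (by fun_prop) (by fun_prop)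

lemma measurableSet_strictNearest (i : ℕ) : MeasurableSet (strictNearest i) := by
  unfold strictNearest
  rw [Set.ofPred_forall]
  refine MeasurableSet.iInter fun j => ?_
  rw [Set.ofPred_forall]
  exact MeasurableSet.iInter fun _ => measurableSet_lt (by fun_prop) (by fun_prop)

lemma strictNearest_subset_nearest (i : ℕ) : strictNearest i ⊆ nearest i := fun x hx j => by
  rcases eq_or_ne j i with rfl | h
  · exact le_rfl
  · exact (hx j h).le

/-! ### Mass carried by the serving station, ring by ring. -/

namespace Params

variable (p : Params) {Ω : Type*} [MeasurableSpace Ω] {μ : Measure Ω} {x : ℕ → Ω → Plane} {δ : ℝ}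

/-- The mean contribution of a serving station whose distance from the origin is in `A`. -/
def serveMass (δ : ℝ) (μ : Measure Ω) (x : ℕ → Ω → Plane) (D : ℕ → Set (ℕ → Plane))
    (F : ℝ → ℝ≥0∞) : Measure ℝ :=
  Measure.sum fun i => (μ.withDensity fun ω => (D i).indicator 1 (fun j => x j ω) *
    p.innerFactor δ i (fun j => x j ω) * F ‖x i ω‖).map fun ω => ‖x i ω‖

lemma serveMass_apply (hx : ∀ j, Measurable (x j)) {D : ℕ → Set (ℕ → Plane)}
    (hD : ∀ i, MeasurableSet (D i)) {F : ℝ → ℝ≥0∞} (hF : Measurable F) {A : Set ℝ}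
    (hA : MeasurableSet A) :
    p.serveMass δ μ x D F A = ∫⁻ ω, ∑' i, A.indicator 1 ‖x i ω‖ *
      ((D i).indicator 1 (fun j => x j ω) * p.innerFactor δ i (fun j => x j ω) * F ‖x i ω‖) ∂μ := by
  have hX : Measurable fun ω j => x j ω := measurable_pi_lambda _ hx
  have hd : ∀ i, Measurable fun ω => (D i).indicator (1 : (ℕ → Plane) → ℝ≥0∞) (fun j => x j ω) *
      p.innerFactor δ i (fun j => x j ω) * F ‖x i ω‖ := fun i =>
    (((measurable_one.indicator (hD i)).comp hX).mul ((p.measurable_innerFactor δ i).comp hX)).mul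
      (hF.comp (hx i).norm)
  have hn : ∀ i, Measurable fun ω => ‖x i ω‖ := fun i => (hx i).norm
  have hm : ∀ i, Measurable fun ω => A.indicator (1 : ℝ → ℝ≥0∞) ‖x i ω‖ *
      ((D i).indicator 1 (fun j => x j ω) * p.innerFactor δ i (fun j => x j ω) * F ‖x i ω‖) :=
    fun i => ((measurable_one.indicator hA).comp (hn i)).mul (hd i)
  rw [serveMass, Measure.sum_apply _ hA, lintegral_tsum fun i => (hm i).aemeasurable]
  refine tsum_congr fun i => ?_
  rw [Measure.map_apply (hn i) hA, withDensity_apply _ ((hn i) hA),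
    ← lintegral_indicator ((hn i) hA)]
  refine lintegral_congr fun ω => ?_
  by_cases h : ‖x i ω‖ ∈ A
  · rw [Set.indicator_of_mem (by exact h), Set.indicator_of_mem h]
    simp
  · rw [Set.indicator_of_notMem (by exact h), Set.indicator_of_notMem h]
    simp

/-- Rounding up: no station is nearer than `r`, stations in the ring are given the factor `1`, and
lowering the serving distance to `r` lowers all relative powers. -/
lemma innerFactor_le_infProd (hδ : 0 < δ) {y : ℕ → Plane} {i : ℕ} (hy : y ∈ nearest i) {r s : ℝ}
    (hr : 0 ≤ r) (hi : y i ∈ ring r s) :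
    p.innerFactor δ i y ≤ infProd fun j => p.ringFactor δ r s r (y j) := by
  refine infProd_mono fun j => ?_
  have h1 : ¬ ‖y j‖ < r := not_lt.2 (hi.1.trans (hy j))
  unfold ringFactor
  rw [if_neg h1]
  split_ifs with h2 h3 h3
  · exact le_rfl
  · exact absurd (h2 ▸ hi.2) h3
  · simp
  · exact ENNReal.inv_le_inv.2 (by gcongr; exact p.relPower_mono hδ p.P1_pos.le hr hi.1 _)

/-- Rounding down: stations nearer than `r` give `0`, and raising the serving distance to `s` raises
the relative powers. Uniqueness in the ring is needed because `ringFactor` is `1` there. -/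
lemma infProd_le_innerFactor (hδ : 0 < δ) {y : ℕ → Plane} {i : ℕ} {r s : ℝ} (hr : 0 ≤ r)
    (hi : y i ∈ ring r s) (hu : ∀ j, y j ∈ ring r s → j = i) :
    infProd (fun j => p.ringFactor δ r s s (y j)) ≤ p.innerFactor δ i y := by
  refine infProd_mono fun j => ?_
  unfold ringFactor
  split_ifs with h1 h2 h2 h3
  · exact zero_le
  · exact zero_le
  · exact le_rfl
  · exact absurd (hu j ⟨not_lt.1 h1, by assumption⟩) (by assumption)
  · simp
  · exact ENNReal.inv_le_inv.2 (by
      gcongr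
      exact p.relPower_mono hδ p.P1_pos.le (hr.trans hi.1) hi.2.le _)

lemma indicator_ring_eq (r s : ℝ) (y : Plane) :
    (Set.Ico r s).indicator (1 : ℝ → ℝ≥0∞) ‖y‖ = (ring r s).indicator 1 y := by
  by_cases h : y ∈ ring r s
  · rw [Set.indicator_of_mem h, Set.indicator_of_mem (show ‖y‖ ∈ Set.Ico r s from h)]
    rfl
  · rw [Set.indicator_of_notMem h, Set.indicator_of_notMem (show ‖y‖ ∉ Set.Ico r s from h)]

/-- Summing the common bound over the stations in the ring gives their number times a product that
ignores the ring, so the generating functional applies with the count itself as `φ`. -/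
lemma serveMass_Ico_le (hx : IsPoissonProcess μ p.lam1 x) (hδ : 0 < δ)
    {D : ℕ → Set (ℕ → Plane)} (hD : ∀ i, MeasurableSet (D i)) (hDn : ∀ i, D i ⊆ nearest i)
    {F : ℝ → ℝ≥0∞} (hF : Measurable F) (hFa : AntitoneOn F (Set.Ioi 0)) {r s : ℝ}
    (hr : 0 < r) (hrs : r < s) :
    p.serveMass δ μ x D F (Set.Ico r s) ≤ F r * (ENNReal.ofReal p.lam1 * volume (ring r s) *
      expNeg (ENNReal.ofReal p.lam1 * ∫⁻ y, (1 - p.ringFactor δ r s r y))) := by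
  have hvol : volume (ring r s) ≠ ⊤ := by
    rw [volume_ring hr.le hrs.le]
    exact ofReal_ne_top
  rw [p.serveMass_apply hx.measurable hD hF measurableSet_Ico,
    ← lintegral_cnt_self hx (measurableSet_ring r s) hvol,
    ← lintegral_cnt_mul_infProd hx (measurableSet_ring r s) hvol (fun n => (n : ℝ≥0∞))
      (by rw [lintegral_cnt_self hx (measurableSet_ring r s) hvol]
          exact mul_ne_top ofReal_ne_top hvol)
      (p.measurable_ringFactor r s r) (p.ringFactor_le_one r s r)
      (fun y hy => by unfold ringFactor; rw [if_neg (not_lt.2 hy.1), if_pos hy.2])]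
  have hm : Measurable fun ω => ((cnt x (ring r s) ω : ℕ∞) : ℝ≥0∞) *
      infProd fun j => p.ringFactor δ r s r (x j ω) :=
    ((measurable_of_countable fun n : ℕ∞ => (n : ℝ≥0∞)).comp
      (measurable_cnt hx (measurableSet_ring r s))).mul
      (measurable_infProd fun j => (p.measurable_ringFactor r s r).comp (hx.measurable j))
  rw [← lintegral_const_mul _ hm]
  refine lintegral_mono fun ω => ?_
  simp only
  rw [toENNReal_cnt, ← ENNReal.tsum_mul_right, ← ENNReal.tsum_mul_left]
  refine ENNReal.tsum_le_tsum fun i => ?_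
  rw [indicator_ring_eq]
  by_cases hi : x i ω ∈ ring r s
  · rw [Set.indicator_of_mem hi, Pi.one_apply, one_mul, one_mul]
    by_cases hω : (fun j => x j ω) ∈ D i
    · rw [Set.indicator_of_mem hω, Pi.one_apply, one_mul, mul_comm]
      exact mul_le_mul' (hFa hr (hr.trans_le hi.1) hi.1)
        (p.innerFactor_le_infProd hδ (hDn i hω) hr.le hi)
    · rw [Set.indicator_of_notMem hω]
      simp
  · rw [Set.indicator_of_notMem hi]
    simp

/-- Here `φ` is the indicator that the ring holds exactly one station. If moreover no station is
nearer than `r`, that station is the strictly nearest one. -/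
lemma le_serveMass_Ico (hx : IsPoissonProcess μ p.lam1 x) (hδ : 0 < δ)
    {D : ℕ → Set (ℕ → Plane)} (hD : ∀ i, MeasurableSet (D i)) (hDn : ∀ i, strictNearest i ⊆ D i)
    {F : ℝ → ℝ≥0∞} (hF : Measurable F) (hFa : AntitoneOn F (Set.Ioi 0)) {r s : ℝ}
    (hr : 0 < r) (hrs : r < s) :
    F s * (ENNReal.ofReal p.lam1 * volume (ring r s) *
      expNeg (ENNReal.ofReal p.lam1 * volume (ring r s)) *
      expNeg (ENNReal.ofReal p.lam1 * ∫⁻ y, (1 - p.ringFactor δ r s s y))) ≤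
      p.serveMass δ μ x D F (Set.Ico r s) := by
  classical
  have hvol : volume (ring r s) ≠ ⊤ := by
    rw [volume_ring hr.le hrs.le]
    exact ofReal_ne_top
  rw [p.serveMass_apply hx.measurable hD hF measurableSet_Ico,
    ← lintegral_cnt_eq_one hx (measurableSet_ring r s) hvol,
    ← lintegral_cnt_mul_infProd hx (measurableSet_ring r s) hvol (fun n => if n = 1 then 1 else 0)
      (by rw [lintegral_cnt_eq_one hx (measurableSet_ring r s) hvol]
          exact mul_ne_top (mul_ne_top ofReal_ne_top hvol) (expNeg_ne_top _))
      (p.measurable_ringFactor r s s) (p.ringFactor_le_one r s s)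
      (fun y hy => by unfold ringFactor; rw [if_neg (not_lt.2 hy.1), if_pos hy.2])]
  have hm : Measurable fun ω => (if cnt x (ring r s) ω = 1 then (1 : ℝ≥0∞) else 0) *
      infProd fun j => p.ringFactor δ r s s (x j ω) :=
    ((measurable_of_countable fun n : ℕ∞ => if n = 1 then (1 : ℝ≥0∞) else 0).comp
      (measurable_cnt hx (measurableSet_ring r s))).mul
      (measurable_infProd fun j => (p.measurable_ringFactor r s s).comp (hx.measurable j))
  rw [← lintegral_const_mul _ hm]
  refine lintegral_mono fun ω => ?_
  by_cases h1 : cnt x (ring r s) ω = 1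
  · obtain ⟨i, hi⟩ := Set.encard_eq_one.1 h1
    have hiR : x i ω ∈ ring r s := by
      have : i ∈ {j | x j ω ∈ ring r s} := by rw [hi]; rfl
      exact this
    have hu : ∀ j, x j ω ∈ ring r s → j = i := fun j hj => by
      have : j ∈ {j | x j ω ∈ ring r s} := hj
      rw [hi] at this
      exact this
    simp only [h1, if_true, one_mul]
    by_cases hb : ∃ j, ‖x j ω‖ < r
    · obtain ⟨j, hj⟩ := hb
      rw [infProd_eq_zero (j := j) (by unfold ringFactor; rw [if_pos hj]), mul_zero]
      exact zero_le
    · push Not at hb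
      have hω : (fun j => x j ω) ∈ D i := hDn i fun j hj => by
        have : s ≤ ‖x j ω‖ := by
          by_contra h
          exact hj (hu j ⟨hb j, not_le.1 h⟩)
        exact hiR.2.trans_le this
      refine le_trans ?_ (ENNReal.le_tsum i)
      rw [indicator_ring_eq, Set.indicator_of_mem hiR, Set.indicator_of_mem hω, Pi.one_apply,
        Pi.one_apply, one_mul, one_mul, mul_comm]
      exact mul_le_mul' (p.infProd_le_innerFactor hδ hr.le hiR hu)
        (hFa (hr.trans_le hiR.1) (hr.trans hrs) hiR.2.le)
  · simp [h1]

/-- The total contribution of the serving station. -/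
theorem tsum_lintegral_serve (hx : IsPoissonProcess μ p.lam1 x) (hδ : 0 < δ)
    {D : ℕ → Set (ℕ → Plane)} (hD : ∀ i, MeasurableSet (D i))
    (hDs : ∀ i, strictNearest i ⊆ D i) (hDn : ∀ i, D i ⊆ nearest i)
    {F : ℝ → ℝ≥0∞} (hF : Measurable F) {f : ℝ → ℝ} (hFf : ∀ z, 0 < z → F z = ENNReal.ofReal (f z))
    (hf : ContinuousOn f (Set.Ioi 0)) (hfa : AntitoneOn f (Set.Ioi 0))
    (hf0 : ∀ z, 0 < z → 0 ≤ f z) :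
    ∑' i, ∫⁻ ω, (D i).indicator 1 (fun j => x j ω) * p.innerFactor δ i (fun j => x j ω) *
      F ‖x i ω‖ ∂μ = ∫⁻ z in Set.Ioi (0 : ℝ), ENNReal.ofReal (2 * (Real.pi * p.lam1) * z *
        (f z * Real.exp (-(Real.pi * p.lam1 * z ^ 2 * (1 + G δ p.α))))) := by
  have hα := p.two_lt_α
  have hl := p.lam1_pos
  have hpi := Real.pi_pos
  have hG := G_nonneg hδ hα
  have hFa : AntitoneOn F (Set.Ioi 0) := fun a ha b hb hab => by
    rw [hFf a ha, hFf b hb]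
    exact ENNReal.ofReal_le_ofReal (hfa ha hb hab)
  -- In `1 + G`, the `1` comes from the disc of radius `z` being empty and `G` from the interference
  -- of the stations beyond it.
  set g : ℝ → ℝ := fun z => f z * Real.exp (-(Real.pi * p.lam1 * z ^ 2 * (1 + G δ p.α))) with hgdef
  set k := Real.pi * p.lam1 with hk
  have hk0 : 0 < k := by positivity
  have hlv : ∀ r s, 0 < r → r < s → ENNReal.ofReal p.lam1 * volume (ring r s) =
      ENNReal.ofReal (k * (s ^ 2 - r ^ 2)) := fun r s hr hrs => by
    rw [volume_ring hr.le hrs.le, ← ENNReal.ofReal_mul hl.le]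
    congr 1
    rw [hk]
    ring
  have hA : ∀ r s : ℝ, 0 < r → r < s → 0 ≤ k * (s ^ 2 - r ^ 2) := fun r s hr hrs =>
    mul_nonneg hk0.le (by nlinarith)
  have hlow : ∀ r s, 0 < r → r < s → ENNReal.ofReal (k * (s ^ 2 - r ^ 2) *
      Real.exp (-(k * (s ^ 2 - r ^ 2))) * g s) ≤ p.serveMass δ μ x D F (Set.Ico r s) := by
    intro r s hr hrs
    have hs := hr.trans hrs
    refine le_trans ?_ (p.le_serveMass_Ico hx hδ hD hDs hF hFa hr hrs)
    have hint : ENNReal.ofReal p.lam1 * ∫⁻ y, (1 - p.ringFactor δ r s s y) ≤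
        ENNReal.ofReal (k * s ^ 2 * (1 + G δ p.α)) := by
      rw [p.lintegral_one_sub_ringFactor hδ hrs.le hs.le, lintegral_lossFactor_compl_ball hδ hα hs,
        volume_ball_plane hr.le, ← ENNReal.ofReal_add (by positivity) (by positivity),
        ← ENNReal.ofReal_mul hl.le]
      refine ENNReal.ofReal_le_ofReal ?_
      have : r ^ 2 ≤ s ^ 2 := by nlinarith
      calc p.lam1 * (Real.pi * r ^ 2 + Real.pi * s ^ 2 * G δ p.α)
          ≤ p.lam1 * (Real.pi * s ^ 2 + Real.pi * s ^ 2 * G δ p.α) := by gcongr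
        _ = _ := by rw [hk]; ring
    calc _ = F s * (ENNReal.ofReal (k * (s ^ 2 - r ^ 2)) *
          expNeg (ENNReal.ofReal (k * (s ^ 2 - r ^ 2))) *
          expNeg (ENNReal.ofReal (k * s ^ 2 * (1 + G δ p.α)))) := by
          rw [expNeg_ofReal (hA r s hr hrs), expNeg_ofReal (by positivity), hFf s hs,
            ← ENNReal.ofReal_mul (hA r s hr hrs), ← ENNReal.ofReal_mul
              (mul_nonneg (hA r s hr hrs) (Real.exp_pos _).le), ← ENNReal.ofReal_mul (hf0 s hs)]
          congr 1
          simp only [hgdef]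
          ring
      _ ≤ _ := by
          rw [hlv r s hr hrs]
          gcongr
          exact expNeg_antitone hint
  have hup : ∀ r s, 0 < r → r < s → p.serveMass δ μ x D F (Set.Ico r s) ≤
      ENNReal.ofReal (k * (s ^ 2 - r ^ 2) * Real.exp (k * (s ^ 2 - r ^ 2)) * g r) := by
    intro r s hr hrs
    have hs := hr.trans hrs
    refine (p.serveMass_Ico_le hx hδ hD hDn hF hFa hr hrs).trans ?_
    set E := ENNReal.ofReal p.lam1 * ∫⁻ y, (1 - p.ringFactor δ r s r y) with hE
    -- The loss factor is at most `1`, so leaving the ring out of the interference integral costs at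
    -- most its area.
    have hint : ENNReal.ofReal (k * r ^ 2 * (1 + G δ p.α)) ≤
        E + ENNReal.ofReal (k * (s ^ 2 - r ^ 2)) := by
      have h1 : ENNReal.ofReal (Real.pi * r ^ 2 * G δ p.α) ≤
          (∫⁻ y in (Metric.ball (0 : Plane) s)ᶜ, ENNReal.ofReal (lossFactor p.α δ r ‖y‖)) +
            volume (ring r s) := by
        rw [← lintegral_lossFactor_compl_ball hδ hα hr,
          ← lintegral_indicator measurableSet_ball.compl,
          ← lintegral_indicator measurableSet_ball.compl,
          ← lintegral_indicator_one (measurableSet_ring r s),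
          ← lintegral_add_right _ (measurable_one.indicator (measurableSet_ring r s))]
        refine lintegral_mono fun y => ?_
        by_cases h1 : ‖y‖ < r
        · rw [Set.indicator_of_notMem (by simpa using h1)]
          exact zero_le
        · by_cases h2 : ‖y‖ < s
          · rw [Set.indicator_of_mem (show y ∈ ring r s from ⟨not_lt.1 h1, h2⟩),
              Set.indicator_of_mem (by simpa using h1), ← p.one_sub_inv_relPower_P1 hδ hr.le]
            exact tsub_le_self.trans le_add_self
          · rw [Set.indicator_of_mem (by simpa using h1), Set.indicator_of_mem (by simpa using h2)]
            exact le_self_add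
      rw [hE, p.lintegral_one_sub_ringFactor hδ hrs.le hr.le, volume_ball_plane hr.le,
        ← hlv r s hr hrs, ← mul_add, add_assoc]
      refine le_trans (le_of_eq ?_) (mul_le_mul_right (add_le_add_right h1 _) _)
      rw [← ENNReal.ofReal_add (by positivity) (by positivity), ← ENNReal.ofReal_mul hl.le]
      congr 1
      rw [hk]
      ring
    have hexp : expNeg E ≤ ENNReal.ofReal (Real.exp (k * (s ^ 2 - r ^ 2)) *
        Real.exp (-(k * r ^ 2 * (1 + G δ p.α)))) := by
      have h2 := expNeg_antitone hint
      rw [expNeg_add, expNeg_ofReal (hA r s hr hrs), expNeg_ofReal (by positivity)] at h2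
      rw [ENNReal.ofReal_mul (Real.exp_pos _).le]
      calc expNeg E = ENNReal.ofReal (Real.exp (k * (s ^ 2 - r ^ 2))) *
            (expNeg E * ENNReal.ofReal (Real.exp (-(k * (s ^ 2 - r ^ 2))))) := by
            rw [mul_left_comm, ← ENNReal.ofReal_mul (Real.exp_pos _).le, ← Real.exp_add]
            simp
        _ ≤ _ := by gcongr
    rw [hlv r s hr hrs, hFf r hr]
    calc _ ≤ ENNReal.ofReal (f r) * (ENNReal.ofReal (k * (s ^ 2 - r ^ 2)) *
          ENNReal.ofReal (Real.exp (k * (s ^ 2 - r ^ 2)) *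
            Real.exp (-(k * r ^ 2 * (1 + G δ p.α))))) := by gcongr
      _ = _ := by
          rw [← ENNReal.ofReal_mul (hA r s hr hrs), ← ENNReal.ofReal_mul (hf0 r hr)]
          congr 1
          simp only [hgdef]
          ring
  have hgc : ContinuousOn g (Set.Ioi 0) := hf.mul (by fun_prop)
  have hmain := measure_Ioi_of_squeeze hk0 hgc
    (fun z hz => mul_nonneg (hf0 z hz) (Real.exp_pos _).le) hlow hup
  rw [← hmain, p.serveMass_apply hx.measurable hD hF measurableSet_Ioi]
  have hX : Measurable fun ω j => x j ω := measurable_pi_lambda _ hx.measurable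
  have hm : ∀ i, Measurable fun ω => (D i).indicator (1 : (ℕ → Plane) → ℝ≥0∞) (fun j => x j ω) *
      p.innerFactor δ i (fun j => x j ω) * F ‖x i ω‖ := fun i =>
    (((measurable_one.indicator (hD i)).comp hX).mul ((p.measurable_innerFactor δ i).comp hX)).mul
      (hF.comp (hx.measurable i).norm)
  rw [← lintegral_tsum fun i => (hm i).aemeasurable]
  refine lintegral_congr_ae ?_
  filter_upwards [hx.ae_ne_zero] with ω hω
  refine tsum_congr fun i => ?_
  rw [Set.indicator_of_mem (show ‖x i ω‖ ∈ Set.Ioi (0 : ℝ) from norm_pos_iff.2 (hω i)),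
    Pi.one_apply, one_mul]

end Params

/-! ## Almost sure properties of the network -/

/-- The function `x e^(-x)` is the Gamma density of shape `2`. -/
lemma lintegral_id_expMeasure : ∫⁻ x, ENNReal.ofReal x ∂(expMeasure 1) = 1 := by
  rw [lintegral_expMeasure (by fun_prop), ← lintegral_gammaPDF_eq_one (a := 2) (r := 1)
    (by norm_num) one_pos]
  refine lintegral_congr fun x => ?_
  rcases lt_or_ge x 0 with hx | hx
  · simp [ENNReal.ofReal_of_nonpos hx.le, gammaPDF_of_neg hx]
  · rw [exponentialPDF_of_nonneg hx, gammaPDF_of_nonneg hx, ← ENNReal.ofReal_mul (by positivity)]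
    congr 1
    have h1 : (2 : ℝ) - 1 = 1 := by norm_num
    have h2 : Real.Gamma 2 = 1 := Real.Gamma_two
    rw [h1, h2]
    simp [mul_comm]

/-- Outside the unit disc `‖y‖^(-α) ≤ 1`, so it is at most twice the loss factor with `δ = r = 1`,
whose integral is already known to be finite. -/
lemma lintegral_rpow_neg_plane_ne_top {α : ℝ} (hα : 2 < α) :
    ∫⁻ y in (Metric.ball (0 : Plane) 1)ᶜ, ENNReal.ofReal (‖y‖ ^ (-α)) ≠ ⊤ := by
  have h : ∫⁻ y in (Metric.ball (0 : Plane) 1)ᶜ, ENNReal.ofReal (‖y‖ ^ (-α)) ≤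
      2 * ∫⁻ y in (Metric.ball (0 : Plane) 1)ᶜ, ENNReal.ofReal (lossFactor α 1 1 ‖y‖) := by
    rw [← lintegral_const_mul' _ _ (by simp)]
    refine setLIntegral_mono' measurableSet_ball.compl fun y hy => ?_
    have hy1 : 1 ≤ ‖y‖ := by simpa using hy
    have h1 : ‖y‖ ^ (-α) ≤ 1 := Real.rpow_le_one_of_one_le_of_nonpos hy1 (by linarith)
    have h0 : 0 ≤ ‖y‖ ^ (-α) := by positivity
    rw [show (2 : ℝ≥0∞) * ENNReal.ofReal (lossFactor α 1 1 ‖y‖) =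
        ENNReal.ofReal (2 * lossFactor α 1 1 ‖y‖) by
      rw [ENNReal.ofReal_mul (by norm_num), ENNReal.ofReal_ofNat]]
    refine ENNReal.ofReal_le_ofReal ?_
    unfold lossFactor
    rw [Real.one_rpow, one_mul, one_mul, ← mul_div_assoc, le_div_iff₀ (by positivity)]
    nlinarith
  refine (h.trans_lt ?_).ne
  rw [lintegral_lossFactor_compl_ball one_pos hα one_pos]
  exact mul_lt_top (by simp) ofReal_lt_top

section Summability

variable {Ω : Type*} [MeasurableSpace Ω] {μ : Measure Ω} {lam : ℝ}
  {x : ℕ → Ω → Plane} {h : ℕ → Ω → ℝ}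

lemma ae_fading_pos (hm : ∀ j, Measurable (h j)) (hl : ∀ j, HasLaw (h j) (expMeasure 1) μ) :
    ∀ᵐ ω ∂μ, ∀ j, 0 < h j ω := by
  rw [ae_all_iff]
  intro j
  have h1 : expMeasure 1 (Set.Iic 0) = 0 := by
    have : expMeasure 1 = volume.withDensity (exponentialPDF 1) := rfl
    rw [this, withDensity_apply _ measurableSet_Iic, ← setLIntegral_congr Iio_ae_eq_Iic]
    refine (setLIntegral_congr_fun (g := 0) measurableSet_Iio fun t ht => ?_).trans (by simp)
    exact exponentialPDF_of_neg ht
  rw [← (hl j).map_eq, Measure.map_apply (hm j) measurableSet_Iic] at h1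
  rw [ae_iff]
  simp only [not_lt]
  exact h1

/-- The interference is almost surely finite. -/
lemma IsPoissonProcess.ae_summable (hx : IsPoissonProcess μ lam x) (hm : ∀ j, Measurable (h j))
    (hl : ∀ j, HasLaw (h j) (expMeasure 1) μ)
    (hind : IndepFun (fun ω j => x j ω) (fun ω j => h j ω) μ) {α : ℝ} (hα : 2 < α) :
    ∀ᵐ ω ∂μ, Summable fun j => h j ω * ‖x j ω‖ ^ (-α) := by
  let f : Plane → ℝ≥0∞ :=
    (Metric.ball (0 : Plane) 1)ᶜ.indicator fun y => ENNReal.ofReal (‖y‖ ^ (-α))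
  have hf : Measurable f := Measurable.indicator (by fun_prop) measurableSet_ball.compl
  have hfm : ∀ j, Measurable fun ω => f (x j ω) * ENNReal.ofReal (h j ω) := fun j =>
    (hf.comp (hx.measurable j)).mul (hm j).ennreal_ofReal
  -- Outside the unit disc the mean interference is an integral against the intensity measure and is
  -- finite. Near the origin the path loss is not integrable, but almost surely only finitely many
  -- points lie there.
  have hE : ∫⁻ ω, ∑' j, f (x j ω) * ENNReal.ofReal (h j ω) ∂μ ≠ ⊤ := by
    rw [lintegral_tsum fun j => (hfm j).aemeasurable]
    have h1 : ∀ j, ∫⁻ ω, f (x j ω) * ENNReal.ofReal (h j ω) ∂μ = ∫⁻ y, f y ∂(μ.map (x j)) := by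
      intro j
      have hij : IndepFun (x j) (h j) μ :=
        hind.comp (φ := fun x : ℕ → Plane => x j) (ψ := fun h : ℕ → ℝ => h j)
          (measurable_pi_apply j) (measurable_pi_apply j)
      have := lintegral_mul_eq_lintegral_mul_lintegral_of_indepFun (hf.comp (hx.measurable j))
        (hm j).ennreal_ofReal (hij.comp hf ENNReal.measurable_ofReal)
      simp only [Pi.mul_apply, Function.comp_apply] at this
      rw [this, lintegral_map hf (hx.measurable j),
        ← lintegral_map (f := ENNReal.ofReal) ENNReal.measurable_ofReal (hm j), (hl j).map_eq,
        lintegral_id_expMeasure, mul_one]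
    simp_rw [h1]
    rw [← lintegral_sum_measure, hx.sum_map, lintegral_smul_measure,
      lintegral_indicator measurableSet_ball.compl]
    exact mul_ne_top ofReal_ne_top (lintegral_rpow_neg_plane_ne_top hα)
  have hN : ∫⁻ ω, ((cnt x (Metric.ball 0 1) ω : ℕ∞) : ℝ≥0∞) ∂μ ≠ ⊤ := by
    rw [lintegral_cnt_self hx measurableSet_ball measure_ball_lt_top.ne]
    exact mul_ne_top ofReal_ne_top measure_ball_lt_top.ne
  have hNm : Measurable fun ω => ((cnt x (Metric.ball 0 1) ω : ℕ∞) : ℝ≥0∞) :=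
    (measurable_of_countable fun n : ℕ∞ => (n : ℝ≥0∞)).comp (measurable_cnt hx measurableSet_ball)
  filter_upwards [ae_lt_top (Measurable.tsum hfm) hE, ae_lt_top hNm hN, ae_fading_pos hm hl]
    with ω h1 h2 h3
  have hfinite : {j | x j ω ∈ Metric.ball (0 : Plane) 1}.Finite := by
    rw [← Set.encard_lt_top_iff]
    exact ENat.toENNReal_lt_top.1 h2
  have hs1 : Summable ({j | x j ω ∈ Metric.ball (0 : Plane) 1}.indicator
      fun j => h j ω * ‖x j ω‖ ^ (-α)) :=
    summable_of_hasFiniteSupport (hfinite.subset Set.support_indicator_subset)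
  have hs2 : Summable ({j | x j ω ∈ Metric.ball (0 : Plane) 1}ᶜ.indicator
      fun j => h j ω * ‖x j ω‖ ^ (-α)) := by
    refine (ENNReal.summable_toReal h1.ne).congr fun j => ?_
    by_cases hj : x j ω ∈ Metric.ball (0 : Plane) 1
    · simp only [f]
      rw [Set.indicator_of_notMem (Set.notMem_compl_iff.2 hj),
        Set.indicator_of_notMem (Set.notMem_compl_iff.2 (by exact hj))]
      simp
    · simp only [f]
      rw [Set.indicator_of_mem (Set.mem_compl hj),
        Set.indicator_of_mem (Set.mem_compl (by exact hj)), ENNReal.toReal_mul, ENNReal.toReal_ofReal (h3 j).le,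
        ENNReal.toReal_ofReal (by positivity), mul_comm]
  refine (hs1.add hs2).congr fun j => ?_
  exact Set.indicator_self_add_compl_apply _ _ _

end Summability

namespace Params

variable (p : Params)

lemma δ1_pos (l : ℕ) : 0 < p.δ1 l := by
  unfold δ1
  have := p.R0_pos
  have := p.W_pos
  rw [sub_pos]
  exact Real.one_lt_rpow one_lt_two (by positivity)

end Params

/-! ### From the real-valued SINR to inequalities in `[0, ∞]`. -/

namespace Network

variable {p : Params} {Ω : Type*} [MeasurableSpace Ω] {μ : Measure Ω} (M : Network p μ)

/-- The almost sure properties of a network that are used below. -/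
structure Good (ω : Ω) : Prop where
  x1_ne : ∀ j, M.x1 j ω ≠ 0
  h1_pos : ∀ j, 0 < M.h1 j ω
  h2_pos : ∀ j, 0 < M.h2 j ω
  sum1 : Summable fun j => M.h1 j ω * ‖M.x1 j ω‖ ^ (-p.α)
  sum2 : Summable fun j => M.h2 j ω * ‖M.x2 j ω‖ ^ (-p.α)

lemma ae_good [IsProbabilityMeasure μ] : ∀ᵐ ω ∂μ, M.Good ω := by
  have h1 := M.ppp1.ae_summable M.h1_meas M.h1_law (indepFun_of_iIndep M.sigmas_le M.indep {0} {2}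
    (by simp) (M.measurable_x1_sup (by simp)) (M.measurable_h1_sup (by simp))) p.two_lt_α
  have h2 := M.ppp2.ae_summable M.h2_meas M.h2_law (indepFun_of_iIndep M.sigmas_le M.indep {1} {3}
    (by simp) (M.measurable_x2_sup (by simp)) (M.measurable_h2_sup (by simp))) p.two_lt_α
  filter_upwards [M.ppp1.ae_ne_zero, ae_fading_pos M.h1_meas M.h1_law,
    ae_fading_pos M.h2_meas M.h2_law, h1, h2] with ω h1 h2 h3 h4 h5
  exact ⟨h1, h2, h3, h4, h5⟩

variable {M}

lemma Good.serves_iff {ω : Ω} (hω : M.Good ω) (n i : ℕ) :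
    M.Serves n i ω ↔ (fun j => M.x1 j ω) ∈ nearest i ∧ M.Unblocked n i ω := by
  have hP := p.P1_pos
  have hα : -p.α < 0 := by linarith [p.two_lt_α]
  unfold Serves Unblocked
  refine and_congr (forall_congr' fun j => ?_) (forall_congr' fun j => ?_)
  · rw [mul_le_mul_iff_right₀ hP]
    exact Real.rpow_le_rpow_iff_of_neg (norm_pos_iff.2 (hω.x1_ne j)) (norm_pos_iff.2 (hω.x1_ne i))
      hα
  · rw [not_and, not_lt]
    rfl

/-- Keeps the denominator of the SINR positive even without noise, where division by zero would
return `0`. Station `i + 1` serves as an interferer. -/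
lemma Good.I1_pos {ω : Ω} (hω : M.Good ω) (i : ℕ) : 0 < M.I1 i ω := by
  have hP := p.P1_pos
  have hterm : ∀ j, 0 < p.P1 * M.h1 j ω * M.loss1 j ω := fun j => by
    have := hω.h1_pos j
    have := norm_pos_iff.2 (hω.x1_ne j)
    unfold loss1
    positivity
  have hs : Summable fun j => if j = i then 0 else p.P1 * M.h1 j ω * M.loss1 j ω := by
    refine Summable.of_nonneg_of_le (fun j => ?_) (fun j => ?_) (hω.sum1.mul_left p.P1)
    · split_ifs
      · exact le_rfl
      · exact (hterm j).le
    · split_ifs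
      · have := (hterm j).le
        rwa [mul_assoc] at this
      · exact (mul_assoc _ _ _).le
  refine hs.tsum_pos (fun j => ?_) (i + 1) (by simpa using hterm (i + 1))
  split_ifs
  · exact le_rfl
  · exact (hterm j).le

/-- The inequalities differ by the positive factor `δ z^α / P₁`. Summability matters because the
real `tsum` of a divergent series is `0`, whereas the sum in `[0, ∞]` is `⊤`. -/
lemma Good.exceeds_iff {ω : Ω} (hω : M.Good ω) (n i : ℕ) {δ : ℝ} (hδ : 0 < δ) :
    M.Exceeds δ i ω ↔ δ ≤ M.SINR n i ω := by
  classical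
  have hP := p.P1_pos
  have hP2 := p.P2_pos
  have hn := p.noise_nonneg
  have hz : 0 < ‖M.x1 i ω‖ := norm_pos_iff.2 (hω.x1_ne i)
  set z := ‖M.x1 i ω‖ with hzdef
  set κ := δ * z ^ p.α * p.P1⁻¹ with hκ
  have hκ0 : 0 < κ := by positivity
  have hI1 : ∑' j, (if j = i then 0 else
      p.relPower δ p.P1 z (M.x1 j ω) * ENNReal.ofReal (M.h1 j ω)) =
      ENNReal.ofReal (κ * M.I1 i ω) := by
    have h0 : ∀ j, 0 ≤ κ * (if j = i then 0 else p.P1 * M.h1 j ω * M.loss1 j ω) := fun j => by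
      have := hω.h1_pos j
      unfold loss1
      split_ifs <;> positivity
    have hs : Summable fun j => κ * (if j = i then 0 else p.P1 * M.h1 j ω * M.loss1 j ω) := by
      refine Summable.of_nonneg_of_le h0 (fun j => ?_) (hω.sum1.mul_left (κ * p.P1))
      have := hω.h1_pos j
      split_ifs
      · rw [mul_zero]
        positivity
      · unfold loss1
        exact le_of_eq (by ring)
    rw [I1, ← tsum_mul_left, ENNReal.ofReal_tsum_of_nonneg h0 hs]
    refine tsum_congr fun j => ?_
    split_ifs
    · simp
    · unfold Params.relPower
      rw [← ENNReal.ofReal_mul (by positivity)]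
      congr 1
      unfold loss1
      ring
  have hI2 : ∑' j, (if M.active j ω = true then p.relPower δ p.P2 z (M.x2 j ω) else 0) *
        ENNReal.ofReal (M.h2 j ω) = ENNReal.ofReal (κ * (M.IPlus n ω + M.IMinus n ω)) := by
    have hle : ∀ (P : ℕ → Prop) [DecidablePred P], Summable fun j => if P j then
        p.P2 * M.h2 j ω * M.loss2 j ω else 0 := fun P _ => by
      refine Summable.of_nonneg_of_le (fun j => ?_) (fun j => ?_) (hω.sum2.mul_left p.P2)
      · have := hω.h2_pos j
        unfold loss2
        split_ifs <;> positivity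
      · have := hω.h2_pos j
        split_ifs
        · unfold loss2
          exact le_of_eq (by ring)
        · positivity
    have hsum : M.IPlus n ω + M.IMinus n ω =
        ∑' j, if M.active j ω = true then p.P2 * M.h2 j ω * M.loss2 j ω else 0 := by
      rw [IPlus, IMinus, ← Summable.tsum_add (hle _) (hle _)]
      refine tsum_congr fun j => ?_
      by_cases h1 : M.active j ω = true <;> by_cases h2 : n ∈ M.cache j ω <;> simp [h1, h2]
    rw [hsum, ← tsum_mul_left, ENNReal.ofReal_tsum_of_nonneg _ ((hle _).mul_left κ)]
    · refine tsum_congr fun j => ?_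
      split_ifs
      · unfold Params.relPower
        rw [← ENNReal.ofReal_mul (by positivity)]
        congr 1
        unfold loss2
        ring
      · simp
    · intro j
      have := hω.h2_pos j
      unfold loss2
      split_ifs <;> positivity
  have h1 := hω.I1_pos i
  have h2 : 0 ≤ M.IPlus n ω + M.IMinus n ω := by
    refine add_nonneg (tsum_nonneg fun j => ?_) (tsum_nonneg fun j => ?_) <;>
    · have := hω.h2_pos j
      unfold loss2
      split_ifs <;> positivity
  unfold Exceeds SINR
  rw [← hzdef, hI1, hI2, Params.relNoise, ← ENNReal.ofReal_add (by positivity) (by positivity),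
    ← ENNReal.ofReal_add (by positivity) (by positivity),
    ENNReal.ofReal_le_ofReal_iff (hω.h1_pos i).le, le_div_iff₀ (by linarith), ← hκ, ← mul_add,
    ← mul_add]
  have hzz : z ^ (-p.α) * z ^ p.α = 1 := by
    rw [← Real.rpow_add hz]
    simp
  have hloss : M.loss1 i ω = z ^ (-p.α) := rfl
  have hpos : 0 < p.P1 * z ^ (-p.α) := by positivity
  rw [← mul_le_mul_iff_right₀ hpos, hloss]
  have e1 : p.P1 * z ^ (-p.α) * (κ * (p.noise + (M.IPlus n ω + M.IMinus n ω) + M.I1 i ω)) =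
      (z ^ (-p.α) * z ^ p.α) * (p.P1 * p.P1⁻¹) *
        (δ * (M.I1 i ω + M.IPlus n ω + M.IMinus n ω + p.noise)) := by
    rw [hκ]
    ring
  rw [e1, hzz, mul_inv_cancel₀ hP.ne', one_mul, one_mul]
  have e2 : p.P1 * z ^ (-p.α) * M.h1 i ω = p.P1 * M.h1 i ω * z ^ (-p.α) := by ring
  rw [e2]

lemma Good.accessRate_iff {ω : Ω} (hω : M.Good ω) (n i : ℕ) {l : ℕ} (hl : M.load ω = l + 1) :
    p.R0 ≤ M.accessRate n i ω ↔ M.Exceeds (p.δ1 l) i ω := by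
  rw [hω.exceeds_iff n i (p.δ1_pos l)]
  have hW := p.W_pos
  have hS : 0 ≤ M.SINR n i ω := by
    have h1 := hω.I1_pos i
    have h2 := hω.h1_pos i
    have h3 := p.P1_pos
    have h4 := p.noise_nonneg
    have h5 := p.P2_pos
    have h6 : 0 ≤ M.IPlus n ω := tsum_nonneg fun j => by
      have := hω.h2_pos j
      unfold loss2
      split_ifs <;> positivity
    have h7 : 0 ≤ M.IMinus n ω := tsum_nonneg fun j => by
      have := hω.h2_pos j
      unfold loss2
      split_ifs <;> positivity
    unfold SINR loss1
    positivity
  have hl0 : (0 : ℝ) < (l : ℝ) + 1 := by positivity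
  unfold accessRate Params.δ1
  rw [hl, Nat.cast_succ, sub_le_iff_le_add', ← Real.le_logb_iff_rpow_le one_lt_two (by linarith),
    div_mul_eq_mul_div, le_div_iff₀ hl0, ← mul_div_assoc, div_le_iff₀ hW, mul_comm p.R0,
    mul_comm p.W]

/-- Here `W / 0 = 0`, so the rate is `0`. Load `0`, which `load_law` does not mention, therefore
never counts as a success. -/
lemma accessRate_of_load_eq_zero {ω : Ω} (n i : ℕ) (hl : M.load ω = 0) :
    ¬ p.R0 ≤ M.accessRate n i ω := by
  unfold accessRate
  rw [hl]
  simpa using p.R0_pos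

end Network

/-! ## Access delivery -/

namespace Params

variable (p : Params) {δ : ℝ}

/-- Ratio of the distances at which a helper and a macro base station are equally strong. -/
def distRatio : ℝ := (p.P2 / p.P1) ^ (1 / p.α)

lemma distRatio_pos : 0 < p.distRatio := by
  have := p.P1_pos
  have := p.P2_pos
  unfold distRatio
  positivity

lemma α_pos : 0 < p.α := by linarith [p.two_lt_α]

lemma distRatio_rpow : p.distRatio ^ p.α = p.P2 / p.P1 := by
  have h1 := p.P1_pos
  have h2 := p.P2_pos
  rw [distRatio, ← Real.rpow_mul (by positivity), one_div, inv_mul_cancel₀ p.α_pos.ne',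
    Real.rpow_one]

lemma distRatio_sq : p.distRatio ^ 2 = p.P2 ^ (2 / p.α) / p.P1 ^ (2 / p.α) := by
  have h1 := p.P1_pos
  have h2 := p.P2_pos
  rw [distRatio, ← Real.rpow_natCast, ← Real.rpow_mul (by positivity),
    Real.div_rpow h2.le h1.le]
  congr 2 <;> push_cast <;> ring

lemma one_sub_inv_relPower_P2 (hδ : 0 < δ) {z : ℝ} (hz : 0 ≤ z) (y : Plane) :
    1 - (1 + p.relPower δ p.P2 z y)⁻¹ =
      ENNReal.ofReal (lossFactor p.α δ (p.distRatio * z) ‖y‖) := by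
  have h1 := p.P1_pos
  have h2 := p.P2_pos
  rw [relPower, one_sub_inv_ofReal (by positivity), lossFactor,
    Real.mul_rpow p.distRatio_pos.le hz, distRatio_rpow]
  have e : δ * z ^ p.α * p.P1⁻¹ * (p.P2 * ‖y‖ ^ (-p.α)) =
      δ * (p.P2 / p.P1 * z ^ p.α) * ‖y‖ ^ (-p.α) := by ring
  rw [e]

/-- The exclusion radius for helpers storing `n` equals the scale of their loss factor in
`one_sub_inv_relPower_P2`. This is why their interference is again expressed by `G` at the same
argument. -/
lemma stronger_iff {z : ℝ} (hz : 0 < z) {y : Plane} (hy : y ≠ 0) :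
    p.P1 * z ^ (-p.α) < p.P2 * ‖y‖ ^ (-p.α) ↔ ‖y‖ < p.distRatio * z := by
  have h1 := p.P1_pos
  have h2 := p.P2_pos
  have hy0 := norm_pos_iff.2 hy
  have hr := p.distRatio_pos
  rw [← Real.rpow_lt_rpow_iff_of_neg (by positivity) hy0 (neg_lt_zero.2 p.α_pos),
    Real.mul_rpow hr.le hz.le, Real.rpow_neg hr.le, distRatio_rpow, inv_div, div_mul_eq_mul_div,
    div_lt_iff₀ h2, mul_comm (‖y‖ ^ (-p.α))]

/-- The coefficient of `π λ₂ z²` in the exponent contributed by the helpers. -/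
def helperCoeff (δ : ℝ) : ℝ :=
  p.distRatio ^ 2 *
    (p.pLp + p.pa * p.pLp * G δ p.α + p.pa * (1 - p.pLp) * H δ p.α)

lemma lintegral_one_sub_helperFactor (hδ : 0 < δ) (hpa : 0 ≤ p.pa ∧ p.pa ≤ 1)
    (hpL : 0 ≤ p.pLp ∧ p.pLp ≤ 1) {z : ℝ} (hz : 0 < z) :
    ∫⁻ y, (1 - p.helperFactor δ z y) = ENNReal.ofReal (Real.pi * z ^ 2 * p.helperCoeff δ) := by
  have hα := p.two_lt_α
  have hr : 0 < p.distRatio * z := mul_pos p.distRatio_pos hz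
  set ρ := p.distRatio * z with hρ
  have hloss : ∀ y : Plane, 0 ≤ lossFactor p.α δ ρ ‖y‖ := fun y =>
    lossFactor_nonneg hδ.le hr.le (norm_nonneg y)
  -- With `w = 1/(1 + relPower)`, the left side is `p_Lp + p_a (1 - p_Lp)(1 - w)` inside the
  -- exclusion disc and `p_a (1 - w)` outside. Splitting the latter by `1 = (1 - p_Lp) + p_Lp`
  -- leaves a whole-plane term for `H` and an exterior term for `G`.
  have hpt : ∀ᵐ y : Plane, 1 - p.helperFactor δ z y =
      ENNReal.ofReal p.pLp * (Metric.ball (0 : Plane) ρ).indicator 1 y +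
      (ENNReal.ofReal (p.pa * (1 - p.pLp)) * ENNReal.ofReal (lossFactor p.α δ ρ ‖y‖) +
      ENNReal.ofReal (p.pa * p.pLp) * (Metric.ball (0 : Plane) ρ)ᶜ.indicator
        (fun y => ENNReal.ofReal (lossFactor p.α δ ρ ‖y‖)) y) := by
    have : ∀ᵐ y : Plane, y ≠ 0 := by simp [ae_iff]
    filter_upwards [this] with y hy
    have hs : 0 ≤ δ * z ^ p.α * p.P1⁻¹ * (p.P2 * ‖y‖ ^ (-p.α)) := by
      have := p.P1_pos
      have := p.P2_pos
      positivity
    have hL := p.one_sub_inv_relPower_P2 hδ hz.le y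
    rw [← hρ] at hL
    set w : ℝ := (1 + δ * z ^ p.α * p.P1⁻¹ * (p.P2 * ‖y‖ ^ (-p.α)))⁻¹ with hw
    have hw0 : 0 ≤ w := by positivity
    have hw1 : w ≤ 1 := inv_le_one_of_one_le₀ (by linarith)
    have hwe : (1 + p.relPower δ p.P2 z y)⁻¹ = ENNReal.ofReal w := by
      rw [relPower, ← ENNReal.ofReal_one, ← ENNReal.ofReal_add zero_le_one hs,
        ← ENNReal.ofReal_inv_of_pos (by linarith)]
    have hlw : lossFactor p.α δ ρ ‖y‖ = 1 - w := by
      rw [hwe, ← ENNReal.ofReal_one, ← ENNReal.ofReal_sub _ hw0, ENNReal.ofReal_eq_ofReal_iff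
        (by linarith) (hloss y)] at hL
      exact hL.symm
    have hq0 : 0 ≤ 1 - p.pa := by linarith
    have hq1 : 0 ≤ 1 - p.pLp := by linarith
    have hin : ENNReal.ofReal (1 - p.pa) + ENNReal.ofReal p.pa * ENNReal.ofReal w =
        ENNReal.ofReal (1 - p.pa + p.pa * w) := by
      rw [← ENNReal.ofReal_mul hpa.1, ← ENNReal.ofReal_add hq0 (mul_nonneg hpa.1 hw0)]
    have hin0 : 0 ≤ 1 - p.pa + p.pa * w := add_nonneg hq0 (mul_nonneg hpa.1 hw0)
    rw [helperFactor, hwe, hin, hlw]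
    simp only [p.stronger_iff hz hy, ← hρ]
    by_cases hyr : ‖y‖ < ρ
    · rw [if_pos hyr, Set.indicator_of_mem (by simpa using hyr),
        Set.indicator_of_notMem (by simpa using hyr), Pi.one_apply, mul_one, mul_zero, add_zero,
        ← ENNReal.ofReal_mul hq1, ← ENNReal.ofReal_one,
        ← ENNReal.ofReal_sub _ (mul_nonneg hq1 hin0),
        ← ENNReal.ofReal_mul (mul_nonneg hpa.1 hq1), ← ENNReal.ofReal_add hpL.1
          (mul_nonneg (mul_nonneg hpa.1 hq1) (by linarith))]
      congr 1
      ring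
    · rw [if_neg hyr, Set.indicator_of_notMem (by simpa using hyr),
        Set.indicator_of_mem (by simpa using hyr), mul_zero, zero_add, one_mul, hlw,
        ← ENNReal.ofReal_one, ← ENNReal.ofReal_sub _ hin0,
        ← ENNReal.ofReal_mul (mul_nonneg hpa.1 hq1), ← ENNReal.ofReal_mul (mul_nonneg hpa.1 hpL.1),
        ← ENNReal.ofReal_add (mul_nonneg (mul_nonneg hpa.1 hq1) (by linarith))
          (mul_nonneg (mul_nonneg hpa.1 hpL.1) (by linarith))]
      congr 1
      ring
  have hm : Measurable fun y : Plane => ENNReal.ofReal (lossFactor p.α δ ρ ‖y‖) := by fun_prop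
  have hG := G_nonneg hδ hα
  have hH := H_nonneg hδ hα
  have hq1 : 0 ≤ 1 - p.pLp := by linarith
  have hpi := Real.pi_pos
  rw [lintegral_congr_ae hpt, lintegral_add_left (Measurable.const_mul
      (measurable_one.indicator measurableSet_ball) _), lintegral_add_left (hm.const_mul _),
    lintegral_const_mul' _ _ ofReal_ne_top, lintegral_const_mul' _ _ ofReal_ne_top,
    lintegral_const_mul' _ _ ofReal_ne_top, lintegral_indicator_one measurableSet_ball,
    lintegral_indicator measurableSet_ball.compl, lintegral_lossFactor_plane hδ hα hr,
    lintegral_lossFactor_compl_ball hδ hα hr, volume_ball_plane hr.le,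
    ← ENNReal.ofReal_mul hpL.1, ← ENNReal.ofReal_mul (mul_nonneg hpa.1 hq1),
    ← ENNReal.ofReal_mul (mul_nonneg hpa.1 hpL.1),
    ← ENNReal.ofReal_add (mul_nonneg (mul_nonneg hpa.1 hq1) (by positivity))
      (mul_nonneg (mul_nonneg hpa.1 hpL.1) (by positivity)),
    ← ENNReal.ofReal_add (mul_nonneg hpL.1 (by positivity))
      (add_nonneg (mul_nonneg (mul_nonneg hpa.1 hq1) (by positivity))
      (mul_nonneg (mul_nonneg hpa.1 hpL.1) (by positivity)))]
  congr 1
  rw [helperCoeff, hρ]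
  ring

lemma helperCoeff_nonneg (hδ : 0 < δ) (hpa : 0 ≤ p.pa ∧ p.pa ≤ 1)
    (hpL : 0 ≤ p.pLp ∧ p.pLp ≤ 1) : 0 ≤ p.helperCoeff δ := by
  have hG := G_nonneg hδ p.two_lt_α
  have hH := H_nonneg hδ p.two_lt_α
  have hq1 : 0 ≤ 1 - p.pLp := by linarith
  have := hpa.1
  have := hpL.1
  unfold helperCoeff
  positivity

/-- The real form of `outerFactor`. -/
def outerReal (δ z : ℝ) : ℝ :=
  Real.exp (-(z ^ p.α * p.P1⁻¹ * δ * p.noise)) *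
    Real.exp (-(Real.pi * p.lam2 * z ^ 2 * p.helperCoeff δ))

lemma outerFactor_eq (hδ : 0 < δ) (hpa : 0 ≤ p.pa ∧ p.pa ≤ 1)
    (hpL : 0 ≤ p.pLp ∧ p.pLp ≤ 1) {z : ℝ} (hz : 0 < z) :
    p.outerFactor δ z = ENNReal.ofReal (p.outerReal δ z) := by
  have h1 := p.P1_pos
  have h2 := p.noise_nonneg
  have h3 := p.lam2_pos
  have h4 := p.helperCoeff_nonneg hδ hpa hpL
  rw [outerFactor, p.lintegral_one_sub_helperFactor hδ hpa hpL hz, relNoise,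
    ← ENNReal.ofReal_mul h3.le, expNeg_ofReal (by positivity), expNeg_ofReal (by positivity),
    ← ENNReal.ofReal_mul (Real.exp_pos _).le, outerReal]
  congr 3
  · ring
  · ring_nf

lemma outerReal_antitoneOn (hδ : 0 < δ) (hpa : 0 ≤ p.pa ∧ p.pa ≤ 1)
    (hpL : 0 ≤ p.pLp ∧ p.pLp ≤ 1) : AntitoneOn (p.outerReal δ) (Set.Ioi 0) := by
  intro a ha b hb hab
  have ha0 : 0 < a := ha
  have h0 := p.α_pos
  have h1 := p.P1_pos
  have h2 := p.noise_nonneg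
  have h3 := p.lam2_pos
  have h4 := p.helperCoeff_nonneg hδ hpa hpL
  unfold outerReal
  gcongr

lemma outerReal_continuousOn : ContinuousOn (p.outerReal δ) (Set.Ioi 0) := by
  have h0 := p.α_pos.le
  have : Continuous fun z : ℝ => z ^ p.α := Real.continuous_rpow_const h0
  unfold outerReal
  exact Continuous.continuousOn (by fun_prop)

lemma measurable_outerFactor : Measurable (p.outerFactor δ) := by
  have h : Measurable fun q : ℝ × Plane => 1 - p.helperFactor δ q.1 q.2 := by
    unfold helperFactor
    refine measurable_const.sub (Measurable.mul (Measurable.ite ?_ measurable_const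
      measurable_const) (by fun_prop))
    exact measurableSet_lt (by fun_prop) (by fun_prop)
  have h2 := h.lintegral_prod_right' (ν := volume)
  unfold outerFactor
  exact (measurable_expNeg.comp (p.measurable_relNoise δ measurable_id)).mul
    (measurable_expNeg.comp (h2.const_mul _))

/-- The density of the distance of the serving macro base station on the event that the fading
exceeds the threshold. -/
def serveDensity (δ z : ℝ) : ℝ :=
  2 * (Real.pi * p.lam1) * z *
    (p.outerReal δ z * Real.exp (-(Real.pi * p.lam1 * z ^ 2 * (1 + G δ p.α))))

/-- Since `distRatio² = (P₂/P₁)^(2/α)`, multiplying the bracket with `ξ₁`, `ς₁`, `ζ₁` by `λ₁` gives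
`λ₁ (1 + G)` from the macro stations plus `λ₂` times `helperCoeff`. -/
lemma term_eq (z : ℝ) (l : ℕ) : p.term z l = p.serveDensity (p.δ1 l) z * p.loadPMF l := by
  have h1 : p.P1 ^ (2 / p.α) ≠ 0 := (Real.rpow_pos_of_pos p.P1_pos _).ne'
  have h2 := p.lam1_pos.ne'
  have e : Real.pi * p.lam1 * z ^ 2 *
      (p.ξ1 * G (p.δ1 l) p.α + p.ς1 * H (p.δ1 l) p.α + p.ζ1) =
      Real.pi * p.lam2 * z ^ 2 * p.helperCoeff (p.δ1 l) +
        Real.pi * p.lam1 * z ^ 2 * (1 + G (p.δ1 l) p.α) := by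
    rw [helperCoeff, distRatio_sq, ξ1, ς1, ζ1]
    field_simp
    ring
  rw [term, e, serveDensity, outerReal, neg_add, Real.exp_add]
  ring

lemma serveDensity_nonneg {z : ℝ} (hz : 0 ≤ z) : 0 ≤ p.serveDensity δ z := by
  have := p.lam1_pos
  unfold serveDensity outerReal
  positivity

lemma serveDensity_pos {z : ℝ} (hz : 0 < z) : 0 < p.serveDensity δ z := by
  have := p.lam1_pos
  unfold serveDensity outerReal
  positivity

/-- The bound does not depend on `δ`, so it dominates the series over the load by a multiple of
`loadPMF`. -/
lemma serveDensity_le (hδ : 0 < δ) (hpa : 0 ≤ p.pa ∧ p.pa ≤ 1)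
    (hpL : 0 ≤ p.pLp ∧ p.pLp ≤ 1) {z : ℝ} (hz : 0 ≤ z) :
    p.serveDensity δ z ≤ 2 * (Real.pi * p.lam1) * z := by
  have h0 := p.lam1_pos
  have h1 := p.P1_pos
  have h2 := p.noise_nonneg
  have h3 := p.lam2_pos
  have h4 := p.helperCoeff_nonneg hδ hpa hpL
  have h5 := G_nonneg hδ p.two_lt_α
  have hpi := Real.pi_pos
  unfold serveDensity outerReal
  refine mul_le_of_le_one_right (by positivity) (mul_le_one₀ (mul_le_one₀ ?_ (Real.exp_pos _).le ?_)
    (Real.exp_pos _).le ?_) <;>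
  · rw [Real.exp_le_one_iff, neg_nonpos]
    positivity

lemma measurable_serveDensity : Measurable (p.serveDensity δ) := by
  unfold serveDensity outerReal
  fun_prop

end Params

/-! ### Access success at a fixed load, then mixed over the load. -/

namespace Network

variable {p : Params} {Ω : Type*} [MeasurableSpace Ω] {μ : Measure Ω} [IsProbabilityMeasure μ]
  (M : Network p μ)

/-- The event that some macro base station is nearest, unblocked and has enough fading. -/
def successSet (n : ℕ) (δ : ℝ) : Set Ω := ⋃ i, M.serveSet n δ i (nearest i)

omit [IsProbabilityMeasure μ] in
lemma measurableSet_serveSet (n : ℕ) (δ : ℝ) (i : ℕ) {D : Set (ℕ → Plane)}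
    (hD : MeasurableSet D) : MeasurableSet (M.serveSet n δ i D) :=
  (measurableSet_serveRadio n δ i hD).preimage M.measurable_radio

/-- The probability of access success for a given load. -/
theorem measure_successSet {n : ℕ} (hn : n ∈ p.secondGroup) {δ : ℝ} (hδ : 0 < δ) :
    μ (M.successSet n δ) = ∫⁻ z in Set.Ioi (0 : ℝ), ENNReal.ofReal (p.serveDensity δ z) := by
  have hpa := M.pa_mem
  have hpL := M.pLp_mem hn
  -- The sum is the same for weakly and strictly nearest stations, so ties need no separate
  -- treatment: the union bound over `nearest` gives `≤`, and the disjoint union over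
  -- `strictNearest` gives `≥`.
  have key : ∀ D : ℕ → Set (ℕ → Plane), (∀ i, MeasurableSet (D i)) →
      (∀ i, strictNearest i ⊆ D i) → (∀ i, D i ⊆ nearest i) →
      ∑' i, μ (M.serveSet n δ i (D i)) =
        ∫⁻ z in Set.Ioi (0 : ℝ), ENNReal.ofReal (p.serveDensity δ z) := by
    intro D hD hDs hDn
    simp_rw [fun i => M.measure_serveSet hn δ i (hD i)]
    exact p.tsum_lintegral_serve M.ppp1 hδ hD hDs hDn p.measurable_outerFactor
      (fun z hz => p.outerFactor_eq hδ hpa hpL hz) p.outerReal_continuousOn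
      (p.outerReal_antitoneOn hδ hpa hpL)
      (fun z _ => mul_nonneg (Real.exp_pos _).le (Real.exp_pos _).le)
  refine le_antisymm ?_ ?_
  · exact (measure_iUnion_le _).trans_eq (key nearest measurableSet_nearest
      strictNearest_subset_nearest fun _ => subset_rfl)
  · rw [← key strictNearest measurableSet_strictNearest (fun _ => subset_rfl)
      strictNearest_subset_nearest, ← measure_iUnion _ fun i =>
        M.measurableSet_serveSet n δ i (measurableSet_strictNearest i)]
    · refine measure_mono (Set.iUnion_mono fun i ω hω => ?_)
      exact ⟨strictNearest_subset_nearest i hω.1, hω.2⟩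
    · intro i j hij
      rw [Function.onFun, Set.disjoint_left]
      intro ω hi hj
      exact lt_asymm (hi.1 j hij.symm) (hj.1 i hij)

omit [IsProbabilityMeasure μ] in
lemma indep_load_successSet (n : ℕ) (δ : ℝ) (l : ℕ) :
    μ ({ω | M.load ω = l} ∩ M.successSet n δ) =
      μ {ω | M.load ω = l} * μ (M.successSet n δ) := by
  have hR : MeasurableSet (⋃ i, serveRadio p n δ i (nearest i)) :=
    MeasurableSet.iUnion fun i => measurableSet_serveRadio n δ i (measurableSet_nearest i)
  have hS : M.successSet n δ = M.radio ⁻¹' ⋃ i, serveRadio p n δ i (nearest i) := by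
    rw [Set.preimage_iUnion]
    rfl
  have hL : {ω | M.load ω = l} = (fun ω => (M.load ω, (fun u => M.miss u ω), M.sched ω)) ⁻¹'
      (Prod.fst ⁻¹' {l}) := rfl
  rw [hS, hL, Set.inter_comm, M.indepFun_radio.measure_inter_preimage_eq_mul _ _ hR
    ((measurableSet_singleton l).preimage measurable_fst), mul_comm]

lemma accessSuccess_ae_eq (n : ℕ) :
    M.accessSuccess n =ᵐ[μ] ⋃ l : ℕ, {ω | M.load ω = l + 1} ∩ M.successSet n (p.δ1 l) := by
  refine Filter.eventuallyEq_set.2 ?_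
  filter_upwards [M.ae_good] with ω hω
  simp only [Set.mem_iUnion, successSet, Set.mem_inter_iff]
  constructor
  · rintro ⟨i, h1, h2⟩
    rcases Nat.eq_zero_or_eq_succ_pred (M.load ω) with h0 | h0
    · exact absurd h2 (accessRate_of_load_eq_zero n i h0)
    · refine ⟨_, h0, i, ?_⟩
      have h3 := (hω.serves_iff n i).1 h1
      exact ⟨h3.1, h3.2, (hω.accessRate_iff n i h0).1 h2⟩
  · rintro ⟨l, hl, i, h1, h2, h3⟩
    exact ⟨i, (hω.serves_iff n i).2 ⟨h1, h2⟩, (hω.accessRate_iff n i hl).2 h3⟩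

omit [IsProbabilityMeasure μ] in
lemma measurableSet_load (l : ℕ) : MeasurableSet {ω | M.load ω = l} :=
  M.load_meas (measurableSet_singleton l)

lemma measure_load (l : ℕ) : μ {ω | M.load ω = l + 1} = ENNReal.ofReal (p.loadPMF l) := by
  rw [← M.load_law l, ofReal_measureReal]

omit [IsProbabilityMeasure μ] in
lemma loadPMF_nonneg (M : Network p μ) (l : ℕ) : 0 ≤ p.loadPMF l := by
  rw [← M.load_law l]
  exact measureReal_nonneg

lemma tsum_measure_load_le : ∑' l : ℕ, μ {ω | M.load ω = l + 1} ≤ 1 := by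
  rw [← measure_iUnion]
  · exact prob_le_one
  · intro l k hlk
    rw [Function.onFun, Set.disjoint_left]
    intro ω h1 h2
    exact hlk (Nat.succ_injective (h1.symm.trans h2))
  · exact fun l => M.measurableSet_load _

/-- The terms are probabilities of disjoint events, so no estimate of the Gamma quotients is needed.
-/
lemma summable_loadPMF (M : Network p μ) : Summable p.loadPMF :=
  (ENNReal.summable_toReal (M.tsum_measure_load_le.trans_lt one_lt_top).ne).congr M.load_law

/-- The probability of access success, as an iterated integral. -/
theorem measure_accessSuccess {n : ℕ} (hn : n ∈ p.secondGroup) :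
    μ (M.accessSuccess n) =
      ∫⁻ z in Set.Ioi (0 : ℝ), ∑' l : ℕ, ENNReal.ofReal (p.term z l) := by
  have hS : ∀ δ, MeasurableSet (M.successSet n δ) := fun δ =>
    MeasurableSet.iUnion fun i => M.measurableSet_serveSet n δ i (measurableSet_nearest i)
  rw [measure_congr (M.accessSuccess_ae_eq n), measure_iUnion, lintegral_tsum]
  · refine tsum_congr fun l => ?_
    rw [M.indep_load_successSet, M.measure_load, M.measure_successSet hn (p.δ1_pos l),
      ← lintegral_const_mul' _ _ ofReal_ne_top]
    refine setLIntegral_congr_fun measurableSet_Ioi fun z hz => ?_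
    rw [p.term_eq, mul_comm (p.serveDensity _ _), ENNReal.ofReal_mul (M.loadPMF_nonneg l)]
  · intro l
    simp_rw [p.term_eq]
    exact (p.measurable_serveDensity.mul_const _).ennreal_ofReal.aemeasurable
  · intro l k hlk
    rw [Function.onFun, Set.disjoint_left]
    intro ω h1 h2
    exact hlk (Nat.succ_injective (h1.1.symm.trans h2.1))
  · exact fun l => (M.measurableSet_load _).inter (hS _)

omit [IsProbabilityMeasure μ] in
lemma term_nonneg (M : Network p μ) {z : ℝ} (hz : 0 < z) (l : ℕ) : 0 ≤ p.term z l := by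
  rw [p.term_eq]
  exact mul_nonneg (p.serveDensity_nonneg hz.le) (M.loadPMF_nonneg l)

lemma summable_term (M : Network p μ) {n : ℕ} (hn : n ∈ p.secondGroup) {z : ℝ} (hz : 0 < z) :
    Summable fun l : ℕ => p.term z l := by
  refine Summable.of_nonneg_of_le (M.term_nonneg hz) (fun l => ?_)
    (M.summable_loadPMF.mul_left (2 * (Real.pi * p.lam1) * z))
  rw [p.term_eq]
  exact mul_le_mul_of_nonneg_right (p.serveDensity_le (p.δ1_pos l) M.pa_mem (M.pLp_mem hn) hz.le)
    (M.loadPMF_nonneg l)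

lemma access_formula (M : Network p μ) {n : ℕ} (hn : n ∈ p.secondGroup) :
    IntegrableOn (fun z : ℝ => ∑' l : ℕ, p.term z l) (Set.Ioi 0) ∧
      μ.real (M.accessSuccess n) = ∫ z in Set.Ioi (0 : ℝ), ∑' l : ℕ, p.term z l := by
  have h1 : ∫⁻ z in Set.Ioi (0 : ℝ), ENNReal.ofReal (∑' l : ℕ, p.term z l) =
      μ (M.accessSuccess n) := by
    rw [M.measure_accessSuccess hn]
    refine setLIntegral_congr_fun measurableSet_Ioi fun z hz => ?_
    exact ENNReal.ofReal_tsum_of_nonneg (M.term_nonneg hz) (M.summable_term hn hz)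
  have hnn : ∀ᵐ z ∂(volume.restrict (Set.Ioi (0 : ℝ))), 0 ≤ ∑' l : ℕ, p.term z l :=
    (ae_restrict_iff' measurableSet_Ioi).2 (ae_of_all _ fun z hz => tsum_nonneg (M.term_nonneg hz))
  have hm : Measurable fun z : ℝ => ∑' l : ℕ, p.term z l := by
    simp_rw [p.term_eq]
    exact Measurable.tsum fun l => p.measurable_serveDensity.mul_const _
  have hint : IntegrableOn (fun z : ℝ => ∑' l : ℕ, p.term z l) (Set.Ioi 0) :=
    (lintegral_ofReal_ne_top_iff_integrable hm.aestronglyMeasurable hnn).1 (by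
      rw [h1]
      exact measure_ne_top _ _)
  refine ⟨hint, ?_⟩
  rw [Measure.real, ← h1, ← ofReal_integral_eq_lintegral_ofReal hint hnn,
    ENNReal.toReal_ofReal (integral_nonneg_of_ae hnn)]

/-- Success at any threshold implies association, and its probability is the integral of a positive
density. The threshold `1` is an arbitrary choice. -/
lemma measure_assocMacro_pos {n : ℕ} (hn : n ∈ p.secondGroup) : 0 < μ (M.assocMacro n) := by
  have h1 : 0 < μ (M.successSet n 1) := by
    rw [M.measure_successSet hn one_pos, setLIntegral_pos_iff
      p.measurable_serveDensity.ennreal_ofReal]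
    refine lt_of_lt_of_le ?_ (measure_mono (s := Set.Ioi (0 : ℝ)) fun z hz => ⟨?_, hz⟩)
    · simp
    · simpa using p.serveDensity_pos hz
  refine h1.trans_le (measure_mono_ae ?_)
  filter_upwards [M.ae_good] with ω hω h
  obtain ⟨i, h1, h2, -⟩ := Set.mem_iUnion.1 h
  exact ⟨i, (hω.serves_iff n i).2 ⟨h1, h2⟩⟩

end Network

/-! ## Backhaul delivery -/

/-- The number of `k`-subsets of a finite set that contain a given element. -/
lemma card_powersetCard_filter_mem {U : Finset ℕ} {a : ℕ} (ha : a ∈ U) (k : ℕ) (hk : k ≤ U.card) :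
    (((U.powersetCard k).filter (a ∈ ·)).card : ℝ) * U.card = k * U.card.choose k := by
  -- The subsets avoiding `a` are easier to count: they are the `k`-subsets of `U.erase a`.
  have h1 : (U.powersetCard k).filter (a ∉ ·) = (U.erase a).powersetCard k := by
    ext T
    simp only [Finset.mem_filter, Finset.mem_powersetCard]
    constructor
    · rintro ⟨⟨h1, h2⟩, h3⟩
      exact ⟨Finset.subset_erase.2 ⟨h1, h3⟩, h2⟩
    · rintro ⟨h1, h2⟩
      exact ⟨⟨(Finset.subset_erase.1 h1).1, h2⟩, (Finset.subset_erase.1 h1).2⟩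
  have h2 := Finset.card_filter_add_card_filter_not (s := U.powersetCard k) (a ∈ ·)
  obtain ⟨m, hm⟩ : ∃ m, U.card = m + 1 :=
    Nat.exists_eq_succ_of_ne_zero (Finset.card_ne_zero_of_mem ha)
  rw [h1, Finset.card_powersetCard, Finset.card_powersetCard, Finset.card_erase_of_mem ha, hm,
    Nat.add_sub_cancel] at h2
  have h3 := Nat.choose_mul_succ_eq m k
  rw [hm] at hk ⊢
  have h2' : (((U.powersetCard k).filter (a ∈ ·)).card : ℝ) + m.choose k = (m + 1).choose k := by
    exact_mod_cast h2
  have h3' : (m.choose k : ℝ) * (m + 1) = (m + 1).choose k * (m + 1 - k) := by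
    have : ((m + 1 - k : ℕ) : ℝ) = (m : ℝ) + 1 - k := by
      rw [Nat.cast_sub hk]
      push_cast
      ring
    rw [← this]
    exact_mod_cast h3
  push_cast
  linear_combination ((m : ℝ) + 1) * h2' - h3'

/-! ### Positivity of the load probabilities. -/

namespace Params

variable (p : Params)

lemma q_nonneg (n : ℕ) : 0 ≤ p.q n := by
  unfold q
  positivity

lemma q_pos {n : ℕ} (hn : n ∈ p.secondGroup) : 0 < p.q n := by
  have h := Finset.mem_Ioc.1 hn
  have hn1 : n ∈ Finset.Icc 1 p.N := Finset.mem_Icc.2 ⟨by omega, h.2⟩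
  have hpos : ∀ k ∈ Finset.Icc 1 p.N, (0 : ℝ) < (k : ℝ) ^ (-p.γ) := fun k hk => by
    have : 0 < k := (Finset.mem_Icc.1 hk).1
    positivity
  exact div_pos (hpos n hn1) (Finset.sum_pos hpos ⟨n, hn1⟩)

lemma A1_pos {n : ℕ} (hn : n ∈ p.secondGroup) (hL : 0 ≤ p.pLp) : 0 < p.A1 := by
  have h1 := p.lam1_pos
  have h2 := p.lam2_pos
  have h3 := p.P1_pos
  have h4 := p.P2_pos
  have h5 : 0 < p.QLp := Finset.sum_pos' (fun k _ => p.q_nonneg k) ⟨n, hn, p.q_pos hn⟩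
  have h6 : 0 ≤ p.QMp := Finset.sum_nonneg fun k _ => p.q_nonneg k
  unfold A1 ALp1 assocDen
  positivity

/-- Ensures that conditioning on a given load is not conditioning on a null event. -/
lemma loadPMF_pos {n : ℕ} (hn : n ∈ p.secondGroup) (hL : 0 ≤ p.pLp) (l : ℕ) : 0 < p.loadPMF l := by
  have h1 := p.A1_pos hn hL
  have h2 := p.lam1_pos
  have h3 := p.lamU_pos
  have h4 : 0 < Real.Gamma ((l : ℝ) + 4.5) := Real.Gamma_pos_of_pos (by positivity)
  have h5 : 0 < Real.Gamma (3.5 : ℝ) := Real.Gamma_pos_of_pos (by norm_num)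
  unfold loadPMF
  positivity

end Params

/-! ### Uniform scheduling and the binomial sum. -/

namespace Network

variable {p : Params} {Ω : Type*} [MeasurableSpace Ω] {μ : Measure Ω} [IsProbabilityMeasure μ]
  (M : Network p μ)

/-- The load is `l` and `U` is the set of users of the serving macro base station that need the
backhaul link. -/
def needSet (l : ℕ) (U : Finset ℕ) : Set Ω :=
  {ω | M.load ω = l ∧
    (Finset.range (M.load ω)).filter (fun u => u = 0 ∨ M.miss u ω = true) = U}

-- The tagged user `0` always belongs to the set, so fixing the set means prescribing the
-- independent bits `miss u` of the other users.
omit [IsProbabilityMeasure μ] in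
lemma needSet_eq (l : ℕ) {V : Finset ℕ} (hV : V ⊆ (Finset.range (l + 1)).erase 0) :
    M.needSet (l + 1) (insert 0 V) = {ω | M.load ω = l + 1} ∩
      ⋂ u ∈ (Finset.range (l + 1)).erase 0, M.miss u ⁻¹' {decide (u ∈ V)} := by
  ext ω
  simp only [needSet, Set.mem_inter_iff, Set.mem_iInter, Set.mem_preimage, Set.mem_singleton_iff]
  refine and_congr_right fun hl => ?_
  rw [show M.load ω = l + 1 from hl]
  constructor
  · intro h u hu
    have h1 := Finset.ext_iff.1 h u
    rw [Finset.mem_filter, Finset.mem_insert] at h1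
    have h2 := Finset.mem_erase.1 hu
    simp only [h2.1, h2.2, true_and, false_or] at h1
    rw [Bool.eq_iff_iff, h1, decide_eq_true_iff]
  · intro h
    ext u
    rw [Finset.mem_filter, Finset.mem_insert]
    by_cases h0 : u = 0
    · simp [h0]
    · simp only [h0, false_or]
      constructor
      · rintro ⟨h1, h2⟩
        have := h u (Finset.mem_erase.2 ⟨h0, h1⟩)
        rw [h2] at this
        exact of_decide_eq_true this.symm
      · intro h1
        refine ⟨(Finset.mem_erase.1 (hV h1)).2, ?_⟩
        rw [h u (hV h1)]
        exact decide_eq_true h1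

omit [IsProbabilityMeasure μ] in
lemma measurableSet_needSet (l : ℕ) {V : Finset ℕ} (hV : V ⊆ (Finset.range (l + 1)).erase 0) :
    MeasurableSet (M.needSet (l + 1) (insert 0 V)) := by
  rw [M.needSet_eq l hV]
  exact (M.measurableSet_load _).inter (Finset.measurableSet_biInter _ fun u _ =>
    M.miss_meas u (measurableSet_singleton _))

lemma measureReal_needSet (l : ℕ) {V : Finset ℕ} (hV : V ⊆ (Finset.range (l + 1)).erase 0) :
    μ.real (M.needSet (l + 1) (insert 0 V)) =
      p.loadPMF l * ((1 - p.pb) ^ (l - V.card) * p.pb ^ V.card) := by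
  set S := (Finset.range (l + 1)).erase 0 with hS
  have hcard : S.card = l := by simp [hS]
  have h1 : μ (M.needSet (l + 1) (insert 0 V)) = μ {ω | M.load ω = l + 1} *
      μ (⋂ u ∈ S, M.miss u ⁻¹' {decide (u ∈ V)}) := by
    have h := M.load_miss_indep.measure_inter_preimage_eq_mul {l + 1}
      (⋂ u ∈ S, (fun b : ℕ → Bool => b u) ⁻¹' {decide (u ∈ V)}) (measurableSet_singleton _)
      (Finset.measurableSet_biInter _ fun u _ => measurable_pi_apply u (measurableSet_singleton _))
    have h2 : (fun ω u => M.miss u ω) ⁻¹' (⋂ u ∈ S, (fun b : ℕ → Bool => b u) ⁻¹'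
        {decide (u ∈ V)}) = ⋂ u ∈ S, M.miss u ⁻¹' {decide (u ∈ V)} := by
      rw [Set.preimage_iInter₂]
      rfl
    rw [h2] at h
    rw [M.needSet_eq l hV]
    exact h
  have h2 : ∀ u, μ.real (M.miss u ⁻¹' {decide (u ∈ V)}) = if u ∈ V then p.pb else 1 - p.pb := by
    intro u
    have hm : MeasurableSet {ω | M.miss u ω = true} := M.miss_meas u (measurableSet_singleton true)
    split_ifs with hu
    · rw [← M.miss_law u, decide_eq_true hu]
      rfl
    · rw [← M.miss_law u, ← probReal_compl_eq_one_sub hm, decide_eq_false hu]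
      congr 1
      ext ω
      simp
  have h3 : μ.real (⋂ u ∈ S, M.miss u ⁻¹' {decide (u ∈ V)}) =
      (1 - p.pb) ^ (l - V.card) * p.pb ^ V.card := by
    rw [Measure.real, M.miss_indep.measure_inter_preimage_eq_mul S fun u _ =>
      measurableSet_singleton (decide (u ∈ V)), ENNReal.toReal_prod]
    change ∏ u ∈ S, μ.real (M.miss u ⁻¹' {decide (u ∈ V)}) = _
    simp_rw [h2]
    rw [Finset.prod_ite, Finset.prod_const, Finset.prod_const, Finset.filter_mem_eq_inter,
      Finset.inter_eq_right.2 hV, ← Finset.sdiff_eq_filter, Finset.card_sdiff_of_subset hV, hcard,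
      mul_comm]
  rw [Measure.real, h1, ENNReal.toReal_mul, ← h3, ← M.load_law l]
  rfl

/-- Given the users that need the backhaul link, the tagged user is scheduled with probability
`min N_b k / k`, where `k` is their number. -/
lemma measureReal_needSet_inter_sched (l : ℕ) {U : Finset ℕ} (hU : MeasurableSet (M.needSet l U))
    (h0 : 0 ∈ U) :
    μ.real (M.needSet l U ∩ {ω | 0 ∈ M.sched ω}) =
      μ.real (M.needSet l U) * (((min p.Nb U.card : ℕ) : ℝ) / U.card) := by
  set k := min p.Nb U.card with hk
  have hkU : k ≤ U.card := min_le_right _ _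
  set C : ℝ := (U.card.choose k : ℝ) with hC
  have hC0 : 0 < C := by
    rw [hC]
    exact_mod_cast Nat.choose_pos hkU
  have hU0 : (0 : ℝ) < U.card := by exact_mod_cast Finset.card_pos.2 ⟨0, h0⟩
  have hsm : ∀ T : Finset ℕ, MeasurableSet {ω | M.sched ω = T} := fun T =>
    M.sched_meas (measurableSet_singleton T)
  have hT : ∀ T ∈ U.powersetCard k, μ.real (M.needSet l U ∩ {ω | M.sched ω = T}) =
      μ.real (M.needSet l U) / C := by
    intro T hT
    rw [Finset.mem_powersetCard] at hT
    rw [hC, hk]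
    unfold needSet
    rw [← M.sched_law l U T hT.1 hT.2]
    congr 1
    ext ω
    exact and_assoc
  have hsum : ∀ F ⊆ U.powersetCard k, μ.real (M.needSet l U ∩ {ω | M.sched ω ∈ F}) =
      F.card * (μ.real (M.needSet l U) / C) := by
    intro F hF
    have hset : M.needSet l U ∩ {ω | M.sched ω ∈ F} =
        ⋃ T ∈ F, M.needSet l U ∩ {ω | M.sched ω = T} := by
      ext ω
      simp
    rw [hset, measureReal_biUnion_finset, Finset.sum_congr rfl fun T h => hT T (hF h),
      Finset.sum_const, nsmul_eq_mul]
    · intro T _ T' _ h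
      rw [Function.onFun, Set.disjoint_left]
      intro ω h1 h2
      exact h (h1.2.symm.trans h2.2)
    · exact fun T _ => hU.inter (hsm T)
  have hfull : μ.real (M.needSet l U ∩ {ω | M.sched ω ∈ U.powersetCard k}) =
      μ.real (M.needSet l U) := by
    rw [hsum _ subset_rfl, Finset.card_powersetCard]
    exact mul_div_cancel₀ _ hC0.ne'
  have hm : MeasurableSet {ω | M.sched ω ∈ U.powersetCard k} :=
    M.sched_meas (MeasurableSet.of_discrete (s := {T | T ∈ U.powersetCard k}))
  -- The law of the schedule is given only on subsets of the prescribed size. Their probabilities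
  -- already add up to that of `needSet`, so every other value is null there.
  have hnull : μ.real (M.needSet l U \ {ω | M.sched ω ∈ U.powersetCard k}) = 0 := by
    have := measureReal_inter_add_sdiff (μ := μ) (s := M.needSet l U) hm
    linarith
  have h1 : μ.real (M.needSet l U ∩ {ω | 0 ∈ M.sched ω}) =
      μ.real (M.needSet l U ∩ {ω | M.sched ω ∈ (U.powersetCard k).filter (0 ∈ ·)}) := by
    refine le_antisymm ?_ (measureReal_mono ?_)
    · calc _ ≤ μ.real ((M.needSet l U ∩ {ω | M.sched ω ∈ (U.powersetCard k).filter (0 ∈ ·)}) ∪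
            (M.needSet l U \ {ω | M.sched ω ∈ U.powersetCard k})) := by
            refine measureReal_mono fun ω hω => ?_
            by_cases h : M.sched ω ∈ U.powersetCard k
            · exact Or.inl ⟨hω.1, Finset.mem_filter.2 ⟨h, hω.2⟩⟩
            · exact Or.inr ⟨hω.1, h⟩
        _ ≤ _ := (measureReal_union_le _ _).trans_eq (by rw [hnull, add_zero])
    · exact fun ω hω => ⟨hω.1, (Finset.mem_filter.1 hω.2).2⟩
  rw [h1, hsum _ (Finset.filter_subset _ _)]
  have h2 := card_powersetCard_filter_mem h0 k hkU
  field_simp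
  rw [mul_right_comm, h2]
  ring

/-- The joint probability of the load and of the tagged user being scheduled. -/
lemma measureReal_load_inter_sched (l : ℕ) :
    μ.real ({ω | M.load ω = l + 1} ∩ {ω | 0 ∈ M.sched ω}) = p.loadPMF l *
      ∑ m ∈ Finset.range (l + 1), (l.choose m : ℝ) * (1 - p.pb) ^ (l - m) * p.pb ^ m *
        min 1 ((p.Nb : ℝ) / ((m : ℝ) + 1)) := by
  set S := (Finset.range (l + 1)).erase 0 with hS
  have hcard : S.card = l := by simp [hS]
  have h0S : ∀ {V : Finset ℕ}, V ⊆ S → 0 ∉ V := fun hV h => by simpa [hS] using hV h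
  have hm : MeasurableSet {ω | 0 ∈ M.sched ω} :=
    M.sched_meas (MeasurableSet.of_discrete (s := {T : Finset ℕ | 0 ∈ T}))
  -- The event is split according to the set `V` of other users needing the link. The probability of
  -- each piece depends on `V.card` alone, so summing over subsets yields the binomial coefficients.
  have hset : {ω | M.load ω = l + 1} ∩ {ω | 0 ∈ M.sched ω} =
      ⋃ V ∈ S.powerset, M.needSet (l + 1) (insert 0 V) ∩ {ω | 0 ∈ M.sched ω} := by
    ext ω
    simp only [Set.mem_iUnion, Set.mem_inter_iff, Finset.mem_powerset, exists_prop]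
    constructor
    · rintro ⟨h1, h2⟩
      have h1' : M.load ω = l + 1 := h1
      refine ⟨S.filter fun u => M.miss u ω = true, Finset.filter_subset _ _, ⟨h1, ?_⟩, h2⟩
      rw [h1']
      ext u
      simp only [hS, Finset.mem_filter, Finset.mem_insert, Finset.mem_erase]
      by_cases hu : u = 0 <;> simp [hu]
    · rintro ⟨V, -, h1, h2⟩
      exact ⟨h1.1, h2⟩
  rw [hset, measureReal_biUnion_finset]
  · have hV : ∀ V ∈ S.powerset, μ.real (M.needSet (l + 1) (insert 0 V) ∩ {ω | 0 ∈ M.sched ω}) =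
        (fun m : ℕ => p.loadPMF l * ((1 - p.pb) ^ (l - m) * p.pb ^ m *
          min 1 ((p.Nb : ℝ) / ((m : ℝ) + 1)))) V.card := by
      intro V hV
      rw [Finset.mem_powerset] at hV
      rw [M.measureReal_needSet_inter_sched _ (M.measurableSet_needSet l hV)
        (Finset.mem_insert_self 0 V), M.measureReal_needSet l hV,
        Finset.card_insert_of_notMem (h0S hV)]
      have hpos : (0 : ℝ) < (V.card : ℝ) + 1 := by positivity
      have : ((min p.Nb (V.card + 1) : ℕ) : ℝ) / ((V.card + 1 : ℕ) : ℝ) =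
          min 1 ((p.Nb : ℝ) / ((V.card : ℝ) + 1)) := by
        push_cast
        rw [← min_div_div_right hpos.le, div_self hpos.ne', min_comm]
      rw [this]
      ring
    rw [Finset.sum_congr rfl hV, Finset.sum_powerset_apply_card (fun m : ℕ => p.loadPMF l *
      ((1 - p.pb) ^ (l - m) * p.pb ^ m * min 1 ((p.Nb : ℝ) / ((m : ℝ) + 1)))), hcard,
      Finset.mul_sum]
    refine Finset.sum_congr rfl fun m _ => ?_
    rw [nsmul_eq_mul]
    ring
  · intro V hV V' hV' h
    rw [Function.onFun, Set.disjoint_left]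
    intro ω h1 h2
    have h3 : insert 0 V = insert 0 V' := h1.1.2.symm.trans h2.1.2
    have hV1 := Finset.mem_powerset.1 (Finset.mem_coe.1 hV)
    have hV2 := Finset.mem_powerset.1 (Finset.mem_coe.1 hV')
    apply h
    rw [← Finset.erase_insert (h0S hV1), h3, Finset.erase_insert (h0S hV2)]
  · exact fun V hV => (M.measurableSet_needSet l (Finset.mem_powerset.1 hV)).inter hm

/-! ### Independence of association and backhaul. -/

/-- `assocMacro` as a set of values of `radio`. -/
def assocRadio (p : Params) (n : ℕ) : Set RadioSpace :=
  ⋃ i, (⋂ j, {q | p.P1 * ‖q.1 j‖ ^ (-p.α) ≤ p.P1 * ‖q.1 i‖ ^ (-p.α)}) ∩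
    ⋂ j, {q | n ∈ q.2.2.1 j}ᶜ ∪ {q | p.P2 * ‖q.2.1 j‖ ^ (-p.α) ≤ p.P1 * ‖q.1 i‖ ^ (-p.α)}

lemma measurableSet_assocRadio (n : ℕ) : MeasurableSet (assocRadio p n) := by
  have h1 : ∀ j, MeasurableSet {q : RadioSpace | n ∈ q.2.2.1 j} := fun j =>
    (MeasurableSet.of_discrete (s := {c : Finset ℕ | n ∈ c})).preimage
      (f := fun q : RadioSpace => q.2.2.1 j) (by fun_prop)
  refine MeasurableSet.iUnion fun i => (MeasurableSet.iInter fun j => ?_).inter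
    (MeasurableSet.iInter fun j => (h1 j).compl.union ?_)
  · exact measurableSet_le (by fun_prop) (by fun_prop)
  · exact measurableSet_le (by fun_prop) (by fun_prop)

omit [IsProbabilityMeasure μ] in
lemma assocMacro_eq (n : ℕ) : M.assocMacro n = M.radio ⁻¹' assocRadio p n := by
  ext ω
  simp only [assocRadio, Set.mem_preimage, Set.mem_iUnion, Set.mem_inter_iff, Set.mem_iInter,
    Set.mem_union, Set.mem_compl_iff]
  refine exists_congr fun i => and_congr Iff.rfl (forall_congr' fun j => ?_)
  exact imp_iff_not_or

omit [IsProbabilityMeasure μ] in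
lemma measure_assocMacro_inter (n : ℕ) {B : Set (ℕ × (ℕ → Bool) × Finset ℕ)}
    (hB : MeasurableSet B) :
    μ (M.assocMacro n ∩ (fun ω => (M.load ω, (fun u => M.miss u ω), M.sched ω)) ⁻¹' B) =
      μ (M.assocMacro n) *
        μ ((fun ω => (M.load ω, (fun u => M.miss u ω), M.sched ω)) ⁻¹' B) := by
  rw [assocMacro_eq]
  exact M.indepFun_radio.measure_inter_preimage_eq_mul _ _ (measurableSet_assocRadio n) hB

/-- The conditional probability of backhaul success. -/
theorem cond_backhaul {n : ℕ} (hn : n ∈ p.secondGroup) (l : ℕ) :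
    (ProbabilityTheory.cond μ (M.assocMacro n ∩ {ω | M.load ω = l + 1})).real
        {ω | p.R0 ≤ M.backhaulRate ω} =
      ∑ m ∈ Finset.range (l + 1), (l.choose m : ℝ) * (1 - p.pb) ^ (l - m) * p.pb ^ m *
        min 1 ((p.Nb : ℝ) / ((m : ℝ) + 1)) := by
  have hrate : {ω | p.R0 ≤ M.backhaulRate ω} = {ω | 0 ∈ M.sched ω} := by
    ext ω
    have := p.R0_pos
    by_cases h : 0 ∈ M.sched ω <;> simp [backhaulRate, h, this]
  have hm : MeasurableSet {ω | 0 ∈ M.sched ω} :=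
    M.sched_meas (MeasurableSet.of_discrete (s := {T : Finset ℕ | 0 ∈ T}))
  have hL : MeasurableSet {b : ℕ × (ℕ → Bool) × Finset ℕ | b.1 = l + 1} :=
    (measurableSet_singleton (l + 1)).preimage measurable_fst
  have hT : MeasurableSet {b : ℕ × (ℕ → Bool) × Finset ℕ | 0 ∈ b.2.2} :=
    (MeasurableSet.of_discrete (s := {T : Finset ℕ | 0 ∈ T})).preimage
      (f := fun b : ℕ × (ℕ → Bool) × Finset ℕ => b.2.2) (by fun_prop)
  have h1 := M.measure_assocMacro_inter n hL
  have h2 := M.measure_assocMacro_inter n (hL.inter hT)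
  have e1 : (fun ω => (M.load ω, (fun u => M.miss u ω), M.sched ω)) ⁻¹'
      {b : ℕ × (ℕ → Bool) × Finset ℕ | b.1 = l + 1} = {ω | M.load ω = l + 1} := rfl
  have e2 : (fun ω => (M.load ω, (fun u => M.miss u ω), M.sched ω)) ⁻¹'
      ({b : ℕ × (ℕ → Bool) × Finset ℕ | b.1 = l + 1} ∩ {b | 0 ∈ b.2.2}) =
      {ω | M.load ω = l + 1} ∩ {ω | 0 ∈ M.sched ω} := rfl
  rw [e1] at h1
  rw [e2] at h2
  have hpos : 0 < p.loadPMF l := p.loadPMF_pos hn (M.pLp_mem hn).1 l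
  -- By independence the association probability is a factor of both numerator and denominator;
  -- being positive, it cancels.
  have hA : 0 < (μ (M.assocMacro n)).toReal :=
    ENNReal.toReal_pos (M.measure_assocMacro_pos hn).ne' (measure_ne_top _ _)
  rw [hrate, Measure.real, ProbabilityTheory.cond_apply' hm, Set.inter_assoc, h1, h2,
    ENNReal.toReal_mul, ENNReal.toReal_inv, ENNReal.toReal_mul, ENNReal.toReal_mul]
  change ((μ (M.assocMacro n)).toReal * μ.real {ω | M.load ω = l + 1})⁻¹ *
    ((μ (M.assocMacro n)).toReal * μ.real ({ω | M.load ω = l + 1} ∩ {ω | 0 ∈ M.sched ω})) = _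
  rw [M.measureReal_load_inter_sched l, M.load_law l]
  field_simp

end Network

end HetNet

end

theorem lemma4 (p : HetNet.Params) {Ω : Type*} [MeasurableSpace Ω] (μ : Measure Ω)
    [IsProbabilityMeasure μ] (M : HetNet.Network p μ) (n : ℕ) (hn : n ∈ p.secondGroup) :
    ((∀ z : ℝ, 0 < z → Summable (fun l : ℕ => p.term z l)) ∧
      IntegrableOn (fun z : ℝ => ∑' l : ℕ, p.term z l) (Set.Ioi 0) ∧
      μ.real (M.accessSuccess n) = ∫ z in Set.Ioi (0 : ℝ), ∑' l : ℕ, p.term z l) ∧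
    (∀ l : ℕ,
      (ProbabilityTheory.cond μ (M.assocMacro n ∩ {ω | M.load ω = l + 1})).real
          {ω | p.R0 ≤ M.backhaulRate ω} =
        ∑ m ∈ Finset.range (l + 1),
          (l.choose m : ℝ) * (1 - p.pb) ^ (l - m) * p.pb ^ m *
            min 1 ((p.Nb : ℝ) / ((m : ℝ) + 1))) :=
  ⟨⟨fun _ hz => M.summable_term hn hz, M.access_formula hn⟩, fun l => M.cond_backhaul hn l⟩
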